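/- **Theorem.** There are a randomized algorithm and an absolute constant $C>0$ with the following property. Let $n\ge 2$, let $f:2^{[n]}\to\mathbb{R}$ be submodular, that is, $f(S\cup\{i\})-f(S)\ge f(T\cup\{i\})-f(T)$ for all $S\subseteq T\subseteq[n]$ and $i\notin T$, with $|f(S)|\le 1$ for all $S\subseteq[n]$, and let $\varepsilon>0$. Given $n$ and $\varepsilon$, and access to $f$ through an evaluation oracle, the algorithm returns a random set $S\subseteq[n]$ with $$\mathbb{E}\,f(S)\le \mathrm{OPT}+\varepsilon,\qquad \mathrm{OPT}=\min_{S\subseteq[n]}f(S),$$ and on every run its running time is at most $$C\left(1+n^{5/3}\,\varepsilon^{-2}\cdot\mathrm{EO}\cdot\log^4 n\right).$$ Here $\mathrm{EO}\ge 1$ is the time of one oracle call: given a linked list in memory that stores a permutation $P$ of $[n]$, and a position $0\le k\le n$, the oracle returns $f(\{P_1,\dots,P_k\})$. The machine is a real RAM: integer addition, subtraction, halving with rounding down and comparison, real addition, subtraction, multiplication, division and comparison, conversion of an integer to a real, indirectly addressed memory access, and drawing a random bit that is $1$ with a computed probability $p$ each take constant time. -/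

import Mathlib

/-- Submodularity as diminishing marginal returns. -/
def Submodular {n : ℕ} (f : Finset (Fin n) → ℝ) : Prop :=
  ∀ S T : Finset (Fin n), S ⊆ T → ∀ i, i ∉ T →
    f (insert i T) - f T ≤ f (insert i S) - f S

/-- `OPT`, the minimum of `f` over all subsets of the ground set. -/
noncomputable def optValue {n : ℕ} (f : Finset (Fin n) → ℝ) : ℝ :=
  Finset.univ.inf' Finset.univ_nonempty f

/-! ### A randomized real RAM with an evaluation oracle

The memory consists of banks of integer cells and banks of real cells. A program is a finite
syntactic object, so it uses finitely many banks. Addresses inside a bank are integers, and they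
can be computed (indirect addressing). Programs and their constants depend on nothing: the size of
the ground set and the accuracy are inputs, and the set function is accessible only through the
oracle command. -/

namespace RealRAM

/-- The memory, and the time that has elapsed. -/
structure State where
  int : ℕ → ℤ → ℤ
  real : ℕ → ℤ → ℝ
  time : ℝ

/-- Integer expressions; `get a i` reads cell `i` of integer bank `a`, and `half` is `⌊·/2⌋`. -/
inductive IntExpr where
  | const (c : ℤ)
  | get (a : ℕ) (i : IntExpr)
  | add (e₁ e₂ : IntExpr)
  | sub (e₁ e₂ : IntExpr)
  | half (e : IntExpr)

/-- Real expressions over the four operations, with rational constants. There is no rounding of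
reals to integers. -/
inductive RealExpr where
  | const (q : ℚ)
  | ofInt (e : IntExpr)
  | get (a : ℕ) (i : IntExpr)
  | add (e₁ e₂ : RealExpr)
  | sub (e₁ e₂ : RealExpr)
  | mul (e₁ e₂ : RealExpr)
  | div (e₁ e₂ : RealExpr)

/-- Tests: comparisons and their Boolean combinations. -/
inductive Test where
  | intLE (e₁ e₂ : IntExpr)
  | realLE (e₁ e₂ : RealExpr)
  | neg (t : Test)
  | conj (t₁ t₂ : Test)

/-- Commands. `flip p a i` stores in cell `i` of integer bank `a` a fresh random bit that is `1`
with probability `p`. `query elem next head pos a i` stores in cell `i` of real bank `a` the value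
of the set function on the first `pos` elements of the linked list that starts at address `head`,
whose node at address `p` carries the element `elem p` and the successor address `next p`. -/
inductive Command where
  | skip
  | setInt (a : ℕ) (i : IntExpr) (e : IntExpr)
  | setReal (a : ℕ) (i : IntExpr) (e : RealExpr)
  | flip (p : RealExpr) (a : ℕ) (i : IntExpr)
  | query (elem next : ℕ) (head pos : IntExpr) (a : ℕ) (i : IntExpr)
  | seq (c₁ c₂ : Command)
  | branch (t : Test) (c₁ c₂ : Command)
  | loop (t : Test) (c : Command)

noncomputable section

def State.writeInt (s : State) (a : ℕ) (i v : ℤ) : State :=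
  { s with int := Function.update s.int a (Function.update (s.int a) i v) }

def State.writeReal (s : State) (a : ℕ) (i : ℤ) (v : ℝ) : State :=
  { s with real := Function.update s.real a (Function.update (s.real a) i v) }

/-- Let `d` units of time pass. -/
def State.tick (s : State) (d : ℝ) : State :=
  { s with time := s.time + d }

def IntExpr.eval (s : State) : IntExpr → ℤ
  | .const c => c
  | .get a i => s.int a (i.eval s)
  | .add e₁ e₂ => e₁.eval s + e₂.eval s
  | .sub e₁ e₂ => e₁.eval s - e₂.eval s
  | .half e => e.eval s / 2

/-- Division by zero returns zero. -/
def RealExpr.eval (s : State) : RealExpr → ℝ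
  | .const q => (q : ℝ)
  | .ofInt e => (e.eval s : ℝ)
  | .get a i => s.real a (i.eval s)
  | .add e₁ e₂ => e₁.eval s + e₂.eval s
  | .sub e₁ e₂ => e₁.eval s - e₂.eval s
  | .mul e₁ e₂ => e₁.eval s * e₂.eval s
  | .div e₁ e₂ => e₁.eval s / e₂.eval s

def Test.Holds (s : State) : Test → Prop
  | .intLE e₁ e₂ => e₁.eval s ≤ e₂.eval s
  | .realLE e₁ e₂ => e₁.eval s ≤ e₂.eval s
  | .neg t => ¬ t.Holds s
  | .conj t₁ t₂ => t₁.Holds s ∧ t₂.Holds s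

/-- The linked list that starts at `head` stores the permutation `P` of the ground set, whose
elements are encoded as `0, …, n - 1`. -/
def Stores {n : ℕ} (elem next : ℤ → ℤ) (head : ℤ) (P : Equiv.Perm (Fin n)) : Prop :=
  ∀ j : Fin n, elem (next^[(j : ℕ)] head) = ((P j : ℕ) : ℤ)

/-- `P[k]`, the set of the first `k` elements of the permutation `P`. -/
def prefixSet {n : ℕ} (P : Equiv.Perm (Fin n)) (k : ℕ) : Finset (Fin n) :=
  Finset.univ.filter fun i => ((P.symm i : Fin n) : ℕ) < k

open Classical in
/-- The oracle's answer: `f (P[k])` if the list stores a permutation `P` of the ground set and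
`0 ≤ k ≤ n`; there is no answer otherwise. -/
def answer {n : ℕ} (f : Finset (Fin n) → ℝ) (elem next : ℤ → ℤ) (head k : ℤ) : Option ℝ :=
  if h : (∃ P : Equiv.Perm (Fin n), Stores elem next head P) ∧ 0 ≤ k ∧ k ≤ (n : ℤ) then
    some (f (prefixSet h.1.choose k.toNat))
  else none

/-- A random bit, `1` with probability `p` (truncated to `[0, 1]`) and `0` otherwise. -/
def coin (p : ℝ) : PMF ℤ :=
  (PMF.ofFintype
    (fun b : Bool => cond b (min (ENNReal.ofReal p) 1) (1 - min (ENNReal.ofReal p) 1))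
    (by simp)).map fun b => cond b 1 0

open Classical in
/-- The law of the state after running a command, with recursion depth at most the first argument.
The outcome `none` stands for a run that exceeds this depth or makes an invalid query.
A query costs `EO`, every other basic command and every test costs `1`. (The expressions in a
given program have bounded size, so charging for each operation in them would change running times
by at most a constant factor that depends on the program only.) -/
def run {n : ℕ} (f : Finset (Fin n) → ℝ) (EO : ℝ) : ℕ → Command → State → PMF (Option State)
  | 0, _, _ => PMF.pure none
  | _ + 1, .skip, s => PMF.pure (some (s.tick 1))
  | _ + 1, .setInt a i e, s =>
      PMF.pure (some ((s.writeInt a (i.eval s) (e.eval s)).tick 1))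
  | _ + 1, .setReal a i e, s =>
      PMF.pure (some ((s.writeReal a (i.eval s) (e.eval s)).tick 1))
  | _ + 1, .flip p a i, s =>
      (coin (p.eval s)).map fun b => some ((s.writeInt a (i.eval s) b).tick 1)
  | _ + 1, .query elem next head pos a i, s =>
      PMF.pure ((answer f (s.int elem) (s.int next) (head.eval s) (pos.eval s)).map
        fun v => (s.writeReal a (i.eval s) v).tick EO)
  | d + 1, .seq c₁ c₂, s =>
      (run f EO d c₁ s).bind fun o => o.elim (PMF.pure none) (run f EO d c₂)
  | d + 1, .branch t c₁ c₂, s =>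
      if t.Holds s then run f EO d c₁ (s.tick 1) else run f EO d c₂ (s.tick 1)
  | d + 1, .loop t c, s =>
      if t.Holds s then
        (run f EO d c (s.tick 1)).bind fun o => o.elim (PMF.pure none) (run f EO d (.loop t c))
      else PMF.pure (some (s.tick 1))

/-- The initial state: `n` is in cell `0` of integer bank `0`, `ε` is in cell `0` of real bank `0`,
all other cells are `0`. -/
def initial (n : ℕ) (ε : ℝ) : State where
  int := Function.update 0 0 (Function.update 0 0 (n : ℤ))
  real := Function.update 0 0 (Function.update 0 0 ε)
  time := 0

/-- The returned set: its members are marked by nonzero cells of integer bank `1`. -/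
def output (n : ℕ) (s : State) : Finset (Fin n) :=
  Finset.univ.filter fun i => s.int 1 ((i : ℕ) : ℤ) ≠ 0

/-- Every run of the program `c` on input `(n, ε)` with oracle `f` terminates without an invalid
query, and `μ` is the law of the final state. -/
def HaltsWithLaw {n : ℕ} (f : Finset (Fin n) → ℝ) (EO ε : ℝ) (c : Command) (μ : PMF State) :
    Prop :=
  ∃ d : ℕ, run f EO d c (initial n ε) = μ.map some

/-- The expectation of `f (S)` for the random set `S` that is returned when the law of the final
state is `μ`. -/
def expectedValue {n : ℕ} (f : Finset (Fin n) → ℝ) (μ : PMF State) : ℝ :=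
  ∑ S : Finset (Fin n), ((μ.map (output n)) S).toReal * f S

end

end RealRAM

/-! The program runs stochastic subgradient descent for the Lovász extension on the grid `{0, …,
K}^n`, where `K` is about `12/ε`. At a grid point `x`, the marginals of `f` along an order of
decreasing levels form a subgradient `g` (`sum_levels_le`, `gap_le_descent`). One step moves at most
one coordinate by one level: `i` is drawn with probability `w i / 12`, where `|g i| ≤ w i` and `∑ w
≤ 12`, and goes down with probability `(w i + g i) / (2 w i)`, up otherwise. This is an unbiased
one-sparse step, so the squared distance to `K · 1_S` falls in expectation by at least `⟨g, x - K ·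
1_S⟩ / 6 - 1` (`expected_step_le`). The descent is stopped at a uniformly random one of `n K²`
rounds and returns a uniformly random level set. The initial squared distance is at most `n K²`, so
the expected excess over the minimum is at most `12 / K ≤ ε` (`mainLoop_spec`, `pickLoop_spec`).

The time bound rests on cheap sampling. The rounds are grouped into stages of `m ≈ n^(1/3)` steps.
Elements moved in the current stage are marked; there are at most `m` of them, and each of their
marginals costs two queries. For unmarked elements, submodularity sandwiches the current marginal
between marginals in simpler orders, and the weights are built from these so that their prefix sums
in the fixed order of positions telescope: two values of `f`, a table made at the start of the
stage, and a sum over marked elements (`StageOrder.abs_marg_le_weight`, `StageOrder.sum_weight_lt`).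
A randomized binary search with `O(log n)` prefix sums then samples from `w` (`descentCmd_spec`).
Each query needs its permutation as a linked list; only the links of marked elements and of the last
unmarked one change, which takes `O(m)` time (`answer_linked`). A step costs `O((m + log n)(m +
EO))` and a new stage `O(m² + n · EO)`. With `n ≤ (m + 1)^3` both amount to `O(m² · EO)` per step,
hence `O(n^(5/3) ε⁻² EO)` in total (`mainCost_le`); the factor `log^4 n` is only slack.

Programs are verified by bounding expectations of costs with values in `[0, ∞]`. A failed run costs
`⊤`, and so does a late one, so a single finite bound yields termination, the time bound on every
run and the bound of the expectation (`exists_law`). -/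

open scoped ENNReal

namespace RealRAM

/-! ### Expected costs of runs, and proof rules for commands. -/

noncomputable section

/-- Expectation of a cost over the outcomes of a run; a failed run costs `⊤`. -/
def expect (φ : State → ℝ≥0∞) (q : PMF (Option State)) : ℝ≥0∞ :=
  ∑' o, q o * o.elim ⊤ φ

lemma expect_pure (φ : State → ℝ≥0∞) (o : Option State) :
    expect φ (PMF.pure o) = o.elim ⊤ φ := by
  classical
  unfold expect
  rw [tsum_eq_single o]
  · simp
  · intro b hb
    simp [PMF.pure_apply, hb]

lemma expect_mono {φ ψ : State → ℝ≥0∞} (h : ∀ s, φ s ≤ ψ s) (q : PMF (Option State)) :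
    expect φ q ≤ expect ψ q := by
  refine ENNReal.tsum_le_tsum fun o => ?_
  cases o with
  | none => exact le_rfl
  | some s => exact mul_le_mul_right (h s) _

lemma expect_bind {α : Type*} (φ : State → ℝ≥0∞) (q : PMF α) (k : α → PMF (Option State)) :
    expect φ (q.bind k) = ∑' x, q x * expect φ (k x) := by
  unfold expect
  simp only [PMF.bind_apply, ← ENNReal.tsum_mul_right, ← ENNReal.tsum_mul_left]
  rw [ENNReal.tsum_comm]
  simp only [mul_assoc]

/-- Failure is absorbing and costs `⊤` on both sides, so sequencing of runs becomes composition of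
expectations. -/
lemma expect_bind_elim (φ : State → ℝ≥0∞) (q : PMF (Option State))
    (k : State → PMF (Option State)) :
    expect φ (q.bind fun o => o.elim (PMF.pure none) k) = expect (fun s => expect φ (k s)) q := by
  rw [expect_bind]
  refine tsum_congr fun o => ?_
  cases o with
  | none => simp [expect_pure]
  | some s => rfl

lemma expect_coin_map (φ : State → ℝ≥0∞) (p : ℝ) (g : ℤ → State) :
    expect φ ((coin p).map fun b => some (g b)) =
      min (ENNReal.ofReal p) 1 * φ (g 1) + (1 - min (ENNReal.ofReal p) 1) * φ (g 0) := by
  unfold coin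
  rw [PMF.map_comp, ← PMF.bind_pure_comp, expect_bind, tsum_fintype]
  simp [expect_pure, PMF.ofFintype_apply]

section

variable {n : ℕ} (f : Finset (Fin n) → ℝ) (EO : ℝ)

/-- More depth can only replace outcomes `none`, which cost `⊤`, by genuine ones. Depth bounds of
subcommands can therefore be merged by taking a maximum. -/
lemma expect_run_succ_le (d : ℕ) : ∀ (c : Command) (s : State) (φ : State → ℝ≥0∞),
    expect φ (run f EO (d + 1) c s) ≤ expect φ (run f EO d c s) := by
  induction d with
  | zero => intro c s φ; simp [run, expect_pure]
  | succ d ih =>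
    intro c s φ
    cases c with
    | skip => exact le_rfl
    | setInt => exact le_rfl
    | setReal => exact le_rfl
    | flip => exact le_rfl
    | query => exact le_rfl
    | seq c₁ c₂ =>
      rw [run, run, expect_bind_elim, expect_bind_elim]
      exact (ih _ _ _).trans (expect_mono (fun s => ih _ _ _) _)
    | branch t c₁ c₂ =>
      rw [run, run]
      split_ifs
      · exact ih _ _ _
      · exact ih _ _ _
    | loop t c =>
      rw [run, run]
      split_ifs
      · rw [expect_bind_elim, expect_bind_elim]
        exact (ih _ _ _).trans (expect_mono (fun s => ih _ _ _) _)
      · exact le_rfl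

lemma expect_run_antitone {d e : ℕ} (h : d ≤ e) (c : Command) (s : State) (φ : State → ℝ≥0∞) :
    expect φ (run f EO e c s) ≤ expect φ (run f EO d c s) := by
  induction h with
  | refl => exact le_rfl
  | step _ ih => exact (expect_run_succ_le f EO _ c s φ).trans ih

/-- A run makes finitely many binary choices. `Bounded.seq` needs this to find one depth that works
for all intermediate states. -/
lemma finite_support_run (d : ℕ) : ∀ (c : Command) (s : State),
    (run f EO d c s).support.Finite := by
  have hb : ∀ (q : PMF (Option State)) (k : State → PMF (Option State)), q.support.Finite →
      (∀ s, (k s).support.Finite) →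
      (q.bind fun o => o.elim (PMF.pure none) k).support.Finite := by
    intro q k hq hk
    rw [PMF.support_bind]
    refine hq.biUnion fun o _ => ?_
    cases o with
    | none => simp
    | some s => exact hk s
  induction d with
  | zero => intro c s; simp [run]
  | succ d ih =>
    intro c s
    cases c with
    | skip => simp [run]
    | setInt => simp [run]
    | setReal => simp [run]
    | flip p a i =>
      rw [run, coin, PMF.map_comp, PMF.support_map]
      exact (Set.toFinite _).image _
    | query => simp [run]
    | seq c₁ c₂ => rw [run]; exact hb _ _ (ih _ _) (ih _)
    | branch t c₁ c₂ =>
      rw [run]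
      split_ifs
      · exact ih _ _
      · exact ih _ _
    | loop t c =>
      rw [run]
      split_ifs
      · exact hb _ _ (ih _ _) (ih _)
      · simp

/-- The command halts from `s`, and the expectation of `φ` at the final state is at most `v`. -/
def Bounded (c : Command) (s : State) (φ : State → ℝ≥0∞) (v : ℝ≥0∞) : Prop :=
  ∃ d, expect φ (run f EO d c s) ≤ v

open Classical in
/-- Every run of the command from `s` halts in a state with property `Q`. -/
def Ens (c : Command) (s : State) (Q : State → Prop) : Prop :=
  Bounded f EO c s (fun s' => if Q s' then 0 else ⊤) 0

variable {f EO}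

lemma Bounded.top (c : Command) (s : State) (φ : State → ℝ≥0∞) : Bounded f EO c s φ ⊤ :=
  ⟨0, le_top⟩

lemma Bounded.mono {c : Command} {s : State} {φ ψ : State → ℝ≥0∞} {v w : ℝ≥0∞}
    (h : Bounded f EO c s φ v) (hφ : ∀ s, ψ s ≤ φ s) (hv : v ≤ w) : Bounded f EO c s ψ w := by
  obtain ⟨d, hd⟩ := h
  exact ⟨d, (expect_mono hφ _).trans (hd.trans hv)⟩

/-- The function `ψ` plays the role of an intermediate assertion: a bound for the rest of the run,
depending on the intermediate state. -/
lemma Bounded.seq {c₁ c₂ : Command} {s : State} {φ ψ : State → ℝ≥0∞} {v : ℝ≥0∞}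
    (h₁ : Bounded f EO c₁ s ψ v) (h₂ : ∀ s', Bounded f EO c₂ s' φ (ψ s')) :
    Bounded f EO (.seq c₁ c₂) s φ v := by
  obtain ⟨d, hd⟩ := h₁
  choose D hD using h₂
  have hfin := finite_support_run f EO d c₁ s
  -- The depth `D s'` for the second command varies with `s'`; it is bounded over the finite
  -- support.
  obtain ⟨M, hM⟩ := (hfin.image fun o => o.elim 0 D).bddAbove
  refine ⟨max d M + 1, ?_⟩
  rw [run, expect_bind_elim]
  refine (expect_run_antitone f EO (le_max_left d M) _ _ _).trans (le_trans ?_ hd)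
  refine ENNReal.tsum_le_tsum fun o => ?_
  by_cases ho : o ∈ (run f EO d c₁ s).support
  · cases o with
    | none => exact le_rfl
    | some s' =>
      refine mul_le_mul_right ?_ _
      refine (expect_run_antitone f EO (le_trans ?_ (le_max_right d M)) _ _ _).trans (hD s')
      exact hM ⟨some s', ho, rfl⟩
  · rw [PMF.mem_support_iff, not_not] at ho
    simp [ho]

/-- A cost with values `0` and `⊤` has expectation `0` only if every outcome of positive probability
costs `0`; in particular no such outcome is a failure. -/
lemma Ens.exists_forall {c : Command} {s : State} {Q : State → Prop} (h : Ens f EO c s Q) :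
    ∃ d, ∀ o, run f EO d c s o ≠ 0 → ∃ s', o = some s' ∧ Q s' := by
  classical
  obtain ⟨d, hd⟩ := h
  refine ⟨d, fun o ho => ?_⟩
  have h0 := ENNReal.tsum_eq_zero.1 (le_antisymm hd bot_le) o
  rcases mul_eq_zero.1 h0 with h | h
  · exact absurd h ho
  · cases o with
    | none => simp at h
    | some s' => exact ⟨s', rfl, by simpa using h⟩

lemma Ens.bounded {c : Command} {s : State} {φ : State → ℝ≥0∞} {v : ℝ≥0∞}
    (h : Ens f EO c s fun s' => φ s' ≤ v) : Bounded f EO c s φ v := by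
  obtain ⟨d, hd⟩ := h.exists_forall
  refine ⟨d, ?_⟩
  calc expect φ (run f EO d c s) ≤ ∑' o, run f EO d c s o * v := by
        refine ENNReal.tsum_le_tsum fun o => ?_
        by_cases ho : run f EO d c s o = 0
        · simp [ho]
        · obtain ⟨s', rfl, hs'⟩ := hd o ho
          exact mul_le_mul_right hs' _
    _ = v := by rw [ENNReal.tsum_mul_right, PMF.tsum_coe, one_mul]

/-- The working rule for a first command whose random choices, if any, do not affect the bound: its
postcondition is the bound for the rest. States without that postcondition receive `ψ = ⊤`, where
nothing is left to prove. -/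
lemma Ens.seq_bounded {c₁ c₂ : Command} {s : State} {φ : State → ℝ≥0∞} {v : ℝ≥0∞}
    (h : Ens f EO c₁ s fun s' => Bounded f EO c₂ s' φ v) : Bounded f EO (.seq c₁ c₂) s φ v := by
  classical
  refine Bounded.seq (ψ := fun s' => if Bounded f EO c₂ s' φ v then v else ⊤) ?_ ?_
  · refine Ens.bounded (Bounded.mono h (fun s' => ?_) le_rfl)
    by_cases hs : Bounded f EO c₂ s' φ v <;> simp [hs]
  · intro s'
    by_cases hs : Bounded f EO c₂ s' φ v
    · simp [hs]
    · simp [hs, Bounded.top]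

lemma Ens.mono {c : Command} {s : State} {P Q : State → Prop} (h : Ens f EO c s P)
    (hPQ : ∀ s', P s' → Q s') : Ens f EO c s Q := by
  classical
  refine Bounded.mono h (fun s' => ?_) le_rfl
  by_cases hs : P s'
  · simp [hs, hPQ s' hs]
  · simp [hs]

lemma Ens.seq {c₁ c₂ : Command} {s : State} {Q : State → Prop}
    (h : Ens f EO c₁ s fun s' => Ens f EO c₂ s' Q) : Ens f EO (.seq c₁ c₂) s Q :=
  Ens.seq_bounded h

lemma Bounded.skip {s : State} {φ : State → ℝ≥0∞} {v : ℝ≥0∞} (h : φ (s.tick 1) ≤ v) :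
    Bounded f EO .skip s φ v :=
  ⟨1, by rw [run, expect_pure]; exact h⟩

lemma Bounded.setInt {a : ℕ} {i e : IntExpr} {s : State} {φ : State → ℝ≥0∞} {v : ℝ≥0∞}
    (h : φ ((s.writeInt a (i.eval s) (e.eval s)).tick 1) ≤ v) :
    Bounded f EO (.setInt a i e) s φ v :=
  ⟨1, by rw [run, expect_pure]; exact h⟩

lemma Bounded.setReal {a : ℕ} {i : IntExpr} {e : RealExpr} {s : State} {φ : State → ℝ≥0∞}
    {v : ℝ≥0∞} (h : φ ((s.writeReal a (i.eval s) (e.eval s)).tick 1) ≤ v) :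
    Bounded f EO (.setReal a i e) s φ v :=
  ⟨1, by rw [run, expect_pure]; exact h⟩

lemma Bounded.query {el nx : ℕ} {hd pos : IntExpr} {a : ℕ} {i : IntExpr} {s : State}
    {φ : State → ℝ≥0∞} {v : ℝ≥0∞} {x : ℝ}
    (hx : answer f (s.int el) (s.int nx) (hd.eval s) (pos.eval s) = some x)
    (h : φ ((s.writeReal a (i.eval s) x).tick EO) ≤ v) :
    Bounded f EO (.query el nx hd pos a i) s φ v :=
  ⟨1, by rw [run, expect_pure, hx]; exact h⟩

lemma Bounded.branch {t : Test} {c₁ c₂ : Command} {s : State} {φ : State → ℝ≥0∞} {v : ℝ≥0∞}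
    (h₁ : t.Holds s → Bounded f EO c₁ (s.tick 1) φ v)
    (h₂ : ¬ t.Holds s → Bounded f EO c₂ (s.tick 1) φ v) :
    Bounded f EO (.branch t c₁ c₂) s φ v := by
  by_cases ht : t.Holds s
  · obtain ⟨d, hd⟩ := h₁ ht
    exact ⟨d + 1, by rw [run, if_pos ht]; exact hd⟩
  · obtain ⟨d, hd⟩ := h₂ ht
    exact ⟨d + 1, by rw [run, if_neg ht]; exact hd⟩

lemma Bounded.loop_false {t : Test} {c : Command} {s : State} {φ : State → ℝ≥0∞} {v : ℝ≥0∞}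
    (ht : ¬ t.Holds s) (h : φ (s.tick 1) ≤ v) : Bounded f EO (.loop t c) s φ v :=
  ⟨1, by rw [run, if_neg ht, expect_pure]; exact h⟩

lemma Bounded.loop_true {t : Test} {c : Command} {s : State} {φ : State → ℝ≥0∞} {v : ℝ≥0∞}
    (ht : t.Holds s) (h : Bounded f EO (.seq c (.loop t c)) (s.tick 1) φ v) :
    Bounded f EO (.loop t c) s φ v := by
  obtain ⟨d, hd⟩ := h
  cases d with
  -- A run of depth `0` has cost `⊤`, so `v = ⊤` here.
  | zero => exact ⟨0, by simpa [run] using hd⟩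
  | succ d => exact ⟨d + 1, by rw [run, if_pos ht]; rw [run] at hd; exact hd⟩

lemma Bounded.flip {p : RealExpr} {a : ℕ} {i : IntExpr} {s : State} {φ : State → ℝ≥0∞}
    {x y : ℝ} (hp0 : 0 ≤ p.eval s) (hp1 : p.eval s ≤ 1) (hx : 0 ≤ x) (hy : 0 ≤ y)
    (h₁ : φ ((s.writeInt a (i.eval s) 1).tick 1) ≤ ENNReal.ofReal x)
    (h₀ : φ ((s.writeInt a (i.eval s) 0).tick 1) ≤ ENNReal.ofReal y) :
    Bounded f EO (.flip p a i) s φ (ENNReal.ofReal (p.eval s * x + (1 - p.eval s) * y)) := by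
  refine ⟨1, ?_⟩
  rw [run, expect_coin_map φ _ fun b => (s.writeInt a (i.eval s) b).tick 1]
  have hm : min (ENNReal.ofReal (p.eval s)) 1 = ENNReal.ofReal (p.eval s) :=
    min_eq_left (by simpa using hp1)
  have h1 : 1 - ENNReal.ofReal (p.eval s) = ENNReal.ofReal (1 - p.eval s) := by
    rw [ENNReal.ofReal_sub _ hp0, ENNReal.ofReal_one]
  rw [hm, h1, ENNReal.ofReal_add (by positivity) (mul_nonneg (by linarith) hy),
    ENNReal.ofReal_mul hp0, ENNReal.ofReal_mul (by linarith)]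
  gcongr

lemma Ens.skip {s : State} {Q : State → Prop} (h : Q (s.tick 1)) : Ens f EO .skip s Q :=
  Bounded.skip (by simp [h])

lemma Ens.setInt {a : ℕ} {i e : IntExpr} {s : State} {Q : State → Prop}
    (h : Q ((s.writeInt a (i.eval s) (e.eval s)).tick 1)) : Ens f EO (.setInt a i e) s Q :=
  Bounded.setInt (by simp [h])

lemma Ens.setReal {a : ℕ} {i : IntExpr} {e : RealExpr} {s : State} {Q : State → Prop}
    (h : Q ((s.writeReal a (i.eval s) (e.eval s)).tick 1)) : Ens f EO (.setReal a i e) s Q :=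
  Bounded.setReal (by simp [h])

lemma Ens.query {el nx : ℕ} {hd pos : IntExpr} {a : ℕ} {i : IntExpr} {s : State}
    {Q : State → Prop} {x : ℝ}
    (hx : answer f (s.int el) (s.int nx) (hd.eval s) (pos.eval s) = some x)
    (h : Q ((s.writeReal a (i.eval s) x).tick EO)) : Ens f EO (.query el nx hd pos a i) s Q :=
  Bounded.query hx (by simp [h])

lemma Ens.branch {t : Test} {c₁ c₂ : Command} {s : State} {Q : State → Prop}
    (h₁ : t.Holds s → Ens f EO c₁ (s.tick 1) Q) (h₂ : ¬ t.Holds s → Ens f EO c₂ (s.tick 1) Q) :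
    Ens f EO (.branch t c₁ c₂) s Q :=
  Bounded.branch h₁ h₂

lemma Ens.loop_false {t : Test} {c : Command} {s : State} {Q : State → Prop}
    (ht : ¬ t.Holds s) (h : Q (s.tick 1)) : Ens f EO (.loop t c) s Q :=
  Bounded.loop_false ht (by simp [h])

lemma Ens.loop_true {t : Test} {c : Command} {s : State} {Q : State → Prop}
    (ht : t.Holds s) (h : Ens f EO c (s.tick 1) fun s' => Ens f EO (.loop t c) s' Q) :
    Ens f EO (.loop t c) s Q :=
  Bounded.loop_true ht (Ens.seq h)

/-- A loop whose invariant carries a decreasing counter. -/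
lemma Ens.loop {t : Test} {c : Command} {Q : State → Prop} (I : ℕ → State → Prop)
    (hstep : ∀ k s, I k s → t.Holds s → Ens f EO c (s.tick 1) fun s' => ∃ l < k, I l s')
    (hend : ∀ k s, I k s → ¬ t.Holds s → Q (s.tick 1)) (k : ℕ) (s : State) (h : I k s) :
    Ens f EO (.loop t c) s Q := by
  induction k using Nat.strong_induction_on generalizing s with
  | _ k ih =>
    by_cases ht : t.Holds s
    · refine Ens.loop_true ht ((hstep k s h ht).mono ?_)
      rintro s' ⟨l, hl, hI⟩
      exact ih l hl s' hI
    · exact Ens.loop_false ht (hend k s h ht)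

end

/-! ### Effect of memory updates. -/

@[simp] lemma State.tick_int (s : State) (d : ℝ) : (s.tick d).int = s.int := rfl
@[simp] lemma State.tick_real (s : State) (d : ℝ) : (s.tick d).real = s.real := rfl
@[simp] lemma State.tick_time (s : State) (d : ℝ) : (s.tick d).time = s.time + d := rfl
@[simp] lemma State.writeInt_real (s : State) (a : ℕ) (i v : ℤ) :
    (s.writeInt a i v).real = s.real := rfl
@[simp] lemma State.writeInt_time (s : State) (a : ℕ) (i v : ℤ) :
    (s.writeInt a i v).time = s.time := rfl
@[simp] lemma State.writeReal_int (s : State) (a : ℕ) (i : ℤ) (v : ℝ) :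
    (s.writeReal a i v).int = s.int := rfl
@[simp] lemma State.writeReal_time (s : State) (a : ℕ) (i : ℤ) (v : ℝ) :
    (s.writeReal a i v).time = s.time := rfl

@[simp] lemma State.writeInt_int (s : State) (a b : ℕ) (i v : ℤ) :
    (s.writeInt a i v).int b = if b = a then Function.update (s.int a) i v else s.int b := by
  by_cases h : b = a
  · subst h; simp [State.writeInt]
  · simp [State.writeInt, h]

@[simp] lemma State.writeReal_real (s : State) (a b : ℕ) (i : ℤ) (v : ℝ) :
    (s.writeReal a i v).real b = if b = a then Function.update (s.real a) i v else s.real b := by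
  by_cases h : b = a
  · subst h; simp [State.writeReal]
  · simp [State.writeReal, h]

/-- `s'` agrees with `s` outside the listed integer banks and real banks. -/
def Same (I R : List ℕ) (s s' : State) : Prop :=
  (∀ b, b ∉ I → s'.int b = s.int b) ∧ ∀ b, b ∉ R → s'.real b = s.real b

lemma Same.trans {I R I' R' J S : List ℕ} {s s' s'' : State} (h : Same I R s s')
    (h' : Same I' R' s' s'') (hI : ∀ b, b ∈ I ∨ b ∈ I' → b ∈ J)
    (hR : ∀ b, b ∈ R ∨ b ∈ R' → b ∈ S) : Same J S s s'' := by
  refine ⟨fun b hb => ?_, fun b hb => ?_⟩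
  · rw [h'.1 b fun hm => hb (hI b (Or.inr hm)), h.1 b fun hm => hb (hI b (Or.inl hm))]
  · rw [h'.2 b fun hm => hb (hR b (Or.inr hm)), h.2 b fun hm => hb (hR b (Or.inl hm))]

end

noncomputable section

/-! ### Marginals of a submodular function along a linear order. -/

section Marginals

variable {n : ℕ} {α β : Type*} [LinearOrder α] [LinearOrder β]

/-- The elements that come before `i` in the order given by the key `κ`. -/
def below (κ : Fin n → α) (i : Fin n) : Finset (Fin n) :=
  Finset.univ.filter fun j => κ j < κ i

/-- The marginal value of `i` over its predecessors in the order given by `κ`. -/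
def marg (f : Finset (Fin n) → ℝ) (κ : Fin n → α) (i : Fin n) : ℝ :=
  f (insert i (below κ i)) - f (below κ i)

variable {f : Finset (Fin n) → ℝ} {κ : Fin n → α}

/-- Telescoping along the order: in an initial segment `S`, the predecessors of the last element are
exactly the other elements of `S`. -/
lemma eq_add_sum_marg (hκ : Function.Injective κ) (S : Finset (Fin n)) :
    (∀ i ∈ S, ∀ j, κ j < κ i → j ∈ S) → f S = f ∅ + ∑ i ∈ S, marg f κ i := by
  induction S using Finset.induction_on_max_value κ with
  | empty => simp
  | insert a s ha hmax ih =>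
    intro hS
    have hb : below κ a = s := by
      ext j
      simp only [below, Finset.mem_filter, Finset.mem_univ, true_and]
      constructor
      · intro hj
        rcases Finset.mem_insert.1 (hS a (Finset.mem_insert_self _ _) j hj) with h | h
        · subst h; exact absurd hj (lt_irrefl _)
        · exact h
      · intro hj
        refine lt_of_le_of_ne (hmax j hj) fun h => ha ?_
        rwa [hκ h] at hj
    have hs : ∀ i ∈ s, ∀ j, κ j < κ i → j ∈ s := by
      intro i hi j hj
      rcases Finset.mem_insert.1 (hS i (Finset.mem_insert_of_mem hi) j hj) with h | h
      · subst h; exact absurd hj (not_lt.2 (hmax i hi))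
      · exact h
    rw [Finset.sum_insert ha, marg, hb]
    linarith [ih hs]

lemma marg_le_of_below_subset {κ' : Fin n → β} (hf : Submodular f) {i : Fin n}
    (h : below κ i ⊆ below κ' i) : marg f κ' i ≤ marg f κ i :=
  hf _ _ h i (by simp [below])

/-- The marginal vector lies in the base polytope. For arbitrary `X` the telescoping loses, since
the true predecessors of an element contain its predecessors inside `X`. -/
lemma sum_marg_le (hf : Submodular f) (hκ : Function.Injective κ) (X : Finset (Fin n)) :
    ∑ i ∈ X, marg f κ i ≤ f X - f ∅ := by
  induction X using Finset.induction_on_max_value κ with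
  | empty => simp
  | insert a s ha hmax ih =>
    have hb : s ⊆ below κ a := by
      intro j hj
      simp only [below, Finset.mem_filter, Finset.mem_univ, true_and]
      refine lt_of_le_of_ne (hmax j hj) fun h => ha ?_
      rwa [hκ h] at hj
    have := hf _ _ hb a (by simp [below])
    rw [Finset.sum_insert ha, marg]
    linarith

lemma sum_marg_univ (hκ : Function.Injective κ) :
    ∑ i, marg f κ i = f Finset.univ - f ∅ := by
  rw [eq_add_sum_marg (f := f) hκ Finset.univ fun _ _ _ _ => Finset.mem_univ _]
  ring

/-- The witness is the set of elements with nonnegative marginal. -/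
lemma sum_max_zero_marg_le (hf : Submodular f) (hκ : Function.Injective κ) :
    ∃ X, ∑ i, max 0 (marg f κ i) ≤ f X - f ∅ := by
  refine ⟨Finset.univ.filter fun i => 0 ≤ marg f κ i, ?_⟩
  refine le_trans (le_of_eq ?_) (sum_marg_le hf hκ _)
  rw [Finset.sum_filter]
  refine Finset.sum_congr rfl fun i _ => ?_
  split_ifs with h
  · exact max_eq_right h
  · exact max_eq_left (not_le.1 h).le

/-- Negative parts are positive parts minus values, so the sum is at most `f X - f univ`. -/
lemma sum_max_zero_neg_marg_le (hf : Submodular f) (hκ : Function.Injective κ)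
    (hb : ∀ S, |f S| ≤ 1) : ∑ i, max 0 (-marg f κ i) ≤ 2 := by
  obtain ⟨X, hX⟩ := sum_max_zero_marg_le hf hκ
  have h : ∑ i, max 0 (-marg f κ i) = ∑ i, max 0 (marg f κ i) - ∑ i, marg f κ i := by
    rw [← Finset.sum_sub_distrib]
    refine Finset.sum_congr rfl fun i _ => ?_
    rcases le_total 0 (marg f κ i) with h | h
    · rw [max_eq_left (by linarith), max_eq_right h]; ring
    · rw [max_eq_right (by linarith), max_eq_left h]; ring
  rw [h, sum_marg_univ hκ]
  have h1 := abs_le.1 (hb X)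
  have h2 := abs_le.1 (hb Finset.univ)
  linarith

/-- From `|g| = 2 g⁺ - g`, the sum is at most `2 f X - f univ - f ∅`, four values bounded by `1`. -/
lemma sum_abs_marg_le (hf : Submodular f) (hκ : Function.Injective κ)
    (hb : ∀ S, |f S| ≤ 1) : ∑ i, |marg f κ i| ≤ 4 := by
  obtain ⟨X, hX⟩ := sum_max_zero_marg_le hf hκ
  have h : ∑ i, |marg f κ i| = 2 * ∑ i, max 0 (marg f κ i) - ∑ i, marg f κ i := by
    rw [Finset.mul_sum, ← Finset.sum_sub_distrib]
    refine Finset.sum_congr rfl fun i _ => ?_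
    rcases le_total 0 (marg f κ i) with h | h
    · rw [abs_of_nonneg h, max_eq_right h]; ring
    · rw [abs_of_nonpos h, max_eq_left h]; ring
  rw [h, sum_marg_univ hκ]
  have h1 := abs_le.1 (hb X)
  have h2 := abs_le.1 (hb Finset.univ)
  have h3 := abs_le.1 (hb ∅)
  linarith

/-- The first-order inequality for the Lovász extension at a point of an integer grid. -/
lemma sum_levels_le (hf : Submodular f) (hκ : Function.Injective κ) {K : ℤ} {cl : Fin n → ℤ}
    (hcl : ∀ i, 0 ≤ cl i ∧ cl i ≤ K) (hmono : ∀ i j, κ j < κ i → cl i ≤ cl j)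
    (S : Finset (Fin n)) :
    ∑ v ∈ Finset.Ico 0 K, (f (Finset.univ.filter fun i => v < cl i) - f S) ≤
      ∑ i, marg f κ i * ((cl i : ℝ) - K * if i ∈ S then 1 else 0) := by
  -- Layer-cake formula: `cl i` counts the levels `v` in `[0, K)` below it.
  have hcl' : ∀ i, (cl i : ℝ) = ∑ v ∈ Finset.Ico 0 K, if v < cl i then (1 : ℝ) else 0 := by
    intro i
    have : (Finset.Ico 0 K).filter (fun v => v < cl i) = Finset.Ico 0 (cl i) := by
      ext v
      simp only [Finset.mem_filter, Finset.mem_Ico]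
      have := hcl i
      omega
    rw [← Finset.sum_filter, this, Finset.sum_const, Int.card_Ico, nsmul_one]
    have h0 := (hcl i).1
    have : ((cl i - 0).toNat : ℤ) = cl i := by omega
    exact_mod_cast this.symm
  have hrhs : ∑ i, marg f κ i * ((cl i : ℝ) - K * if i ∈ S then 1 else 0) =
      ∑ v ∈ Finset.Ico 0 K, (∑ i ∈ Finset.univ.filter (fun i => v < cl i), marg f κ i -
        ∑ i ∈ S, marg f κ i) := by
    have h1 : ∀ v, ∑ i ∈ Finset.univ.filter (fun i => v < cl i), marg f κ i -
        ∑ i ∈ S, marg f κ i = ∑ i, marg f κ i * ((if v < cl i then (1 : ℝ) else 0) -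
          if i ∈ S then 1 else 0) := by
      intro v
      simp only [mul_sub, Finset.sum_sub_distrib, mul_ite, mul_one, mul_zero]
      rw [Finset.sum_filter, Finset.sum_ite_mem, Finset.univ_inter]
    simp only [h1]
    rw [Finset.sum_comm]
    refine Finset.sum_congr rfl fun i _ => ?_
    rw [← Finset.mul_sum, Finset.sum_sub_distrib, ← hcl' i, Finset.sum_const, Int.card_Ico,
      nsmul_eq_mul]
    have hK : 0 ≤ K := (hcl i).1.trans (hcl i).2
    have : (((K - 0).toNat : ℕ) : ℝ) = K := by
      have : ((K - 0).toNat : ℤ) = K := by omega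
      exact_mod_cast this
    rw [this]
  rw [hrhs]
  refine Finset.sum_le_sum fun v _ => ?_
  -- Level sets are initial segments of the order, so they telescope exactly; `S` only satisfies the
  -- base polytope inequality, which has the right direction.
  have h1 := eq_add_sum_marg (f := f) hκ (Finset.univ.filter fun i => v < cl i) (by
    intro i hi j hj
    simp only [Finset.mem_filter, Finset.mem_univ, true_and] at hi ⊢
    exact lt_of_lt_of_le hi (hmono i j hj))
  have h2 := sum_marg_le hf hκ S
  linarith

end Marginals

/-! ### The sampling weights of a stage. -/

section Stage

variable {n : ℕ}

/-- The members of `D`: marked elements of level above `v`, and those of level `v` whose mark is at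
most `r`. -/
def InFront (cl mk : ℤ → ℤ) (v r i : ℤ) : Prop :=
  v < cl i ∨ v ≤ cl i ∧ mk i ≤ r

open Classical in
/-- The first `k` positions without their marked elements, together with the marked elements in
front. -/
def askSet (n : ℕ) (pos cl mk : ℤ → ℤ) (v r k : ℤ) : Finset (Fin n) :=
  Finset.univ.filter fun i =>
    mk (i : ℕ) = 0 ∧ pos (i : ℕ) < k ∨ mk (i : ℕ) ≠ 0 ∧ InFront cl mk v r (i : ℕ)

lemma mem_askSet {n : ℕ} {pos cl mk : ℤ → ℤ} {v r k : ℤ} {i : Fin n} :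
    i ∈ askSet n pos cl mk v r k ↔ mk (i : ℕ) = 0 ∧ pos (i : ℕ) < k ∨
      mk (i : ℕ) ≠ 0 ∧ (v < cl (i : ℕ) ∨ v ≤ cl (i : ℕ) ∧ mk (i : ℕ) ≤ r) :=
  (@Finset.mem_filter _ _ (_) _ _).trans (by simp [InFront])

def posKey (n : ℕ) (pos : ℤ → ℤ) (i : Fin n) : ℤ := pos (i : ℕ)

/-- Decreasing levels; in a level, marked elements first. -/
def curKey (n : ℕ) (a : ℤ) (pos cl mk : ℤ → ℤ) (i : Fin n) : ℤ ×ₗ ℤ :=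
  toLex (-cl (i : ℕ), if mk (i : ℕ) = 0 then pos (i : ℕ) else mk (i : ℕ) - a - 1)

/-- The unmarked elements by position, then the marked elements. -/
def restKey (n : ℕ) (pos mk : ℤ → ℤ) (i : Fin n) : ℤ ×ₗ ℤ :=
  toLex (if mk (i : ℕ) = 0 then 0 else 1, if mk (i : ℕ) = 0 then pos (i : ℕ) else mk (i : ℕ))

/-- Here `pos` and `bl` are positions and levels fixed at the start of the stage, `cl` are current
levels, and `mk` numbers the marked elements by `1, …, a`, with `0` for unmarked ones. Unmarked
elements have not moved. -/
structure StageOrder (n : ℕ) (a : ℤ) (pos bl cl mk : ℤ → ℤ) : Prop where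
  pos_inj : ∀ i j : Fin n, pos (i : ℕ) = pos (j : ℕ) → i = j
  pos_nonneg : ∀ i : Fin n, 0 ≤ pos (i : ℕ)
  pos_lt : ∀ i : Fin n, pos (i : ℕ) < n
  mk_inj : ∀ i j : Fin n, mk (i : ℕ) = mk (j : ℕ) → mk (i : ℕ) ≠ 0 → i = j
  mk_nonneg : ∀ i : Fin n, 0 ≤ mk (i : ℕ)
  mk_le : ∀ i : Fin n, mk (i : ℕ) ≤ a
  cl_eq : ∀ i : Fin n, mk (i : ℕ) = 0 → cl (i : ℕ) = bl (i : ℕ)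
  sorted : ∀ i j : Fin n, pos (i : ℕ) < pos (j : ℕ) → bl (j : ℕ) ≤ bl (i : ℕ)

/-- An upper bound of the marginals in the current order whose prefix sums are cheap. -/
def weight (f : Finset (Fin n) → ℝ) (a : ℤ) (pos cl mk : ℤ → ℤ) (i : Fin n) : ℝ :=
  2 * max 0 (-marg f (posKey n pos) i) +
    if mk (i : ℕ) = 0 then
      2 * marg f (restKey n pos mk) i - marg f (curKey n a pos cl mk) i
    else |marg f (curKey n a pos cl mk) i|

namespace StageOrder

variable {a : ℤ} {pos bl cl mk : ℤ → ℤ} {f : Finset (Fin n) → ℝ}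

lemma posKey_inj (h : StageOrder n a pos bl cl mk) : Function.Injective (posKey n pos) :=
  fun i j hij => h.pos_inj i j hij

/-- Marks are at most `a`, so the shift by `a + 1` makes the keys of marked elements negative and
separates them from positions, which are nonnegative. -/
lemma curKey_inj (h : StageOrder n a pos bl cl mk) :
    Function.Injective (curKey n a pos cl mk) := by
  intro i j hij
  have h2 := congrArg (fun x => (ofLex x).2) hij
  simp only [curKey, ofLex_toLex] at h2
  have h3 := h.pos_nonneg i
  have h4 := h.pos_nonneg j
  have h5 := h.mk_le i
  have h6 := h.mk_le j
  split_ifs at h2 with hi hj hj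
  · exact h.pos_inj i j h2
  · omega
  · omega
  · exact h.mk_inj i j (by omega) hi

lemma restKey_inj (h : StageOrder n a pos bl cl mk) :
    Function.Injective (restKey n pos mk) := by
  intro i j hij
  have h1 := congrArg (fun x => (ofLex x).1) hij
  have h2 := congrArg (fun x => (ofLex x).2) hij
  simp only [restKey, ofLex_toLex] at h1 h2
  by_cases hi : mk (i : ℕ) = 0 <;> by_cases hj : mk (j : ℕ) = 0 <;> simp [hi, hj] at h1 h2
  · exact h.pos_inj i j h2
  · exact h.mk_inj i j h2 hi

lemma curKey_lt (i j : Fin n) : curKey n a pos cl mk j < curKey n a pos cl mk i ↔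
    cl (i : ℕ) < cl (j : ℕ) ∨ cl (j : ℕ) = cl (i : ℕ) ∧
      (if mk (j : ℕ) = 0 then pos (j : ℕ) else mk (j : ℕ) - a - 1) <
        (if mk (i : ℕ) = 0 then pos (i : ℕ) else mk (i : ℕ) - a - 1) := by
  rw [curKey, curKey, Prod.Lex.toLex_lt_toLex]
  simp only [neg_lt_neg_iff, neg_inj]

lemma restKey_lt (i j : Fin n) : restKey n pos mk j < restKey n pos mk i ↔
    (mk (j : ℕ) = 0 ∧ mk (i : ℕ) ≠ 0) ∨ (mk (j : ℕ) = 0 ∧ mk (i : ℕ) = 0 ∧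
      pos (j : ℕ) < pos (i : ℕ)) ∨ (mk (j : ℕ) ≠ 0 ∧ mk (i : ℕ) ≠ 0 ∧
      mk (j : ℕ) < mk (i : ℕ)) := by
  rw [restKey, restKey, Prod.Lex.toLex_lt_toLex]
  by_cases hi : mk (i : ℕ) = 0 <;> by_cases hj : mk (j : ℕ) = 0 <;> simp [hi, hj]

/-- Unmarked elements keep their base levels, hence their relative order. So the unmarked elements
at smaller positions, which are all predecessors of `i` in the rest order, also precede `i` in the
current order. -/
lemma marg_curKey_le_marg_restKey (h : StageOrder n a pos bl cl mk) (hf : Submodular f)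
    {i : Fin n} (hi : mk (i : ℕ) = 0) :
    marg f (curKey n a pos cl mk) i ≤ marg f (restKey n pos mk) i := by
  refine marg_le_of_below_subset hf fun j hj => ?_
  simp only [below, Finset.mem_filter, Finset.mem_univ, true_and] at hj ⊢
  rw [restKey_lt] at hj
  rw [curKey_lt]
  have hj' : mk (j : ℕ) = 0 ∧ pos (j : ℕ) < pos (i : ℕ) := by tauto
  rw [if_pos hi, if_pos hj'.1, h.cl_eq i hi, h.cl_eq j hj'.1]
  have := h.sorted j i hj'.2
  have := hj'.2
  omega

lemma marg_posKey_le_marg_restKey (hf : Submodular f) {i : Fin n} (hi : mk (i : ℕ) = 0) :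
    marg f (posKey n pos) i ≤ marg f (restKey n pos mk) i := by
  refine marg_le_of_below_subset hf fun j hj => ?_
  simp only [below, Finset.mem_filter, Finset.mem_univ, true_and] at hj ⊢
  rw [restKey_lt] at hj
  simp only [posKey]
  tauto

/-- Let `i` be unmarked with current, rest and position marginals `c`, `r`, `p`, and let `t = max 0
(-p)`, so that the weight is `w = 2t + 2r - c`. Then `w - c = 2t + 2(r - c) ≥ 0` because `c ≤ r`,
and `w + c = 2t + 2r ≥ 0` because `r ≥ p ≥ -t`. -/
lemma abs_marg_le_weight (h : StageOrder n a pos bl cl mk) (hf : Submodular f) (i : Fin n) :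
    |marg f (curKey n a pos cl mk) i| ≤ weight f a pos cl mk i := by
  unfold weight
  have h0 : 0 ≤ max 0 (-marg f (posKey n pos) i) := le_max_left _ _
  have h1 : -marg f (posKey n pos) i ≤ max 0 (-marg f (posKey n pos) i) := le_max_right _ _
  split_ifs with hi
  · have h2 := h.marg_curKey_le_marg_restKey hf hi
    have h3 := marg_posKey_le_marg_restKey (pos := pos) hf hi
    rw [abs_le]
    constructor <;> linarith
  · linarith

-- The three groups of terms contribute at most `2 · 2`, `2 · 2` and `4`. The rest marginals of the
-- unmarked elements have to be bounded through the value of `f` at the set of these elements.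
open Classical in
lemma sum_weight_le (h : StageOrder n a pos bl cl mk) (hf : Submodular f)
    (hb : ∀ S, |f S| ≤ 1) : ∑ i, weight f a pos cl mk i ≤ 12 := by
  have h1 := sum_max_zero_neg_marg_le hf h.posKey_inj hb
  have h2 := sum_abs_marg_le hf h.curKey_inj hb
  have h3 := sum_marg_le hf h.restKey_inj (Finset.univ.filter fun i : Fin n => mk (i : ℕ) = 0)
  have h4 : ∑ i, weight f a pos cl mk i ≤ 2 * ∑ i, max 0 (-marg f (posKey n pos) i) +
      2 * ∑ i ∈ Finset.univ.filter (fun i : Fin n => mk (i : ℕ) = 0),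
        marg f (restKey n pos mk) i + ∑ i, |marg f (curKey n a pos cl mk) i| := by
    rw [Finset.sum_filter, Finset.mul_sum, Finset.mul_sum, ← Finset.sum_add_distrib,
      ← Finset.sum_add_distrib]
    refine Finset.sum_le_sum fun i _ => ?_
    unfold weight
    split_ifs
    · linarith [neg_le_abs (marg f (curKey n a pos cl mk) i)]
    · linarith
  have h5 := abs_le.1 (hb (Finset.univ.filter fun i : Fin n => mk (i : ℕ) = 0))
  have h6 := abs_le.1 (hb ∅)
  linarith

open Classical in
/-- Prefix sums of the weights in terms of two values of `f`. -/
lemma sum_weight_lt (h : StageOrder n a pos bl cl mk) {K k v : ℤ}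
    (hK : ∀ i : Fin n, cl (i : ℕ) ≤ K)
    (hv₁ : ∀ i : Fin n, mk (i : ℕ) = 0 → pos (i : ℕ) < k → v ≤ bl (i : ℕ))
    (hv₂ : ∀ i : Fin n, mk (i : ℕ) = 0 → k ≤ pos (i : ℕ) → bl (i : ℕ) ≤ v) :
    2 * ∑ i ∈ Finset.univ.filter (fun i : Fin n => pos (i : ℕ) < k),
        max 0 (-marg f (posKey n pos) i) +
      2 * f (askSet n pos cl mk K 0 k) - f (askSet n pos cl mk v a k) +
      ∑ i ∈ Finset.univ.filter (fun i : Fin n => mk (i : ℕ) ≠ 0),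
        ((if InFront cl mk v a (i : ℕ) then marg f (curKey n a pos cl mk) i else 0) +
          if pos (i : ℕ) < k then |marg f (curKey n a pos cl mk) i| else 0) =
    f ∅ + ∑ i ∈ Finset.univ.filter (fun i : Fin n => pos (i : ℕ) < k),
      weight f a pos cl mk i := by
  -- No level exceeds `K` and no marked element has mark at most `0`, so this query contains
  -- unmarked elements only: an initial segment of the rest order.
  have e1 := eq_add_sum_marg (f := f) h.restKey_inj (askSet n pos cl mk K 0 k) (by
    intro i hi j hj
    simp only [mem_askSet] at hi ⊢
    rw [restKey_lt] at hj
    have := hK i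
    have := h.mk_nonneg i
    omega)
  -- The level `v` separates the unmarked elements before position `k` from those after it. Adding
  -- all marked elements of level at least `v` therefore gives an initial segment of the current
  -- order.
  have e2 := eq_add_sum_marg (f := f) h.curKey_inj (askSet n pos cl mk v a k) (by
    intro i hi j hj
    simp only [mem_askSet] at hi ⊢
    rw [curKey_lt] at hj
    have h1 := h.mk_le i
    have h2 := h.mk_le j
    have h3 := h.mk_nonneg i
    have h4 := h.mk_nonneg j
    have h5 := h.pos_nonneg i
    have h6 := h.pos_nonneg j
    have h7 := h.cl_eq i
    have h8 := h.cl_eq j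
    have h9 := hv₁ i
    have h10 := hv₂ j
    have h11 := h.sorted i j
    by_cases hi0 : mk (i : ℕ) = 0 <;> by_cases hj0 : mk (j : ℕ) = 0 <;>
      grind)
  rw [e1, e2]
  have s1 : ∑ i ∈ askSet n pos cl mk K 0 k, marg f (restKey n pos mk) i =
      ∑ i ∈ Finset.univ.filter (fun i : Fin n => pos (i : ℕ) < k),
        if mk (i : ℕ) = 0 then marg f (restKey n pos mk) i else 0 := by
    rw [askSet, Finset.sum_filter, Finset.sum_filter]
    refine Finset.sum_congr rfl fun i _ => ?_
    have h1 := hK i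
    have h2 := h.mk_nonneg i
    by_cases hi0 : mk (i : ℕ) = 0
    · simp [hi0]
    · have : ¬ InFront cl mk K 0 (i : ℕ) := by unfold InFront; omega
      simp [hi0, this]
  have s2 : ∑ i ∈ askSet n pos cl mk v a k, marg f (curKey n a pos cl mk) i =
      (∑ i ∈ Finset.univ.filter (fun i : Fin n => pos (i : ℕ) < k),
        if mk (i : ℕ) = 0 then marg f (curKey n a pos cl mk) i else 0) +
      ∑ i ∈ Finset.univ.filter (fun i : Fin n => mk (i : ℕ) ≠ 0),
        if InFront cl mk v a (i : ℕ) then marg f (curKey n a pos cl mk) i else 0 := by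
    rw [askSet, Finset.sum_filter, Finset.sum_filter, Finset.sum_filter,
      ← Finset.sum_add_distrib]
    refine Finset.sum_congr rfl fun i _ => ?_
    by_cases hi0 : mk (i : ℕ) = 0 <;> simp [hi0]
  have s3 : ∑ i ∈ Finset.univ.filter (fun i : Fin n => pos (i : ℕ) < k),
      weight f a pos cl mk i =
      2 * ∑ i ∈ Finset.univ.filter (fun i : Fin n => pos (i : ℕ) < k),
        max 0 (-marg f (posKey n pos) i) +
      2 * (∑ i ∈ Finset.univ.filter (fun i : Fin n => pos (i : ℕ) < k),
        if mk (i : ℕ) = 0 then marg f (restKey n pos mk) i else 0) -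
      (∑ i ∈ Finset.univ.filter (fun i : Fin n => pos (i : ℕ) < k),
        if mk (i : ℕ) = 0 then marg f (curKey n a pos cl mk) i else 0) +
      ∑ i ∈ Finset.univ.filter (fun i : Fin n => mk (i : ℕ) ≠ 0),
        if pos (i : ℕ) < k then |marg f (curKey n a pos cl mk) i| else 0 := by
    simp only [Finset.sum_filter, Finset.mul_sum]
    rw [← Finset.sum_add_distrib, ← Finset.sum_sub_distrib, ← Finset.sum_add_distrib]
    refine Finset.sum_congr rfl fun i _ => ?_
    unfold weight
    by_cases hi0 : mk (i : ℕ) = 0 <;> by_cases hk : pos (i : ℕ) < k <;> simp [hi0, hk]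
    ring
  rw [s1, s2, s3, Finset.sum_add_distrib]
  ring

/-- The marginal of a marked element as a difference of two answers. -/
lemma marg_of_marked (h : StageOrder n a pos bl cl mk) {i : Fin n} (hi : mk (i : ℕ) ≠ 0) {k : ℤ}
    (hk : ∀ j : Fin n, mk (j : ℕ) = 0 → (pos (j : ℕ) < k ↔ cl (i : ℕ) < bl (j : ℕ))) :
    marg f (curKey n a pos cl mk) i =
      f (askSet n pos cl mk (cl (i : ℕ)) (mk (i : ℕ)) k) -
        f (askSet n pos cl mk (cl (i : ℕ)) (mk (i : ℕ) - 1) k) := by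
  -- Within its level, `i` is preceded exactly by the marked elements with smaller marks; unmarked
  -- elements precede it only if their level is higher, and `k` cuts there.
  have hb : ∀ j : Fin n, j ∈ below (curKey n a pos cl mk) i ↔
      j ∈ askSet n pos cl mk (cl (i : ℕ)) (mk (i : ℕ) - 1) k := by
    intro j
    simp only [below, mem_askSet, Finset.mem_filter, Finset.mem_univ, true_and]
    rw [curKey_lt]
    have h1 := h.mk_le i
    have h6 := h.pos_nonneg j
    have h8 := h.cl_eq j
    have h9 := hk j
    by_cases hj0 : mk (j : ℕ) = 0 <;> grind
  have hc : ∀ j : Fin n, j ∈ insert i (below (curKey n a pos cl mk) i) ↔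
      j ∈ askSet n pos cl mk (cl (i : ℕ)) (mk (i : ℕ)) k := by
    intro j
    simp only [Finset.mem_insert, hb j, mem_askSet]
    by_cases hij : j = i
    · subst hij; simp [hi]
    · have := h.mk_inj i j
      have : mk (i : ℕ) = mk (j : ℕ) → False := fun he => hij (this he hi).symm
      omega
  rw [marg, Finset.ext hc, Finset.ext hb]

/-- The marginal of an unmarked element as a difference of two answers. -/
lemma marg_of_unmarked (h : StageOrder n a pos bl cl mk) {i : Fin n} (hi : mk (i : ℕ) = 0) :
    marg f (curKey n a pos cl mk) i =
      f (askSet n pos cl mk (bl (i : ℕ)) a (pos (i : ℕ) + 1)) -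
        f (askSet n pos cl mk (bl (i : ℕ)) a (pos (i : ℕ))) := by
  have hb : ∀ j : Fin n, j ∈ below (curKey n a pos cl mk) i ↔
      j ∈ askSet n pos cl mk (bl (i : ℕ)) a (pos (i : ℕ)) := by
    intro j
    simp only [below, mem_askSet, Finset.mem_filter, Finset.mem_univ, true_and]
    rw [curKey_lt, h.cl_eq i hi]
    have h1 := h.mk_le j
    have h6 := h.pos_nonneg i
    have h8 := h.cl_eq j
    have h9 := h.sorted i j
    have h10 := h.sorted j i
    have h11 := h.pos_inj i j
    by_cases hj0 : mk (j : ℕ) = 0 <;> grind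
  have hc : ∀ j : Fin n, j ∈ insert i (below (curKey n a pos cl mk) i) ↔
      j ∈ askSet n pos cl mk (bl (i : ℕ)) a (pos (i : ℕ) + 1) := by
    intro j
    simp only [Finset.mem_insert, hb j, mem_askSet]
    by_cases hij : j = i
    · subst hij; simp [hi]
    · have := h.pos_inj i j
      have : pos (i : ℕ) = pos (j : ℕ) → False := fun he => hij (this he).symm
      omega
  rw [marg, Finset.ext hc, Finset.ext hb]

end StageOrder

end Stage

/-! ### The squared distance as a potential. -/

section Potential

variable {n : ℕ}

/-- Squared distance of the grid point `cl` to the scaled indicator vector of `S`. -/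
def sqDist (K : ℤ) (S : Finset (Fin n)) (cl : Fin n → ℤ) : ℝ :=
  ∑ i, ((cl i : ℝ) - K * if i ∈ S then 1 else 0) ^ 2

lemma sqDist_nonneg (K : ℤ) (S : Finset (Fin n)) (cl : Fin n → ℤ) : 0 ≤ sqDist K S cl :=
  Finset.sum_nonneg fun _ _ => sq_nonneg _

lemma sqDist_update (K : ℤ) (S : Finset (Fin n)) (cl : Fin n → ℤ) (i : Fin n) (y : ℤ) :
    sqDist K S (Function.update cl i y) = sqDist K S cl -
      ((cl i : ℝ) - K * if i ∈ S then 1 else 0) ^ 2 + ((y : ℝ) - K * if i ∈ S then 1 else 0) ^ 2 := by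
  unfold sqDist
  rw [← Finset.add_sum_erase _ _ (Finset.mem_univ i), ← Finset.add_sum_erase _ _ (Finset.mem_univ i)]
  have : ∀ j ∈ Finset.univ.erase i,
      ((Function.update cl i y j : ℝ) - K * if j ∈ S then 1 else 0) ^ 2 =
        ((cl j : ℝ) - K * if j ∈ S then 1 else 0) ^ 2 := by
    intro j hj
    rw [Function.update_of_ne (Finset.ne_of_mem_erase hj)]
  rw [Finset.sum_congr rfl this, Function.update_self]
  ring

/-- Without clamping this is an identity. Clamping projects towards the box, which contains the
target vertex, so it does not increase the distance. -/
lemma sqDist_down (K : ℤ) (hK : 0 ≤ K) (S : Finset (Fin n)) (cl : Fin n → ℤ) (i : Fin n) :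
    sqDist K S (Function.update cl i (max 0 (cl i - 1))) ≤
      sqDist K S cl - 2 * ((cl i : ℝ) - K * if i ∈ S then 1 else 0) + 1 := by
  rw [sqDist_update]
  have hK' : (0 : ℝ) ≤ K := by exact_mod_cast hK
  push_cast
  rcases le_total 0 ((cl i : ℝ) - 1) with h | h
  · rw [max_eq_right h]; apply le_of_eq; ring
  · rw [max_eq_left h]; split_ifs <;> nlinarith

lemma sqDist_up (K : ℤ) (S : Finset (Fin n)) (cl : Fin n → ℤ) (hK : 0 ≤ K) (i : Fin n) :
    sqDist K S (Function.update cl i (min K (cl i + 1))) ≤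
      sqDist K S cl + 2 * ((cl i : ℝ) - K * if i ∈ S then 1 else 0) + 1 := by
  rw [sqDist_update]
  have hK' : (0 : ℝ) ≤ K := by exact_mod_cast hK
  push_cast
  rcases le_total (K : ℝ) ((cl i : ℝ) + 1) with h | h
  · rw [min_eq_left h]; split_ifs <;> nlinarith
  · rw [min_eq_right h]; apply le_of_eq; ring

/-- The potential after a random step along an unbiased estimate of the marginals. -/
lemma expected_step_le {w g u D U : Fin n → ℝ} {α β Ψ : ℝ} (hα : 0 ≤ α)
    (hw : ∀ i, |g i| ≤ w i) (hD : ∀ i, D i ≤ Ψ - 2 * u i + 1) (hU : ∀ i, U i ≤ Ψ + 2 * u i + 1)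
    (hs : ∑ i, w i ≤ 12) :
    (∑ i, w i * ((w i + g i) / (2 * w i) * (α * D i + β) +
        (1 - (w i + g i) / (2 * w i)) * (α * U i + β))) / 12 +
      (1 - (∑ i, w i) / 12) * (α * Ψ + β) ≤ α * (Ψ - (∑ i, g i * u i) / 6 + 1) + β := by
  -- Element `i` moves down with total probability `(w i + g i) / 24` and up with `(w i - g i) /
  -- 24`. The drift `-2 u i` times the difference `g i / 12` gives `-g i * u i / 6`, and the
  -- quadratic terms add up to `(∑ w) / 12 ≤ 1`.
  have h1 : ∑ i, w i * ((w i + g i) / (2 * w i) * (α * D i + β) +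
        (1 - (w i + g i) / (2 * w i)) * (α * U i + β)) ≤
      ∑ i, (w i * (α * Ψ + α + β) - 2 * α * (g i * u i)) := by
    refine Finset.sum_le_sum fun i _ => ?_
    have hg := abs_le.1 (hw i)
    rcases eq_or_lt_of_le ((abs_nonneg _).trans (hw i)) with h0 | h0
    -- At weight `0` the probability is a division by zero, but the factor `w i` removes the term.
    · have : g i = 0 := by linarith
      rw [← h0, this]; simp
    · have e1 : w i * ((w i + g i) / (2 * w i)) = (w i + g i) / 2 := by field_simp
      have e2 : w i * (1 - (w i + g i) / (2 * w i)) = (w i - g i) / 2 := by field_simp; ring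
      rw [mul_add, ← mul_assoc, ← mul_assoc, e1, e2]
      have h2 : α * D i + β ≤ α * (Ψ - 2 * u i + 1) + β := by gcongr; exact hD i
      have h3 : α * U i + β ≤ α * (Ψ + 2 * u i + 1) + β := by gcongr; exact hU i
      have h4 := mul_le_mul_of_nonneg_left h2 (by linarith : 0 ≤ (w i + g i) / 2)
      have h5 := mul_le_mul_of_nonneg_left h3 (by linarith : 0 ≤ (w i - g i) / 2)
      linarith
  rw [Finset.sum_sub_distrib, ← Finset.sum_mul, ← Finset.mul_sum] at h1
  have h6 : (∑ i, w i) * α ≤ 12 * α := by gcongr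
  linarith

end Potential

end

noncomputable section

/-! ### Linked lists and the oracle. -/

section Lists

lemma isChain_congr {nx nx' : ℤ → ℤ} {l : List ℤ} (h : ∀ x ∈ l, nx' x = nx x)
    (hl : l.IsChain fun x y => nx x = y) : l.IsChain fun x y => nx' x = y := by
  induction l with
  | nil => exact List.isChain_nil
  | cons x l ih =>
    rw [List.isChain_cons] at hl ⊢
    refine ⟨fun y hy => ?_, ih (fun z hz => h z (List.mem_cons_of_mem _ hz)) hl.2⟩
    rw [h x List.mem_cons_self]
    exact hl.1 y hy

lemma iterate_of_isChain {nx : ℤ → ℤ} {l : List ℤ} {head : ℤ}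
    (hl : l.IsChain fun x y => nx x = y) (hh : l.head? = some head) (j : ℕ) (hj : j < l.length) :
    nx^[j] head = l[j] := by
  induction j with
  | zero =>
    cases l with
    | nil => simp at hj
    | cons x l => simpa using hh.symm
  | succ j ih =>
    rw [Function.iterate_succ_apply', ih (by omega)]
    exact List.isChain_iff_getElem.1 hl j hj

/-- The oracle's answer on a linked list given by its sequence of addresses. -/
lemma answer_eq {n : ℕ} (f : Finset (Fin n) → ℝ) {el nx : ℤ → ℤ} {l₁ l₂ : List ℤ} {head : ℤ}
    (hel : ∀ x ∈ l₁ ++ l₂, el x = x) (hnd : (l₁ ++ l₂).Nodup)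
    (hmem : ∀ x, x ∈ l₁ ++ l₂ ↔ 0 ≤ x ∧ x < n) (hh : (l₁ ++ l₂).head? = some head)
    (hch : (l₁ ++ l₂).IsChain fun x y => nx x = y) {S : Finset (Fin n)}
    (hS : ∀ i : Fin n, i ∈ S ↔ ((i : ℕ) : ℤ) ∈ l₁) {k : ℤ} (hk : k = l₁.length) :
    answer f el nx head k = some (f S) := by
  classical
  subst hk
  have hlen : (l₁ ++ l₂).length = n := by
    have h1 : (l₁ ++ l₂).toFinset = Finset.Ico (0 : ℤ) n := by
      ext x; rw [List.mem_toFinset, hmem, Finset.mem_Ico]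
    have h2 := List.toFinset_card_of_nodup hnd
    rw [h1, Int.card_Ico] at h2
    omega
  have hval : ∀ j : Fin n, el (nx^[(j : ℕ)] head) = (l₁ ++ l₂)[(j : ℕ)]'(by omega) := by
    intro j
    rw [iterate_of_isChain hch hh _ (by omega)]
    exact hel _ (List.getElem_mem _)
  -- The list visits every number in `[0, n)` exactly once, so reading it off gives a bijection.
  have hex : ∃ P : Equiv.Perm (Fin n), Stores el nx head P := by
    have hr : ∀ j : Fin n, 0 ≤ (l₁ ++ l₂)[(j : ℕ)]'(by omega) ∧
        (l₁ ++ l₂)[(j : ℕ)]'(by omega) < n := fun j => (hmem _).1 (List.getElem_mem _)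
    let g : Fin n → Fin n := fun j =>
      ⟨((l₁ ++ l₂)[(j : ℕ)]'(by omega)).toNat, by have := hr j; omega⟩
    have hg : Function.Injective g := by
      intro i j hij
      have h1 : ((l₁ ++ l₂)[(i : ℕ)]'(by omega)).toNat = ((l₁ ++ l₂)[(j : ℕ)]'(by omega)).toNat :=
        congrArg Fin.val hij
      have h2 := hr i
      have h3 := hr j
      exact Fin.ext ((List.Nodup.getElem_inj_iff hnd).1
        (by omega : (l₁ ++ l₂)[(i : ℕ)] = (l₁ ++ l₂)[(j : ℕ)]))
    refine ⟨Equiv.ofBijective g (Finite.injective_iff_bijective.1 hg), fun j => ?_⟩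
    rw [hval j]
    have := hr j
    simp only [Equiv.ofBijective_apply, g]
    omega
  have hlen₁ : l₁.length ≤ n := by rw [← hlen, List.length_append]; omega
  have hc : (∃ P : Equiv.Perm (Fin n), Stores el nx head P) ∧ (0 : ℤ) ≤ l₁.length ∧
      (l₁.length : ℤ) ≤ n := ⟨hex, by omega, by omega⟩
  rw [answer, dif_pos hc]
  have hP := hc.1.choose_spec
  -- The oracle's permutation is an arbitrary choice. Only `Stores` is known about it, and this
  -- already determines its prefixes.
  generalize hc.1.choose = P at hP
  congr 2
  ext i
  rw [hS, prefixSet, Finset.mem_filter]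
  have h1 := hP (P.symm i)
  rw [hval, Equiv.apply_symm_apply] at h1
  simp only [Finset.mem_univ, true_and, Int.toNat_natCast]
  constructor
  · intro hlt
    rw [List.getElem_append_left hlt] at h1
    rw [← h1]
    exact List.getElem_mem _
  · intro hi
    obtain ⟨j, hj, hji⟩ := List.getElem_of_mem hi
    have h2 : (l₁ ++ l₂)[j]'(by omega) = (l₁ ++ l₂)[((P.symm i : Fin n) : ℕ)]'(by omega) := by
      rw [h1, List.getElem_append_left hj, hji]
    have := (List.Nodup.getElem_inj_iff hnd).1 h2
    omega

open Classical in
/-- The entries `T r`, `r < q`, with `P r`, last one first. -/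
def pick (P : ℕ → Prop) (T : ℤ → ℤ) : ℕ → List ℤ
  | 0 => []
  | q + 1 => if P q then T q :: pick P T q else pick P T q

lemma mem_pick {P : ℕ → Prop} {T : ℤ → ℤ} {q : ℕ} {x : ℤ} :
    x ∈ pick P T q ↔ ∃ r < q, P r ∧ T r = x := by
  induction q with
  | zero => simp [pick]
  | succ q ih =>
    rw [pick]
    split_ifs with h
    · rw [List.mem_cons, ih]
      constructor
      · rintro (rfl | ⟨r, hr, h1, h2⟩)
        · exact ⟨q, by omega, h, rfl⟩
        · exact ⟨r, by omega, h1, h2⟩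
      · rintro ⟨r, hr, h1, h2⟩
        rcases Nat.lt_succ_iff_lt_or_eq.1 hr with hr | rfl
        · exact Or.inr ⟨r, hr, h1, h2⟩
        · exact Or.inl h2.symm
    · rw [ih]
      constructor
      · rintro ⟨r, hr, h1, h2⟩
        exact ⟨r, by omega, h1, h2⟩
      · rintro ⟨r, hr, h1, h2⟩
        rcases Nat.lt_succ_iff_lt_or_eq.1 hr with hr | rfl
        · exact ⟨r, hr, h1, h2⟩
        · exact absurd h1 h

lemma nodup_pick {P : ℕ → Prop} {T : ℤ → ℤ} {q : ℕ}
    (hT : ∀ r s : ℕ, r < q → s < q → T r = T s → r = s) : (pick P T q).Nodup := by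
  induction q with
  | zero => simp [pick]
  | succ q ih =>
    have h1 := ih fun r s hr hs => hT r s (by omega) (by omega)
    rw [pick]
    split_ifs with h
    · refine List.nodup_cons.2 ⟨fun hm => ?_, h1⟩
      obtain ⟨r, hr, -, he⟩ := mem_pick.1 hm
      have := hT r q (by omega) (by omega) he
      omega
    · exact h1

end Lists

/-! ### Invariants of the arrays and links, and the answers to prepared queries. -/

/-- The ground set sorted by decreasing base level `bl`; `start v` counts the levels above `v`. -/
structure Base (n : ℕ) (K : ℕ) (arr pos bl start : ℤ → ℤ) : Prop where
  arr_neg : arr (-1) = -1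
  arr_n : arr n = n
  arr_mem : ∀ p : ℤ, 0 ≤ p → p < n → 0 ≤ arr p ∧ arr p < n
  pos_arr : ∀ p : ℤ, 0 ≤ p → p < n → pos (arr p) = p
  pos_mem : ∀ i : ℤ, 0 ≤ i → i < n → 0 ≤ pos i ∧ pos i < n
  arr_pos : ∀ i : ℤ, 0 ≤ i → i < n → arr (pos i) = i
  bl_mem : ∀ i : ℤ, 0 ≤ i → i < n → 0 ≤ bl i ∧ bl i ≤ K
  bl_n : bl n = 0
  start_mem : ∀ v : ℤ, 0 ≤ v → 0 ≤ start v ∧ start v ≤ n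
  start_iff : ∀ v p : ℤ, 0 ≤ v → 0 ≤ p → p < n → (v < bl (arr p) ↔ p < start v)

/-- The marked elements are `T 0, …, T (a - 1)`, and `T r` has mark `r + 1`. -/
structure Marks (n a : ℕ) (T mk : ℤ → ℤ) : Prop where
  T_mem : ∀ r : ℕ, r < a → 0 ≤ T r ∧ T r < n
  mk_T : ∀ r : ℕ, r < a → mk (T r) = r + 1
  T_mk : ∀ x : ℤ, mk x ≠ 0 → 1 ≤ mk x ∧ mk x ≤ a ∧ T (mk x - 1) = x

/-- The unmarked elements, in the order of their positions and with sentinels `-1` and `n`, form a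
doubly linked list. -/
def Linked (n : ℕ) (arr mk nx prv : ℤ → ℤ) : Prop :=
  ∀ p q : ℤ, -1 ≤ p → p < q → q ≤ n → mk (arr p) = 0 → mk (arr q) = 0 →
    (∀ z, p < z → z < q → mk (arr z) ≠ 0) → nx (arr p) = arr q ∧ prv (arr q) = arr p

section

variable {n K a : ℕ} {arr pos bl start T mk nx prv : ℤ → ℤ}

/-- With `Marks.mk_ge`, this keeps the sentinels `-1` and `n` unmarked. -/
lemma Marks.mk_neg (h : Marks n a T mk) {x : ℤ} (hx : x < 0) : mk x = 0 := by
  by_contra h0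
  obtain ⟨h1, h2, h3⟩ := h.T_mk x h0
  have h4 := h.T_mem (mk x - 1).toNat (by omega)
  rw [show (((mk x - 1).toNat : ℕ) : ℤ) = mk x - 1 by omega, h3] at h4
  omega

lemma Marks.mk_ge (h : Marks n a T mk) {x : ℤ} (hx : n ≤ x) : mk x = 0 := by
  by_contra h0
  obtain ⟨h1, h2, h3⟩ := h.T_mk x h0
  have h4 := h.T_mem (mk x - 1).toNat (by omega)
  rw [show (((mk x - 1).toNat : ℕ) : ℤ) = mk x - 1 by omega, h3] at h4
  omega

lemma Marks.T_inj (h : Marks n a T mk) (r s : ℕ) (hr : r < a) (hs : s < a) (he : T r = T s) :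
    r = s := by
  have h1 := h.mk_T r hr
  have h2 := h.mk_T s hs
  rw [he] at h1
  omega

lemma Marks.exists_T (h : Marks n a T mk) {x : ℤ} (hx : mk x ≠ 0) :
    ∃ r : ℕ, r < a ∧ T r = x ∧ mk x = r + 1 := by
  obtain ⟨h1, h2, h3⟩ := h.T_mk x hx
  refine ⟨(mk x - 1).toNat, by omega, ?_, by omega⟩
  rw [show (((mk x - 1).toNat : ℕ) : ℤ) = mk x - 1 by omega, h3]

/-- Sums over the table of marked elements. -/
lemma Marks.sum_range (h : Marks n a T mk) (w : ℤ → ℝ) :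
    ∑ r ∈ Finset.range a, w (T r) =
      ∑ i ∈ Finset.univ.filter (fun i : Fin n => mk (i : ℕ) ≠ 0), w (i : ℕ) := by
  refine Finset.sum_bij (fun r hr => (⟨(T r).toNat, ?_⟩ : Fin n)) ?_ ?_ ?_ ?_
  · have := h.T_mem r (Finset.mem_range.1 hr); omega
  · intro r hr
    have h1 := h.T_mem r (Finset.mem_range.1 hr)
    have h2 := h.mk_T r (Finset.mem_range.1 hr)
    simp only [Finset.mem_filter, Finset.mem_univ, true_and]
    rw [Int.toNat_of_nonneg h1.1, h2]
    omega
  · intro r hr s hs hrs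
    have h1 := h.T_mem r (Finset.mem_range.1 hr)
    have h2 := h.T_mem s (Finset.mem_range.1 hs)
    have h3 := congrArg Fin.val hrs
    simp only at h3
    exact h.T_inj r s (Finset.mem_range.1 hr) (Finset.mem_range.1 hs) (by omega)
  · intro i hi
    simp only [Finset.mem_filter, Finset.mem_univ, true_and] at hi
    obtain ⟨r, hr, h1, -⟩ := h.exists_T hi
    refine ⟨r, Finset.mem_range.2 hr, Fin.ext ?_⟩
    simp only
    omega
  · intro r hr
    have h1 := h.T_mem r (Finset.mem_range.1 hr)
    simp only
    rw [Int.toNat_of_nonneg h1.1]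

/-- The unmarked elements at the positions below `k`. -/
def unmarked (arr mk : ℤ → ℤ) (k : ℕ) : List ℤ :=
  ((List.range k).map fun p => arr (p : ℕ)).filter fun x => mk x = 0

lemma unmarked_succ (k : ℕ) : unmarked arr mk (k + 1) =
    unmarked arr mk k ++ if mk (arr k) = 0 then [arr k] else [] := by
  unfold unmarked
  rw [List.range_succ, List.map_append, List.filter_append]
  congr 1
  by_cases h : mk (arr k) = 0 <;> simp [h]

lemma mem_unmarked {k : ℕ} {x : ℤ} :
    x ∈ unmarked arr mk k ↔ mk x = 0 ∧ ∃ p < k, arr (p : ℕ) = x := by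
  unfold unmarked
  simp only [List.mem_filter, List.mem_map, List.mem_range, decide_eq_true_eq]
  tauto

lemma exists_unmarked_append {k l : ℕ} (h : k ≤ l) :
    ∃ l', unmarked arr mk l = unmarked arr mk k ++ l' := by
  induction h with
  | refl => exact ⟨[], by simp⟩
  | step _ ih =>
    obtain ⟨l', hl'⟩ := ih
    exact ⟨_, by rw [unmarked_succ, hl', List.append_assoc]⟩

lemma Base.arr_inj (hB : Base n K arr pos bl start) {p q : ℕ} (hp : p < n) (hq : q < n)
    (h : arr p = arr q) : p = q := by
  have h1 := hB.pos_arr p (by omega) (by omega)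
  have h2 := hB.pos_arr q (by omega) (by omega)
  rw [h] at h1
  omega

lemma Base.nodup_map (hB : Base n K arr pos bl start) {k : ℕ} (hk : k ≤ n) :
    ((List.range k).map fun p => arr (p : ℕ)).Nodup := by
  refine List.Nodup.map_on ?_ List.nodup_range
  intro p hp q hq h
  rw [List.mem_range] at hp hq
  exact hB.arr_inj (by omega) (by omega) h

lemma Base.nodup_unmarked (hB : Base n K arr pos bl start) {k : ℕ} (hk : k ≤ n) :
    (unmarked arr mk k).Nodup :=
  (hB.nodup_map hk).filter _

/-- The first `k` positions split into unmarked and marked elements. This converts a bound on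
positions into the length of the prefix of the relinked list that is handed to the oracle. -/
lemma length_unmarked (hB : Base n K arr pos bl start) (hM : Marks n a T mk) {k : ℕ}
    (hk : k ≤ n) : (unmarked arr mk k).length + (pick (fun r => pos (T r) < k) T a).length = k := by
  have h : (unmarked arr mk k ++ pick (fun r => pos (T r) < k) T a).Perm
      ((List.range k).map fun p => arr (p : ℕ)) := by
    rw [List.perm_ext_iff_of_nodup _ (hB.nodup_map hk)]
    · intro x
      rw [List.mem_append, mem_unmarked, mem_pick, List.mem_map]
      simp only [List.mem_range]
      constructor
      · rintro (⟨-, h⟩ | ⟨r, hr, h1, rfl⟩)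
        · exact h
        · have h2 := hM.T_mem r hr
          have h3 := hB.pos_mem _ h2.1 h2.2
          refine ⟨(pos (T r)).toNat, by omega, ?_⟩
          rw [Int.toNat_of_nonneg h3.1, hB.arr_pos _ h2.1 h2.2]
      · rintro ⟨p, hp, rfl⟩
        by_cases h0 : mk (arr p) = 0
        · exact Or.inl ⟨h0, p, hp, rfl⟩
        · obtain ⟨r, hr, h1, -⟩ := hM.exists_T h0
          refine Or.inr ⟨r, hr, ?_, h1⟩
          rw [h1, hB.pos_arr _ (by omega) (by omega)]
          omega
    · refine List.Nodup.append (hB.nodup_unmarked hk) (nodup_pick hM.T_inj) ?_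
      intro x hx hx'
      rw [mem_unmarked] at hx
      obtain ⟨r, hr, -, rfl⟩ := mem_pick.1 hx'
      have := hM.mk_T r hr
      omega
  have h2 := h.length_eq
  simpa using h2

/-- Links are described between consecutive unmarked positions only. The induction therefore carries
along the last unmarked position before `k`, which is initially the sentinel `-1`. -/
lemma Linked.exists_last (hB : Base n K arr pos bl start) (hM : Marks n a T mk)
    (hL : Linked n arr mk nx prv) (k : ℕ) (hk : k ≤ n) :
    ((-1 : ℤ) :: unmarked arr mk k).IsChain (fun x y => nx x = y) ∧
      ∃ p : ℤ, -1 ≤ p ∧ p < k ∧ mk (arr p) = 0 ∧ (∀ z, p < z → z < k → mk (arr z) ≠ 0) ∧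
        ((-1 : ℤ) :: unmarked arr mk k).getLast? = some (arr p) := by
  induction k with
  | zero =>
    refine ⟨by simp [unmarked], -1, le_rfl, by simp, ?_, by intro z h1 h2; omega, ?_⟩
    · rw [hB.arr_neg]; exact hM.mk_neg (by omega)
    · simp [unmarked, hB.arr_neg]
  | succ k ih =>
    obtain ⟨h1, p, h2, h3, h4, h5, h6⟩ := ih (by omega)
    rw [unmarked_succ]
    split_ifs with h0
    · rw [← List.cons_append]
      refine ⟨?_, k, by omega, by omega, h0, by intro z hz hz'; omega, by
        rw [List.getLast?_append]; simp⟩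
      rw [List.isChain_append]
      refine ⟨h1, by simp, ?_⟩
      intro x hx y hy
      rw [h6] at hx
      simp only [Option.mem_def, Option.some.injEq, List.head?_cons] at hx hy
      subst hx hy
      exact (hL p k h2 h3 (by omega) h4 h0 h5).1
    · rw [List.append_nil]
      refine ⟨h1, p, h2, by omega, h4, ?_, h6⟩
      intro z hz hz'
      by_cases he : z = k
      · subst he; exact h0
      · exact h5 z hz (by push_cast at hz'; omega)

/-- The list of all unmarked elements, read off the links. -/
lemma Linked.spec (hB : Base n K arr pos bl start) (hM : Marks n a T mk)
    (hL : Linked n arr mk nx prv) (ha : a < n) :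
    (unmarked arr mk n).IsChain (fun x y => nx x = y) ∧
      (unmarked arr mk n).head? = some (nx (-1)) ∧
      (unmarked arr mk n).getLast? = some (prv n) ∧ nx (prv n) = n := by
  obtain ⟨h1, p, h2, h3, h4, h5, h6⟩ := hL.exists_last hB hM n le_rfl
  -- Since `a < n`, some element is unmarked; an empty middle part would leave nothing to attach the
  -- marked elements to.
  have hne : unmarked arr mk n ≠ [] := by
    intro h
    have h7 := length_unmarked hB hM le_rfl
    rw [h, List.length_nil, zero_add] at h7
    have h8 : ∀ (P : ℕ → Prop) (q : ℕ), (pick P T q).length ≤ q := by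
      intro P q
      induction q with
      | zero => simp [pick]
      | succ q ih =>
        rw [pick]
        split_ifs
        · rw [List.length_cons]; omega
        · omega
    have := h8 (fun r => pos (T r) < n) a
    omega
  obtain ⟨x, l, hxl⟩ := List.exists_cons_of_ne_nil hne
  have hn := hL p n h2 h3 le_rfl h4 (by rw [hB.arr_n]; exact hM.mk_ge le_rfl) h5
  rw [hB.arr_n] at hn
  rw [hxl] at h1 h6 ⊢
  rw [List.isChain_cons_cons] at h1
  rw [List.getLast?_cons_cons] at h6
  refine ⟨h1.2, by simp [h1.1], ?_, ?_⟩
  · rw [h6, hn.2]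
  · rw [hn.2, hn.1]

/-- The answer to the query prepared by the relinking loop. -/
lemma answer_linked (hB : Base n K arr pos bl start) (hM : Marks n a T mk)
    (hL : Linked n arr mk nx prv) (ha : a < n) (f : Finset (Fin n) → ℝ) {el cl nx' : ℤ → ℤ}
    (hel : ∀ x : ℤ, 0 ≤ x → x < n → el x = x) {v r : ℤ} {k : ℕ} (hk : k ≤ n) {head back : ℤ}
    (hnx : ∀ x, mk x = 0 → nx' x = nx x)
    (hF : (pick (fun q => InFront cl mk v r (T q)) T a ++ [nx (-1)]).IsChain fun x y => nx' x = y)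
    (hFh : (pick (fun q => InFront cl mk v r (T q)) T a ++ [nx (-1)]).head? = some head)
    (hK : (pick (fun q => ¬ InFront cl mk v r (T q)) T a ++ [-1]).IsChain fun x y => nx' x = y)
    (hKh : (pick (fun q => ¬ InFront cl mk v r (T q)) T a ++ [-1]).head? = some back) {cnt : ℤ}
    (hc : cnt = k + (pick (fun q => InFront cl mk v r (T q)) T a).length -
      (pick (fun q => pos (T q) < k) T a).length) :
    answer f el (Function.update nx' (prv n) back) head cnt = some (f (askSet n pos cl mk v r k)) := by
  set F := pick (fun q => InFront cl mk v r (T q)) T a with hFdef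
  set G := pick (fun q => ¬ InFront cl mk v r (T q)) T a with hGdef
  obtain ⟨h1, h2, h3, -⟩ := hL.spec hB hM ha
  obtain ⟨U, hU⟩ := exists_unmarked_append (arr := arr) (mk := mk) hk
  have hlast : prv n ∈ unmarked arr mk n := List.mem_of_getLast? h3
  have hlast0 : mk (prv n) = 0 := (mem_unmarked.1 hlast).1
  have hmarked : ∀ x, x ∈ F ++ G → mk x ≠ 0 := by
    intro x hx
    have : ∃ q < a, T q = x := by
      rcases List.mem_append.1 hx with hx | hx
      · obtain ⟨q, hq, -, h⟩ := mem_pick.1 hx; exact ⟨q, hq, h⟩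
      · obtain ⟨q, hq, -, h⟩ := mem_pick.1 hx; exact ⟨q, hq, h⟩
    obtain ⟨q, hq, rfl⟩ := this
    have := hM.mk_T q hq
    omega
  have hFG : ∀ x, x ∈ F ++ G ↔ mk x ≠ 0 := by
    intro x
    refine ⟨hmarked x, fun hx => ?_⟩
    obtain ⟨q, hq, h4, -⟩ := hM.exists_T hx
    rw [List.mem_append, hFdef, hGdef, mem_pick, mem_pick]
    by_cases hp : InFront cl mk v r (T q)
    · exact Or.inl ⟨q, hq, hp, h4⟩
    · exact Or.inr ⟨q, hq, hp, h4⟩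
  have hF' : ∀ x, x ∈ F ↔ mk x ≠ 0 ∧ InFront cl mk v r x := by
    intro x
    rw [hFdef, mem_pick]
    constructor
    · rintro ⟨q, hq, h4, rfl⟩
      exact ⟨by have := hM.mk_T q hq; omega, h4⟩
    · rintro ⟨hx, h4⟩
      obtain ⟨q, hq, rfl, -⟩ := hM.exists_T hx
      exact ⟨q, hq, h4, rfl⟩
  have hVmem : ∀ x, x ∈ unmarked arr mk n ↔ mk x = 0 ∧ 0 ≤ x ∧ x < n := by
    intro x
    rw [mem_unmarked]
    refine and_congr_right fun _ => ?_
    constructor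
    · rintro ⟨p, hp, rfl⟩; exact hB.arr_mem p (by omega) (by omega)
    · rintro ⟨h4, h5⟩
      have h6 := hB.pos_mem x h4 h5
      refine ⟨(pos x).toNat, by omega, ?_⟩
      rw [Int.toNat_of_nonneg h6.1, hB.arr_pos x h4 h5]
  have hassoc : (F ++ unmarked arr mk k) ++ (U ++ G) = F ++ (unmarked arr mk n ++ G) := by
    rw [hU]; simp
  have hmem : ∀ x, x ∈ (F ++ unmarked arr mk k) ++ (U ++ G) ↔ 0 ≤ x ∧ x < n := by
    intro x
    have h4 := hFG x
    rw [List.mem_append] at h4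
    rw [hassoc, List.mem_append, List.mem_append, hVmem]
    by_cases hx : mk x = 0
    · simp only [hx, ne_eq, not_true, iff_false, not_or] at h4
      simp [hx, h4]
    · have h5 : 0 ≤ x ∧ x < n := by
        obtain ⟨q, hq, rfl, -⟩ := hM.exists_T hx
        exact hM.T_mem q hq
      simp only [hx, false_and, false_or, h5, and_self, iff_true]
      exact h4.2 hx
  -- The list read by the oracle: marked elements in front, all unmarked elements by position, the
  -- other marked elements. The prefix ends inside the unmarked part, after position `k`.
  refine answer_eq f (l₁ := F ++ unmarked arr mk k) (l₂ := U ++ G) ?_ ?_ hmem ?_ ?_ ?_ ?_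
  · intro x hx
    have := (hmem x).1 hx
    exact hel x this.1 this.2
  · rw [hassoc]
    refine List.Nodup.append (nodup_pick hM.T_inj) (List.Nodup.append (hB.nodup_unmarked le_rfl)
      (nodup_pick hM.T_inj) ?_) ?_
    · intro x hx hx'
      exact hmarked x (List.mem_append_right _ hx') ((hVmem x).1 hx).1
    · intro x hx hx'
      rcases List.mem_append.1 hx' with hx' | hx'
      · exact hmarked x (List.mem_append_left _ hx) ((hVmem x).1 hx').1
      · obtain ⟨q, hq, h4, rfl⟩ := mem_pick.1 hx'
        exact h4 ((hF' _).1 hx).2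
  · rw [hassoc, ← hFh]
    cases F with
    | nil => simp [h2]
    | cons x l => simp
  · rw [hassoc]
    -- The redirected node `prv n` is the last unmarked one, so the links of marked elements are
    -- unaffected.
    have hup : ∀ x, mk x ≠ 0 → Function.update nx' (prv n) back x = nx' x := by
      intro x hx
      refine Function.update_of_ne ?_ _ _
      rintro rfl
      exact hx hlast0
    have hFu : F.IsChain fun x y => Function.update nx' (prv n) back x = y :=
      isChain_congr (fun x hx => hup x (hmarked x (List.mem_append_left _ hx)))
        (List.isChain_append.1 hF).1
    have hGu : G.IsChain fun x y => Function.update nx' (prv n) back x = y :=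
      isChain_congr (fun x hx => hup x (hmarked x (List.mem_append_right _ hx)))
        (List.isChain_append.1 hK).1
    rw [List.isChain_append, List.isChain_append]
    refine ⟨hFu, ⟨?_, hGu, ?_⟩, ?_⟩
    · obtain ⟨W, hW⟩ := List.getLast?_eq_some_iff.1 h3
      have hnd : (unmarked arr mk n).Nodup := hB.nodup_unmarked le_rfl
      rw [hW] at h1 hnd ⊢
      rw [List.isChain_append] at h1 ⊢
      refine ⟨isChain_congr ?_ h1.1, by simp, ?_⟩
      · intro x hx
        have hx0 : mk x = 0 := ((hVmem x).1 (by rw [hW]; exact List.mem_append_left _ hx)).1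
        rw [Function.update_of_ne, hnx x hx0]
        rintro rfl
        exact (List.nodup_append.1 hnd).2.2 _ hx _ (by simp) rfl
      · intro x hx y hy
        have hx' := List.mem_of_getLast? hx
        have hx0 : mk x = 0 := ((hVmem x).1 (by rw [hW]; exact List.mem_append_left _ hx')).1
        rw [Function.update_of_ne, hnx x hx0]
        · exact h1.2.2 x hx y hy
        · rintro rfl
          exact (List.nodup_append.1 hnd).2.2 _ hx' _ (by simp) rfl
    · intro x hx y hy
      rw [h3] at hx
      obtain rfl : prv n = x := by simpa using hx
      rw [Function.update_self]
      cases hG : G with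
      | nil => rw [hG] at hy; simp at hy
      | cons z l =>
        rw [hG] at hy hKh
        simp only [List.head?_cons, Option.mem_def, Option.some.injEq, List.cons_append] at hy hKh
        rw [← hy, hKh]
    · intro x hx y hy
      have hx' := List.mem_of_getLast? hx
      rw [hup x (hmarked x (List.mem_append_left _ hx'))]
      have h4 := (List.isChain_append.1 hF).2.2 x hx (nx (-1)) (by simp)
      rw [h4]
      have h5 : (unmarked arr mk n ++ G).head? = some (nx (-1)) := by
        rw [List.head?_append, h2]; rfl
      rw [h5] at hy
      simpa using hy
  · intro i
    rw [mem_askSet, List.mem_append, hF', mem_unmarked]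
    have h4 := hB.pos_mem (i : ℕ) (by omega) (by omega)
    have h5 := hB.arr_pos (i : ℕ) (by omega) (by omega)
    rw [or_comm]
    refine or_congr Iff.rfl (and_congr_right fun _ => ?_)
    constructor
    · intro h
      refine ⟨(pos (i : ℕ)).toNat, by omega, ?_⟩
      rw [Int.toNat_of_nonneg h4.1, h5]
    · rintro ⟨p, hp, h⟩
      rw [← h, hB.pos_arr _ (by omega) (by omega)]
      omega
  · have := length_unmarked hB hM hk
    rw [hc, List.length_append]
    push_cast
    omega

end

end

/-! ### Frame rule: which banks a command can change. -/

/-- The integer banks that a command can write. -/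
def Command.ints : Command → List ℕ
  | .skip => []
  | .setInt a _ _ => [a]
  | .setReal _ _ _ => []
  | .flip _ a _ => [a]
  | .query _ _ _ _ _ _ => []
  | .seq c₁ c₂ => c₁.ints ++ c₂.ints
  | .branch _ c₁ c₂ => c₁.ints ++ c₂.ints
  | .loop _ c => c.ints

/-- The real banks that a command can write. -/
def Command.reals : Command → List ℕ
  | .skip => []
  | .setInt _ _ _ => []
  | .setReal a _ _ => [a]
  | .flip _ _ _ => []
  | .query _ _ _ _ a _ => [a]
  | .seq c₁ c₂ => c₁.reals ++ c₂.reals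
  | .branch _ c₁ c₂ => c₁.reals ++ c₂.reals
  | .loop _ c => c.reals

noncomputable section

lemma Same.refl (I R : List ℕ) (s : State) : Same I R s s :=
  ⟨fun _ _ => rfl, fun _ _ => rfl⟩

lemma Same.tick_left {I R : List ℕ} {s s' : State} {d : ℝ} (h : Same I R (s.tick d) s') :
    Same I R s s' := h

section

variable {n : ℕ} (f : Finset (Fin n) → ℝ) (EO : ℝ)

/-- The frame is read off the syntax, so that specifications need not list untouched banks;
membership in it is settled by `decide`. -/
lemma same_of_mem_support_run (d : ℕ) : ∀ (c : Command) (s s' : State),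
    some s' ∈ (run f EO d c s).support → Same c.ints c.reals s s' := by
  have hb : ∀ (q : PMF (Option State)) (k : State → PMF (Option State)) (s' : State),
      some s' ∈ (q.bind fun o => o.elim (PMF.pure none) k).support →
      ∃ t, some t ∈ q.support ∧ some s' ∈ (k t).support := by
    intro q k s' h
    rw [PMF.mem_support_bind_iff] at h
    obtain ⟨o, ho, h⟩ := h
    cases o with
    | none => simp at h
    | some t => exact ⟨t, ho, h⟩
  induction d with
  | zero => intro c s s' h; simp [run] at h
  | succ d ih =>
    intro c s s' h
    cases c with
    | skip =>
      simp only [run, PMF.support_pure, Set.mem_singleton_iff, Option.some.injEq] at h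
      subst h
      exact Same.refl _ _ _
    | setInt a i e =>
      simp only [run, PMF.support_pure, Set.mem_singleton_iff, Option.some.injEq] at h
      subst h
      refine ⟨fun b hb => ?_, fun b hb => rfl⟩
      simp only [Command.ints, List.mem_singleton] at hb
      simp [hb]
    | setReal a i e =>
      simp only [run, PMF.support_pure, Set.mem_singleton_iff, Option.some.injEq] at h
      subst h
      refine ⟨fun b hb => rfl, fun b hb => ?_⟩
      simp only [Command.reals, List.mem_singleton] at hb
      simp [hb]
    | flip p a i =>
      rw [run, PMF.support_map] at h
      obtain ⟨x, -, hx⟩ := h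
      simp only [Option.some.injEq] at hx
      subst hx
      refine ⟨fun b hb => ?_, fun b hb => rfl⟩
      simp only [Command.ints, List.mem_singleton] at hb
      simp [hb]
    | query el nx hd pos a i =>
      simp only [run, PMF.support_pure, Set.mem_singleton_iff] at h
      obtain ⟨x, -, hx⟩ := Option.map_eq_some_iff.1 h.symm
      subst hx
      refine ⟨fun b hb => rfl, fun b hb => ?_⟩
      simp only [Command.reals, List.mem_singleton] at hb
      simp [hb]
    | seq c₁ c₂ =>
      rw [run] at h
      obtain ⟨t, h1, h2⟩ := hb _ _ _ h
      exact (ih _ _ _ h1).trans (ih _ _ _ h2) (fun b hb => List.mem_append.2 hb)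
        (fun b hb => List.mem_append.2 hb)
    | branch t c₁ c₂ =>
      rw [run] at h
      split_ifs at h
      · exact (Same.refl [] [] s).trans (ih _ _ _ h).tick_left
          (fun b hb => List.mem_append.2 (Or.inl (by simpa using hb)))
          (fun b hb => List.mem_append.2 (Or.inl (by simpa using hb)))
      · exact (Same.refl [] [] s).trans (ih _ _ _ h).tick_left
          (fun b hb => List.mem_append.2 (Or.inr (by simpa using hb)))
          (fun b hb => List.mem_append.2 (Or.inr (by simpa using hb)))
    | loop t c =>
      rw [run] at h
      split_ifs at h
      · obtain ⟨u, h1, h2⟩ := hb _ _ _ h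
        exact (ih _ _ _ h1).tick_left.trans (ih _ _ _ h2) (fun b hb => by simpa [Command.ints] using hb)
          (fun b hb => by simpa [Command.reals] using hb)
      · simp only [PMF.support_pure, Set.mem_singleton_iff, Option.some.injEq] at h
        subst h
        exact Same.refl _ _ _

variable {f EO}

/-- A command changes only the banks that it writes. -/
lemma Ens.frame {c : Command} {s : State} {Q : State → Prop} (h : Ens f EO c s Q) :
    Ens f EO c s fun s' => Same c.ints c.reals s s' ∧ Q s' := by
  classical
  obtain ⟨d, hd⟩ := h.exists_forall
  refine ⟨d, le_of_eq (ENNReal.tsum_eq_zero.2 fun o => ?_)⟩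
  by_cases ho : run f EO d c s o = 0
  · simp [ho]
  · obtain ⟨s', rfl, hs'⟩ := hd o ho
    have := same_of_mem_support_run f EO d c s s' ((PMF.mem_support_iff _ _).2 ho)
    simp [this, hs']

/-- A loop whose invariant carries a decreasing counter; only the banks that the body writes change
during the loop. -/
lemma Ens.loop_frame {t : Test} {c : Command} {Q : State → Prop} {s₀ : State}
    (I : ℕ → State → Prop)
    (hstep : ∀ k s, Same c.ints c.reals s₀ s → I k s → t.Holds s →
      Ens f EO c (s.tick 1) fun s' => ∃ l < k, I l s')
    (hend : ∀ k s, Same c.ints c.reals s₀ s → I k s → ¬ t.Holds s → Q (s.tick 1))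
    {k : ℕ} (h : I k s₀) : Ens f EO (.loop t c) s₀ Q := by
  refine Ens.loop (fun k s => Same c.ints c.reals s₀ s ∧ I k s) ?_ ?_ k s₀
    ⟨Same.refl _ _ _, h⟩
  · rintro k s ⟨hs, hI⟩ ht
    refine (hstep k s hs hI ht).frame.mono ?_
    rintro s' ⟨hs', l, hl, hI'⟩
    exact ⟨l, hl, hs.trans hs'.tick_left (by simp) (by simp), hI'⟩
  · rintro k s ⟨hs, hI⟩ ht
    exact hend k s hs hI ht

end

end

/-! ### Shorthands for programs, and the query routine. -/

/-- The scalar in cell `0` of an integer bank. -/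
abbrev iv (b : ℕ) : IntExpr := .get b (.const 0)

/-- The scalar in cell `0` of a real bank. -/
abbrev rv (b : ℕ) : RealExpr := .get b (.const 0)

abbrev setI (b : ℕ) (e : IntExpr) : Command := .setInt b (.const 0) e

abbrev setR (b : ℕ) (e : RealExpr) : Command := .setReal b (.const 0) e

infixr:60 " ;; " => Command.seq

abbrev ltI (e₁ e₂ : IntExpr) : Test := .intLE (.add e₁ (.const 1)) e₂

/-! ### Memory layout

Integer banks: `0` the size `n`, `1` the output, `2` the number `K` of levels, `3` the length of a
stage, `4` the number of steps, `5` the number of steps in the stage, `6` the flag of the main loop,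
`7` the number of marked elements, `8` the array of elements, `9` positions, `10` base levels, `11`
current levels, `12` starts of levels, `13` the identity, `14` and `15` the links, `16` the table of
marked elements, `17` marks, `18`, `19`, `20` the arguments of `askCmd`, `21` to `32` scratch.
Real banks: `0` the accuracy, `1` prefix sums of negative parts, `2` the answer, `3` and `9`
marginals of marked elements and their absolute values, `4` the accumulator, `5` to `8` scratch. -/

/-- The relation `InFront` for the table entry with index `iv 21`, its disjunctions written with
`neg` and `conj`. This entry has mark `iv 21 + 1`, so "mark at most `r`" becomes a strict comparison
of the index with `iv 19`. -/
def frontTest : Test :=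
  .neg (.conj (.neg (ltI (iv 18) (.get 11 (iv 25))))
    (.neg (.conj (.intLE (iv 18) (.get 11 (iv 25))) (ltI (iv 21) (iv 19)))))

/-- Pushes the element on one of two stacks made of links: bank `22` heads the front stack, which
ends at the first unmarked element, and bank `23` heads the back stack, which ends at `-1`. Bank
`24` accumulates the prefix length. -/
def linkStep : Command :=
  .branch frontTest
    (.setInt 14 (iv 25) (iv 22) ;; setI 22 (iv 25) ;; setI 24 (.add (iv 24) (.const 1)) ;;
      setR 4 (.add (rv 4) (.get 3 (iv 21))))
    (.setInt 14 (iv 25) (iv 23) ;; setI 23 (iv 25))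

/-- A marked element at a position below `k` is not in the unmarked part of the list, so it must not
count towards the prefix length. -/
def countStep : Command :=
  .branch (ltI (.get 9 (iv 25)) (iv 20))
    (setI 24 (.sub (iv 24) (.const 1)) ;; setR 4 (.add (rv 4) (.get 9 (iv 21))))
    .skip

def linkBody : Command :=
  setI 25 (.get 16 (iv 21)) ;; linkStep ;; countStep ;; setI 21 (.add (iv 21) (.const 1))

def linkLoop : Command := .loop (ltI (iv 21) (iv 7)) linkBody

/-- Ask for the value of `askSet`; also sum up the marginals of the marked elements in front, and
the absolute values of those of the marked elements at smaller positions. -/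
def askCmd : Command :=
  setI 22 (.get 14 (.const (-1))) ;; setI 23 (.const (-1)) ;; setI 24 (iv 20) ;;
  setR 4 (.const 0) ;; setI 21 (.const 0) ;; linkLoop ;;
  .setInt 14 (.get 15 (iv 0)) (iv 23) ;; .query 13 14 (iv 22) (iv 24) 2 (.const 0) ;;
  .setInt 14 (.get 15 (iv 0)) (iv 0)

noncomputable section

/-- The data of a stage with `a` marked elements. -/
structure Stage (n K a : ℕ) (s : State) : Prop where
  hn : s.int 0 0 = n
  hK : s.int 2 0 = K
  ha : s.int 7 0 = a
  base : Base n K (s.int 8) (s.int 9) (s.int 10) (s.int 12)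
  marks : Marks n a (s.int 16) (s.int 17)
  link : Linked n (s.int 8) (s.int 17) (s.int 14) (s.int 15)
  idn : ∀ x : ℤ, 0 ≤ x → x < n → s.int 13 x = x
  cl_mem : ∀ x : ℤ, 0 ≤ x → x < n → 0 ≤ s.int 11 x ∧ s.int 11 x ≤ K
  cl_eq : ∀ x : ℤ, 0 ≤ x → x < n → s.int 17 x = 0 → s.int 11 x = s.int 10 x
  a_lt : a < n

lemma Linked.congr {n : ℕ} {arr mk nx nx' prv : ℤ → ℤ} (h : Linked n arr mk nx prv)
    (hx : ∀ x, mk x = 0 → nx' x = nx x) : Linked n arr mk nx' prv := by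
  intro p q h1 h2 h3 h4 h5 h6
  rw [hx _ h4]
  exact h p q h1 h2 h3 h4 h5 h6

/-- Links of marked elements are scratch space: bank `14` needs to be preserved at unmarked
addresses only. -/
lemma Stage.congr {n K a : ℕ} {s s' : State} (h : Stage n K a s)
    (hb : ∀ b ∈ [0, 2, 7, 8, 9, 10, 11, 12, 13, 15, 16, 17], s'.int b = s.int b)
    (hx : ∀ x, s.int 17 x = 0 → s'.int 14 x = s.int 14 x) : Stage n K a s' := by
  have e0 := hb 0 (by decide)
  have e2 := hb 2 (by decide)
  have e7 := hb 7 (by decide)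
  have e8 := hb 8 (by decide)
  have e9 := hb 9 (by decide)
  have e10 := hb 10 (by decide)
  have e11 := hb 11 (by decide)
  have e12 := hb 12 (by decide)
  have e13 := hb 13 (by decide)
  have e15 := hb 15 (by decide)
  have e16 := hb 16 (by decide)
  have e17 := hb 17 (by decide)
  constructor
  · rw [e0]; exact h.hn
  · rw [e2]; exact h.hK
  · rw [e7]; exact h.ha
  · rw [e8, e9, e10, e12]; exact h.base
  · rw [e16, e17]; exact h.marks
  · rw [e8, e17, e15]; exact h.link.congr hx
  · rw [e13]; exact h.idn
  · rw [e11]; exact h.cl_mem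
  · rw [e11, e10, e17]; exact h.cl_eq
  · exact h.a_lt

section

variable {n : ℕ} {f : Finset (Fin n) → ℝ} {EO : ℝ}

lemma isChain_push {nx : ℤ → ℤ} {l : List ℤ} {x h : ℤ} (hc : l.IsChain fun x y => nx x = y)
    (hh : l.head? = some h) (hx : x ∉ l) :
    (x :: l).IsChain fun y z => Function.update nx x h y = z := by
  rw [List.isChain_cons]
  refine ⟨fun y hy => ?_, isChain_congr (fun y hy => ?_) hc⟩
  · rw [hh] at hy
    rw [Function.update_self]
    simpa using hy
  · rw [Function.update_of_ne]
    rintro rfl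
    exact hx hy

lemma isChain_update {nx : ℤ → ℤ} {l : List ℤ} {x h : ℤ} (hc : l.IsChain fun x y => nx x = y)
    (hx : x ∉ l) : l.IsChain fun y z => Function.update nx x h y = z := by
  refine isChain_congr (fun y hy => ?_) hc
  rw [Function.update_of_ne]
  rintro rfl
  exact hx hy

/-- The state after relinking `qF` marked elements and counting `qP` of them. -/
structure LinkInv (n a : ℕ) (s₀ : State) (v r k : ℤ) (qF qP : ℕ) (s : State) : Prop where
  unmarked : ∀ x, s₀.int 17 x = 0 → s.int 14 x = s₀.int 14 x
  front : (pick (fun q => InFront (s₀.int 11) (s₀.int 17) v r (s₀.int 16 q)) (s₀.int 16) qF ++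
    [s₀.int 14 (-1)]).IsChain fun x y => s.int 14 x = y
  head : (pick (fun q => InFront (s₀.int 11) (s₀.int 17) v r (s₀.int 16 q)) (s₀.int 16) qF ++
    [s₀.int 14 (-1)]).head? = some (s.int 22 0)
  rest : (pick (fun q => ¬ InFront (s₀.int 11) (s₀.int 17) v r (s₀.int 16 q)) (s₀.int 16) qF ++
    [-1]).IsChain fun x y => s.int 14 x = y
  back : (pick (fun q => ¬ InFront (s₀.int 11) (s₀.int 17) v r (s₀.int 16 q)) (s₀.int 16) qF ++
    [-1]).head? = some (s.int 23 0)
  count : s.int 24 0 = k +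
    (pick (fun q => InFront (s₀.int 11) (s₀.int 17) v r (s₀.int 16 q)) (s₀.int 16) qF).length -
    (pick (fun q => s₀.int 9 (s₀.int 16 q) < k) (s₀.int 16) qP).length

open Classical in
def frontSum (s₀ : State) (v r : ℤ) (q : ℕ) : ℝ :=
  ∑ j ∈ Finset.range q,
    if InFront (s₀.int 11) (s₀.int 17) v r (s₀.int 16 j) then s₀.real 3 j else 0

open Classical in
def countSum (s₀ : State) (k : ℤ) (q : ℕ) : ℝ :=
  ∑ j ∈ Finset.range q, if s₀.int 9 (s₀.int 16 j) < k then s₀.real 9 j else 0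

lemma linkStep_spec {a : ℕ} {s₀ s : State} {v r k : ℤ} {q : ℕ}
    (hS : Same linkBody.ints linkBody.reals s₀ s)
    (hM : Marks n a (s₀.int 16) (s₀.int 17)) (hfirst : s₀.int 17 (s₀.int 14 (-1)) = 0)
    (hq : q < a) (hv : s₀.int 18 0 = v) (hr : s₀.int 19 0 = r)
    (h21 : s.int 21 0 = q) (h25 : s.int 25 0 = s₀.int 16 q) (hI : LinkInv n a s₀ v r k q q s) :
    Ens f EO linkStep s fun s' => LinkInv n a s₀ v r k (q + 1) q s' ∧
      s'.real 4 0 = s.real 4 0 + (frontSum s₀ v r (q + 1) - frontSum s₀ v r q) ∧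
      s'.int 21 0 = q ∧ s'.int 25 0 = s₀.int 16 q ∧ s'.time ≤ s.time + 5 := by
  have e11 := hS.1 11 (by decide)
  have e18 := hS.1 18 (by decide)
  have e19 := hS.1 19 (by decide)
  have e3 := hS.2 3 (by decide)
  have hmT := hM.mk_T q hq
  have hTm := hM.T_mem q hq
  -- The element being pushed is new in both stacks: earlier entries differ by injectivity of the
  -- table, and the bottom of a stack is unmarked.
  have hnF : ∀ (P : ℕ → Prop) (e : ℤ), s₀.int 17 e = 0 →
      s₀.int 16 q ∉ pick P (s₀.int 16) q ++ [e] := by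
    intro P e he hm
    rw [List.mem_append, mem_pick] at hm
    rcases hm with ⟨j, hj, -, h⟩ | hm
    · have := hM.T_inj j q (by omega) hq h
      omega
    · rw [List.mem_singleton] at hm
      rw [← hm, hmT] at he
      omega
  have hneg : s₀.int 17 (-1) = 0 := hM.mk_neg (by omega)
  refine Ens.branch (fun ht => ?_) (fun ht => ?_)
  · have hP : InFront (s₀.int 11) (s₀.int 17) v r (s₀.int 16 q) := by
      simp only [frontTest, Test.Holds, IntExpr.eval, h25, h21, e11, e18, e19, hv,
        hr] at ht
      unfold InFront
      rw [hmT]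
      omega
    refine Ens.seq (Ens.setInt (Ens.seq (Ens.setInt (Ens.seq (Ens.setInt (Ens.setReal ?_))))))
    refine ⟨⟨?_, ?_, ?_, ?_, ?_, ?_⟩, ?_, ?_, ?_, ?_⟩
    · intro x hx
      have : x ≠ s₀.int 16 q := by rintro rfl; omega
      simp [IntExpr.eval, h25, this, hI.unmarked x hx]
    · simp only [IntExpr.eval, pick, hP, if_true]
      simpa [h25] using isChain_push hI.front hI.head (hnF _ _ hfirst)
    · simp [IntExpr.eval, pick, hP, h25]
    · simp only [IntExpr.eval, pick, hP, not_true, if_false]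
      simpa [h25] using isChain_update hI.rest (hnF _ _ hneg)
    · simp only [IntExpr.eval, pick, hP, not_true, if_false]
      simpa using hI.back
    · simp [IntExpr.eval, pick, hP, hI.count]
      ring
    · simp [RealExpr.eval, IntExpr.eval, frontSum, Finset.sum_range_succ, hP, h21, e3]
    · simp [IntExpr.eval, h21]
    · simp [IntExpr.eval, h25]
    · simp; linarith
  · have hP : ¬ InFront (s₀.int 11) (s₀.int 17) v r (s₀.int 16 q) := by
      simp only [frontTest, Test.Holds, IntExpr.eval, h25, h21, e11, e18, e19, hv,
        hr] at ht
      unfold InFront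
      rw [hmT]
      omega
    refine Ens.seq (Ens.setInt (Ens.setInt ?_))
    refine ⟨⟨?_, ?_, ?_, ?_, ?_, ?_⟩, ?_, ?_, ?_, ?_⟩
    · intro x hx
      have : x ≠ s₀.int 16 q := by rintro rfl; omega
      simp [IntExpr.eval, h25, this, hI.unmarked x hx]
    · simp only [IntExpr.eval, pick, hP, if_false]
      simpa [h25] using isChain_update hI.front (hnF _ _ hfirst)
    · simp only [IntExpr.eval, pick, hP, if_false]
      simpa using hI.head
    · simp only [IntExpr.eval, pick, hP, not_false_eq_true, if_true]
      simpa [h25] using isChain_push hI.rest hI.back (hnF _ _ hneg)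
    · simp [IntExpr.eval, pick, hP, h25]
    · simp [IntExpr.eval, pick, hP, hI.count]
    · simp [frontSum, Finset.sum_range_succ, hP]
    · simp [IntExpr.eval, h21]
    · simp [IntExpr.eval, h25]
    · simp; linarith

lemma countStep_spec {a : ℕ} {s₀ s : State} {v r k : ℤ} {q : ℕ}
    (hS : Same linkBody.ints linkBody.reals s₀ s) (hk : s₀.int 20 0 = k)
    (h21 : s.int 21 0 = q) (h25 : s.int 25 0 = s₀.int 16 q)
    (hI : LinkInv n a s₀ v r k (q + 1) q s) :
    Ens f EO countStep s fun s' => LinkInv n a s₀ v r k (q + 1) (q + 1) s' ∧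
      s'.real 4 0 = s.real 4 0 + (countSum s₀ k (q + 1) - countSum s₀ k q) ∧
      s'.int 21 0 = q ∧ s'.time ≤ s.time + 3 := by
  have e9 := hS.1 9 (by decide)
  have e20 := hS.1 20 (by decide)
  have e9' := hS.2 9 (by decide)
  refine Ens.branch (fun ht => ?_) (fun ht => ?_)
  · have hP : s₀.int 9 (s₀.int 16 q) < k := by
      simp only [Test.Holds, IntExpr.eval, h25, e9, e20, hk] at ht
      omega
    refine Ens.seq (Ens.setInt (Ens.setReal ?_))
    refine ⟨⟨?_, ?_, ?_, ?_, ?_, ?_⟩, ?_, ?_, ?_⟩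
    · simpa using hI.unmarked
    · simpa using hI.front
    · simpa using hI.head
    · simpa using hI.rest
    · simpa using hI.back
    · simp [IntExpr.eval, pick, hP, hI.count]
      ring
    · simp [RealExpr.eval, IntExpr.eval, countSum, Finset.sum_range_succ, hP, h21, e9']
    · simp [IntExpr.eval, h21]
    · simp; linarith
  · have hP : ¬ s₀.int 9 (s₀.int 16 q) < k := by
      simp only [Test.Holds, IntExpr.eval, h25, e9, e20, hk] at ht
      omega
    refine Ens.skip ⟨⟨?_, ?_, ?_, ?_, ?_, ?_⟩, ?_, ?_, ?_⟩
    · simpa using hI.unmarked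
    · simpa using hI.front
    · simpa using hI.head
    · simpa using hI.rest
    · simpa using hI.back
    · simp [pick, hP, hI.count]
    · simp [countSum, Finset.sum_range_succ, hP]
    · simp [h21]
    · simp; linarith

/-- A round takes at most 11 units: the test, the load, 5 for relinking, 3 for counting, the
increment. -/
lemma linkLoop_spec {a : ℕ} {s₀ : State} {v r k : ℤ}
    (hM : Marks n a (s₀.int 16) (s₀.int 17)) (hfirst : s₀.int 17 (s₀.int 14 (-1)) = 0)
    (ha : s₀.int 7 0 = a) (hv : s₀.int 18 0 = v) (hr : s₀.int 19 0 = r) (hk : s₀.int 20 0 = k)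
    (h21 : s₀.int 21 0 = 0) (h4 : s₀.real 4 0 = 0) (hI : LinkInv n a s₀ v r k 0 0 s₀) :
    Ens f EO linkLoop s₀ fun s' => LinkInv n a s₀ v r k a a s' ∧
      s'.real 4 0 = frontSum s₀ v r a + countSum s₀ k a ∧ s'.time ≤ s₀.time + 11 * a + 1 := by
  refine Ens.loop_frame (fun l s => ∃ q : ℕ, l = a - q ∧ q ≤ a ∧ s.int 21 0 = q ∧
    LinkInv n a s₀ v r k q q s ∧ s.real 4 0 = frontSum s₀ v r q + countSum s₀ k q ∧
    s.time ≤ s₀.time + 11 * q) ?_ ?_ (k := a)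
    ⟨0, by omega, by omega, by simpa using h21, hI, by simp [h4, frontSum, countSum], by simp⟩
  · rintro l s hS ⟨q, rfl, hq, h21, hI, h4, htime⟩ ht
    have e7 := hS.1 7 (by decide)
    have e16 := hS.1 16 (by decide)
    simp only [Test.Holds, IntExpr.eval, h21, e7, ha] at ht
    refine Ens.seq (Ens.setInt (Ens.seq ?_))
    refine (linkStep_spec (v := v) (r := r) (k := k) (q := q) ?_ hM hfirst (by omega) hv hr ?_ ?_
      ?_).frame.mono ?_
    · refine hS.trans (I' := [25]) (R' := []) ⟨?_, ?_⟩ ?_ ?_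
      · intro b hb; rw [List.mem_singleton] at hb; simp [hb]
      · intro b hb; simp
      · intro b hb
        rcases hb with hb | hb
        · exact hb
        · rw [List.mem_singleton] at hb; subst hb; decide
      · intro b hb; simpa using hb
    · simp [h21]
    · simp [IntExpr.eval, h21, e16]
    · refine ⟨?_, ?_, ?_, ?_, ?_, ?_⟩
      · simpa using hI.unmarked
      · simpa using hI.front
      · simpa using hI.head
      · simpa using hI.rest
      · simpa using hI.back
      · simpa using hI.count
    rintro s₁ ⟨hS₁, hI₁, h4₁, h21₁, h25₁, ht₁⟩
    have hS' : Same linkBody.ints linkBody.reals s₀ s₁ := by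
      refine hS.trans (I' := 25 :: linkStep.ints) (R' := linkStep.reals) ⟨?_, ?_⟩ ?_ ?_
      · intro b hb
        rw [List.mem_cons, not_or] at hb
        rw [hS₁.1 b hb.2]
        simp [hb.1]
      · intro b hb
        rw [hS₁.2 b hb]
        simp
      · have : ∀ b ∈ 25 :: linkStep.ints, b ∈ linkBody.ints := by decide
        rintro b (hb | hb)
        · exact hb
        · exact this b hb
      · have : ∀ b ∈ linkStep.reals, b ∈ linkBody.reals := by decide
        rintro b (hb | hb)
        · exact hb
        · exact this b hb
    refine Ens.seq ((countStep_spec (v := v) (r := r) (k := k) (q := q) hS' hk h21₁ h25₁ hI₁).mono ?_)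
    rintro s₂ ⟨hI₂, h4₂, h21₂, ht₂⟩
    refine Ens.setInt ⟨a - (q + 1), by omega, q + 1, rfl, by omega, ?_, ?_, ?_, ?_⟩
    · simp [IntExpr.eval, h21₂]
    · refine ⟨?_, ?_, ?_, ?_, ?_, ?_⟩
      · simpa using hI₂.unmarked
      · simpa using hI₂.front
      · simpa using hI₂.head
      · simpa using hI₂.rest
      · simpa using hI₂.back
      · simpa using hI₂.count
    · simp [h4₂, h4₁, h4]
      ring
    · simp at ht₁ ⊢
      linarith
  · rintro l s hS ⟨q, rfl, hq, h21, hI, h4, htime⟩ ht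
    have e7 := hS.1 7 (by decide)
    simp only [Test.Holds, IntExpr.eval, h21, e7, ha] at ht
    obtain rfl : q = a := by omega
    refine ⟨⟨?_, ?_, ?_, ?_, ?_, ?_⟩, ?_, ?_⟩
    · simpa using hI.unmarked
    · simpa using hI.front
    · simpa using hI.head
    · simpa using hI.rest
    · simpa using hI.back
    · simpa using hI.count
    · simpa using h4
    · simp; linarith

end

end

/-! ### Computing prefix sums of weights and the marginals of marked elements. -/

/-- Prefix sums of the weights at the position in bank `20`. -/
def cumCmd : Command :=
  setI 18 (iv 2) ;; setI 19 (.const 0) ;; askCmd ;; setR 7 (rv 2) ;;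
  setI 18 (.get 10 (.get 8 (iv 20))) ;; setI 19 (iv 7) ;; askCmd ;;
  setR 7 (.add (.sub (.add (.mul (.const 2) (.get 1 (iv 20))) (.mul (.const 2) (rv 7))) (rv 2))
    (rv 4))

/-- The entry with index `q` has mark `q + 1`, so the queries with mark bounds `q` and `q + 1` at
its own level differ exactly by this element. -/
def margBody : Command :=
  setI 18 (.get 11 (.get 16 (iv 26))) ;; setI 20 (.get 12 (iv 18)) ;; setI 19 (iv 26) ;;
  askCmd ;; setR 8 (rv 2) ;; setI 19 (.add (iv 26) (.const 1)) ;; askCmd ;;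
  .setReal 3 (iv 26) (.sub (rv 2) (rv 8)) ;;
  .branch (.realLE (.const 0) (.get 3 (iv 26)))
    (.setReal 9 (iv 26) (.get 3 (iv 26)))
    (.setReal 9 (iv 26) (.sub (.const 0) (.get 3 (iv 26)))) ;;
  setI 26 (.add (iv 26) (.const 1))

/-- Compute the marginals of the marked elements. -/
def margCmd : Command := setI 26 (.const 0) ;; .loop (ltI (iv 26) (iv 7)) margBody

noncomputable section

variable {n : ℕ} {f : Finset (Fin n) → ℝ} {EO : ℝ}

lemma askCmd_spec {K a : ℕ} {s : State} (hS : Stage n K a s) {k : ℕ} (hk : s.int 20 0 = k)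
    (hkn : k ≤ n) :
    Ens f EO askCmd s fun s' =>
      s'.real 2 0 = f (askSet n (s.int 9) (s.int 11) (s.int 17) (s.int 18 0) (s.int 19 0) k) ∧
      s'.real 4 0 = frontSum s (s.int 18 0) (s.int 19 0) a + countSum s k a ∧
      (∀ x, s.int 17 x = 0 → s'.int 14 x = s.int 14 x) ∧
      s'.time ≤ s.time + 11 * a + EO + 9 := by
  obtain ⟨-, h2, h3, h4⟩ := hS.link.spec hS.base hS.marks hS.a_lt
  have hfirst : s.int 17 (s.int 14 (-1)) = 0 :=
    (mem_unmarked.1 (List.mem_of_head? h2)).1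
  have hlast : s.int 17 (s.int 15 n) = 0 := (mem_unmarked.1 (List.mem_of_getLast? h3)).1
  refine Ens.seq (Ens.setInt (Ens.seq (Ens.setInt (Ens.seq (Ens.setInt (Ens.seq (Ens.setReal
    (Ens.seq (Ens.setInt (Ens.seq ?_))))))))))
  refine (linkLoop_spec (n := n) (a := a) (v := s.int 18 0) (r := s.int 19 0) (k := k)
    (by exact hS.marks) (by exact hfirst) (by exact hS.ha) (by rfl) (by rfl) (by exact hk)
    (by rfl) ?_
    ?_).frame.mono ?_
  · simp [RealExpr.eval, IntExpr.eval]
  · refine ⟨?_, ?_, ?_, ?_, ?_, ?_⟩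
    · intro x _; rfl
    · simp [pick]
    · simp [pick, IntExpr.eval]
    · simp [pick]
    · simp [pick, IntExpr.eval]
    · simp [pick, IntExpr.eval, hk]
  rintro s₁ ⟨hF, hI, hacc, ht⟩
  have e0 : s₁.int 0 = s.int 0 := hF.1 0 (by decide)
  have e9 : s₁.int 9 = s.int 9 := hF.1 9 (by decide)
  have e13 : s₁.int 13 = s.int 13 := hF.1 13 (by decide)
  have e15 : s₁.int 15 = s.int 15 := hF.1 15 (by decide)
  have hI14 := hI.unmarked
  have hA := answer_linked hS.base hS.marks hS.link hS.a_lt f hS.idn hkn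
    (by exact hI.unmarked) (by exact hI.front) (by exact hI.head) (by exact hI.rest)
    (by exact hI.back) (by exact hI.count)
  refine Ens.seq (Ens.setInt (Ens.seq (Ens.query
    (x := f (askSet n (s.int 9) (s.int 11) (s.int 17) (s.int 18 0) (s.int 19 0) k)) ?_
    (Ens.setInt ?_))))
  · simp only [State.tick_int, State.writeInt_int, IntExpr.eval, e0, e13, e15, hS.hn]
    simpa using hA
  · refine ⟨?_, ?_, ?_, ?_⟩
    · simp [IntExpr.eval]
    · have h6 : s₁.real 4 0 = frontSum s (s.int 18 0) (s.int 19 0) a + countSum s k a := hacc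
      simpa using h6
    · intro x hx
      have h5 : s₁.int 14 x = s.int 14 x := hI14 x hx
      -- The last unmarked node is the only unmarked one whose link was redirected for the query;
      -- the final write restores its link to the sentinel `n`.
      by_cases hxl : x = s.int 15 n
      · subst hxl
        simp [IntExpr.eval, e0, e15, hS.hn, h4]
      · simp [IntExpr.eval, e0, e15, hS.hn, hxl, h5]
    · simp at ht ⊢
      linarith

lemma Base.sorted {K : ℕ} {arr pos bl start : ℤ → ℤ} (h : Base n K arr pos bl start) {x y : ℤ}
    (hx : 0 ≤ x ∧ x < n) (hy : 0 ≤ y ∧ y < n) (hxy : pos x < pos y) : bl y ≤ bl x := by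
  by_contra hlt
  have h1 := h.pos_mem x hx.1 hx.2
  have h2 := h.pos_mem y hy.1 hy.2
  have h3 := h.start_iff (bl x) (pos x) (h.bl_mem x hx.1 hx.2).1 h1.1 h1.2
  have h4 := h.start_iff (bl x) (pos y) (h.bl_mem x hx.1 hx.2).1 h2.1 h2.2
  rw [h.arr_pos x hx.1 hx.2] at h3
  rw [h.arr_pos y hy.1 hy.2] at h4
  omega

lemma Fin.int_mem (i : Fin n) : (0 : ℤ) ≤ ((i : ℕ) : ℤ) ∧ ((i : ℕ) : ℤ) < n :=
  ⟨by omega, by omega⟩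

lemma Stage.order {K a : ℕ} {s : State} (h : Stage n K a s) :
    StageOrder n a (s.int 9) (s.int 10) (s.int 11) (s.int 17) where
  pos_inj i j hij := by
    have h1 := h.base.arr_pos _ (Fin.int_mem i).1 (Fin.int_mem i).2
    have h2 := h.base.arr_pos _ (Fin.int_mem j).1 (Fin.int_mem j).2
    rw [hij, h2] at h1
    exact Fin.ext (by omega)
  pos_nonneg i := (h.base.pos_mem _ (Fin.int_mem i).1 (Fin.int_mem i).2).1
  pos_lt i := (h.base.pos_mem _ (Fin.int_mem i).1 (Fin.int_mem i).2).2
  mk_inj i j hij hi := by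
    have h1 := (h.marks.T_mk _ hi).2.2
    have h2 := (h.marks.T_mk _ (hij ▸ hi)).2.2
    rw [hij, h2] at h1
    exact Fin.ext (by omega)
  mk_nonneg i := by
    by_cases hi : s.int 17 (i : ℕ) = 0
    · omega
    · have := (h.marks.T_mk _ hi).1; omega
  mk_le i := by
    by_cases hi : s.int 17 (i : ℕ) = 0
    · omega
    · exact (h.marks.T_mk _ hi).2.1
  cl_eq i hi := h.cl_eq _ (Fin.int_mem i).1 (Fin.int_mem i).2 hi
  sorted i j hij := h.base.sorted (Fin.int_mem i) (Fin.int_mem j) hij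

/-- The current marginals. -/
def curMarg (f : Finset (Fin n) → ℝ) (a : ℤ) (s : State) (i : Fin n) : ℝ :=
  marg f (curKey n a (s.int 9) (s.int 11) (s.int 17)) i

/-- The current weights. -/
def curWeight (f : Finset (Fin n) → ℝ) (a : ℤ) (s : State) (i : Fin n) : ℝ :=
  weight f a (s.int 9) (s.int 11) (s.int 17) i

/-- Prefix sums of the current weights. -/
def cumWeight (f : Finset (Fin n) → ℝ) (a : ℤ) (s : State) (k : ℤ) : ℝ :=
  ∑ i ∈ Finset.univ.filter (fun i : Fin n => s.int 9 (i : ℕ) < k), curWeight f a s i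

/-- Bank `1` holds the prefix sums of the negative parts of the base marginals. -/
def NegSums (f : Finset (Fin n) → ℝ) (s : State) : Prop :=
  ∀ k : ℕ, k ≤ n → s.real 1 k =
    ∑ i ∈ Finset.univ.filter (fun i : Fin n => s.int 9 (i : ℕ) < k),
      max 0 (-marg f (posKey n (s.int 9)) i)

/-- The marginals of the marked elements are stored. -/
def MargTable (f : Finset (Fin n) → ℝ) (a : ℕ) (s : State) (q : ℕ) : Prop :=
  ∀ i : Fin n, s.int 17 (i : ℕ) ≠ 0 → s.int 17 (i : ℕ) ≤ q →
    s.real 3 (s.int 17 (i : ℕ) - 1) = curMarg f a s i ∧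
    s.real 9 (s.int 17 (i : ℕ) - 1) = |curMarg f a s i|

lemma frontSum_congr {s s' : State} (h11 : s.int 11 = s'.int 11) (h17 : s.int 17 = s'.int 17)
    (h16 : s.int 16 = s'.int 16) (h3 : s.real 3 = s'.real 3) (v r : ℤ) (q : ℕ) :
    frontSum s v r q = frontSum s' v r q := by
  unfold frontSum
  rw [h11, h17, h16, h3]

lemma countSum_congr {s s' : State} (h9 : s.int 9 = s'.int 9) (h16 : s.int 16 = s'.int 16)
    (h9' : s.real 9 = s'.real 9) (k : ℤ) (q : ℕ) : countSum s k q = countSum s' k q := by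
  unfold countSum
  rw [h9, h16, h9']

open Classical in
lemma frontSum_eq {K a : ℕ} {s : State} (hS : Stage n K a s) (hT : MargTable f a s a) (v : ℤ) :
    frontSum s v a a = ∑ i ∈ Finset.univ.filter (fun i : Fin n => s.int 17 (i : ℕ) ≠ 0),
      if InFront (s.int 11) (s.int 17) v a (i : ℕ) then curMarg f a s i else 0 := by
  have h1 : frontSum s v a a = ∑ r ∈ Finset.range a, (fun x => if InFront (s.int 11) (s.int 17) v a x
      then s.real 3 (s.int 17 x - 1) else 0) (s.int 16 r) := by
    refine Finset.sum_congr rfl fun r hr => ?_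
    have := hS.marks.mk_T r (Finset.mem_range.1 hr)
    simp [this]
  rw [h1, hS.marks.sum_range fun x => if InFront (s.int 11) (s.int 17) v a x
      then s.real 3 (s.int 17 x - 1) else 0]
  refine Finset.sum_congr rfl fun i hi => ?_
  simp only [Finset.mem_filter, Finset.mem_univ, true_and] at hi
  rw [(hT i hi (hS.order.mk_le i)).1]

open Classical in
lemma countSum_eq {K a : ℕ} {s : State} (hS : Stage n K a s) (hT : MargTable f a s a) (k : ℤ) :
    countSum s k a = ∑ i ∈ Finset.univ.filter (fun i : Fin n => s.int 17 (i : ℕ) ≠ 0),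
      if s.int 9 (i : ℕ) < k then |curMarg f a s i| else 0 := by
  have h1 : countSum s k a = ∑ r ∈ Finset.range a, (fun x => if s.int 9 x < k
      then s.real 9 (s.int 17 x - 1) else 0) (s.int 16 r) := by
    refine Finset.sum_congr rfl fun r hr => ?_
    have := hS.marks.mk_T r (Finset.mem_range.1 hr)
    simp [this]
  rw [h1, hS.marks.sum_range fun x => if s.int 9 x < k then s.real 9 (s.int 17 x - 1) else 0]
  refine Finset.sum_congr rfl fun i hi => ?_
  simp only [Finset.mem_filter, Finset.mem_univ, true_and] at hi
  rw [(hT i hi (hS.order.mk_le i)).2]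

/-- The identity `StageOrder.sum_weight_lt` in executable form. The constant `f ∅` is left in place,
since the program only uses differences of these sums. -/
lemma cumCmd_spec {K a : ℕ} {s : State} (hS : Stage n K a s) (hN : NegSums f s)
    (hT : MargTable f a s a) {k : ℕ} (hk : s.int 20 0 = k) (hkn : k ≤ n) :
    Ens f EO cumCmd s fun s' => Stage n K a s' ∧ NegSums f s' ∧ MargTable f a s' a ∧
      s'.real 7 0 = f ∅ + cumWeight f a s k ∧ s'.time ≤ s.time + 22 * a + 2 * EO + 24 := by
  refine Ens.seq (Ens.setInt (Ens.seq (Ens.setInt (Ens.seq ?_))))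
  refine (askCmd_spec (K := K) (a := a) (k := k) (hS.congr ?_ ?_) ?_ hkn).frame.mono ?_
  · intro b hb; fin_cases hb <;> rfl
  · intro x _; rfl
  · exact hk
  rintro s₁ ⟨hF₁, hres₁, -, h14₁, ht₁⟩
  have hb₁ : ∀ b ∈ [0, 2, 7, 8, 9, 10, 11, 12, 13, 15, 16, 17, 20], s₁.int b = s.int b := by
    intro b hb
    fin_cases hb <;> exact hF₁.1 _ (by decide)
  have hS₁ : Stage n K a s₁ := hS.congr
    (fun b hb => hb₁ b (by revert b; decide)) (by exact h14₁)
  refine Ens.seq (Ens.setReal (Ens.seq (Ens.setInt (Ens.seq (Ens.setInt (Ens.seq ?_))))))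
  refine (askCmd_spec (K := K) (a := a) (k := k) (hS₁.congr ?_ ?_) ?_ hkn).frame.mono ?_
  · intro b hb; fin_cases hb <;> rfl
  · intro x _; rfl
  · exact (congrFun (hb₁ 20 (by decide)) 0).trans hk
  rintro s₂ ⟨hF₂, hres₂, hacc₂, h14₂, ht₂⟩
  have hb₂ : ∀ b ∈ [0, 2, 7, 8, 9, 10, 11, 12, 13, 15, 16, 17, 20], s₂.int b = s.int b := by
    intro b hb
    rw [← hb₁ b hb]
    fin_cases hb <;> exact hF₂.1 _ (by decide)
  have hr₂ : ∀ b ∈ [1, 3, 9], s₂.real b = s.real b := by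
    intro b hb
    fin_cases hb
    · exact (hF₂.2 1 (by decide)).trans (hF₁.2 1 (by decide))
    · exact (hF₂.2 3 (by decide)).trans (hF₁.2 3 (by decide))
    · exact (hF₂.2 9 (by decide)).trans (hF₁.2 9 (by decide))
  have hS₂ : Stage n K a s₂ := hS.congr (fun b hb => hb₂ b (by revert b; decide)) (by
    intro x hx
    have h17 : s₁.int 17 = s.int 17 := hb₁ 17 (by decide)
    exact (h14₂ x (by rw [← h17] at hx; exact hx)).trans (h14₁ x hx))
  have e7 : s₂.real 7 0 = s₁.real 2 0 := by
    rw [hF₂.2 7 (by decide)]; simp [RealExpr.eval, IntExpr.eval]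
  refine Ens.setReal ⟨?_, ?_, ?_, ?_, ?_⟩
  · exact hS₂.congr (fun b _ => rfl) (fun x _ => rfl)
  · intro l hl
    have h1 := hN l hl
    simp only [State.tick_real, State.tick_int, State.writeReal_real, State.writeReal_int]
    simp only [hr₂ 1 (by decide), hb₂ 9 (by decide)]
    simpa using h1
  · intro i h1 h2
    have h3 := hT i
    unfold curMarg at h3 ⊢
    simp only [State.tick_int, State.tick_real, State.writeReal_int,
      State.writeReal_real, hb₂ 17 (by decide), hb₂ 9 (by decide), hb₂ 11 (by decide),
      hr₂ 3 (by decide), hr₂ 9 (by decide)] at h1 h2 ⊢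
    simpa using h3 h1 h2
  -- The separating level is the base level of the element at position `k`, because the array is
  -- sorted.
  · have hv : ∀ i : Fin n, s.int 17 (i : ℕ) = 0 →
        (s.int 9 (i : ℕ) < k → s.int 10 (s.int 8 k) ≤ s.int 10 (i : ℕ)) ∧
        (k ≤ s.int 9 (i : ℕ) → s.int 10 (i : ℕ) ≤ s.int 10 (s.int 8 k)) := by
      intro i _
      have hi := Fin.int_mem i
      have hp := hS.base.pos_mem _ hi.1 hi.2
      rcases Nat.lt_or_ge k n with hlt | hge
      · have ha := hS.base.arr_mem k (by omega) (by omega)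
        have hpa := hS.base.pos_arr k (by omega) (by omega)
        refine ⟨fun h => hS.base.sorted hi ha (by rw [hpa]; exact h), fun h => ?_⟩
        rcases eq_or_lt_of_le h with h | h
        · rw [h, hS.base.arr_pos _ hi.1 hi.2]
        · exact hS.base.sorted ha hi (by rw [hpa]; exact h)
      -- At `k = n` the array holds the sentinel `n`, whose base level `0` is below all levels.
      · obtain rfl : k = n := le_antisymm hkn hge
        rw [hS.base.arr_n, hS.base.bl_n]
        exact ⟨fun _ => (hS.base.bl_mem _ hi.1 hi.2).1, fun h => by omega⟩
    have key := hS.order.sum_weight_lt (f := f) (K := K) (k := k) (v := s.int 10 (s.int 8 k))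
      (fun i => (hS.cl_mem _ (Fin.int_mem i).1 (Fin.int_mem i).2).2)
      (fun i h => (hv i h).1) (fun i h => (hv i h).2)
    rw [Finset.sum_add_distrib] at key
    have hA₁ : s₁.real 2 0 = f (askSet n (s.int 9) (s.int 11) (s.int 17) K 0 k) := by
      rw [hres₁]
      simp [IntExpr.eval, hS.hK]
    have hA₂ : s₂.real 2 0 =
        f (askSet n (s.int 9) (s.int 11) (s.int 17) (s.int 10 (s.int 8 k)) a k) := by
      rw [hres₂]
      simp [IntExpr.eval, hS.ha, hb₁ 9 (by decide), hb₁ 11 (by decide), hb₁ 17 (by decide),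
        hb₁ 10 (by decide), hb₁ 8 (by decide), hb₁ 20 (by decide), hb₁ 7 (by decide), hk]
    have h3 : s₁.real 3 = s.real 3 := hF₁.2 3 (by decide)
    have h9 : s₁.real 9 = s.real 9 := hF₁.2 9 (by decide)
    have hAcc := hacc₂.trans (congrArg₂ (· + ·)
      (frontSum_congr (s' := s) (hb₁ 11 (by decide)) (hb₁ 17 (by decide)) (hb₁ 16 (by decide)) h3
        _ _ _)
      (countSum_congr (s' := s) (hb₁ 9 (by decide)) (hb₁ 16 (by decide)) h9 _ _))
    simp only [State.tick_int, State.writeInt_int, State.writeReal_int, IntExpr.eval] at hAcc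
    simp [hS.ha, hb₁ 10 (by decide), hb₁ 8 (by decide), hb₁ 20 (by decide), hb₁ 7 (by decide),
      hk] at hAcc
    have hNk := hN k hkn
    rw [frontSum_eq hS hT, countSum_eq hS hT] at hAcc
    unfold cumWeight curWeight
    simp only [curMarg] at hAcc
    simp [RealExpr.eval, IntExpr.eval, hb₂ 20 (by decide), hk, hr₂ 1 (by decide), hA₂, e7, hA₁,
      hAcc, hNk]
    linarith
  · simp at ht₁ ht₂ ⊢
    linarith

lemma margCmd_spec {K a : ℕ} {s : State} (hS : Stage n K a s) (hN : NegSums f s) :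
    Ens f EO margCmd s fun s' => Stage n K a s' ∧ NegSums f s' ∧ MargTable f a s' a ∧
      s'.time ≤ s.time + a * (22 * a + 2 * EO + 28) + 2 := by
  have h0 : ∃ s₀ : State, s₀ = (s.writeInt 26 0 0).tick 1 := ⟨_, rfl⟩
  obtain ⟨s₀, hs₀⟩ := h0
  have hS₀ : Stage n K a s₀ := by
    rw [hs₀]
    exact hS.congr (fun b hb => by fin_cases hb <;> rfl) (fun x _ => rfl)
  have hN₀ : NegSums f s₀ := by rw [hs₀]; exact hN
  have h26₀ : s₀.int 26 0 = 0 := by rw [hs₀]; simp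
  have ht₀ : s₀.time = s.time + 1 := by rw [hs₀]; simp
  refine Ens.seq (Ens.setInt ?_)
  simp only [IntExpr.eval]
  rw [← hs₀]
  refine Ens.loop_frame (fun l t => ∃ q : ℕ, l = a - q ∧ q ≤ a ∧ t.int 26 0 = q ∧
    (∀ x, s₀.int 17 x = 0 → t.int 14 x = s₀.int 14 x) ∧ MargTable f a t q ∧
    t.time ≤ s₀.time + q * (22 * a + 2 * EO + 28)) ?_ ?_ (k := a)
    ⟨0, by omega, by omega, by simpa using h26₀, fun _ _ => rfl, ?_, by simp⟩
  · rintro l t hF ⟨q, rfl, hq, h26, h14, hT, htime⟩ htest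
    have e7 := hF.1 7 (by decide)
    simp only [Test.Holds, IntExpr.eval, h26, e7, hS₀.ha] at htest
    have hqa : q < a := by omega
    have hb : ∀ b ∈ [0, 2, 7, 8, 9, 10, 11, 12, 13, 15, 16, 17], t.int b = s₀.int b := by
      intro b hb
      fin_cases hb <;> exact hF.1 _ (by decide)
    have hSt : Stage n K a t := hS₀.congr hb h14
    have hTm := hSt.marks.T_mem q hqa
    have hmT := hSt.marks.mk_T q hqa
    set i : Fin n := ⟨(t.int 16 q).toNat, by omega⟩ with hi
    have hiT : ((i : ℕ) : ℤ) = t.int 16 q := by simp only [hi]; omega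
    have hcl := hSt.cl_mem _ hTm.1 hTm.2
    have hst := hSt.base.start_mem _ hcl.1
    obtain ⟨k, hk⟩ : ∃ k : ℕ, (k : ℤ) = t.int 12 (t.int 11 (t.int 16 q)) :=
      ⟨(t.int 12 (t.int 11 (t.int 16 q))).toNat, by omega⟩
    -- `start v` is the number of base levels above `v`, hence exactly the cut that separates the
    -- unmarked elements of level above `cl i`.
    have hmarg := hSt.order.marg_of_marked (f := f) (i := i) (by rw [hiT]; omega) (k := k) (by
      intro j _
      have hj := Fin.int_mem j
      have hpj := hSt.base.pos_mem _ hj.1 hj.2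
      have := hSt.base.start_iff (t.int 11 (t.int 16 q)) (t.int 9 (j : ℕ)) hcl.1 hpj.1 hpj.2
      rw [hSt.base.arr_pos _ hj.1 hj.2] at this
      rw [hk, hiT]
      exact this.symm)
    rw [hiT, hmT] at hmarg
    refine Ens.seq (Ens.setInt (Ens.seq (Ens.setInt (Ens.seq (Ens.setInt (Ens.seq ?_))))))
    refine (askCmd_spec (K := K) (a := a) (k := k) (hSt.congr ?_ ?_) ?_
      (by omega)).frame.mono ?_
    · intro b hb; fin_cases hb <;> rfl
    · intro x _; rfl
    · simp [IntExpr.eval, h26, hk]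
    rintro s₁ ⟨hF₁, hres₁, -, h14₁, ht₁⟩
    have hb₁ : ∀ b ∈ [0, 2, 7, 8, 9, 10, 11, 12, 13, 15, 16, 17], s₁.int b = t.int b := by
      intro b hb
      fin_cases hb <;> exact hF₁.1 _ (by decide)
    have hS₁ : Stage n K a s₁ := hSt.congr hb₁ (by exact h14₁)
    have e26 : s₁.int 26 0 = q := by rw [hF₁.1 26 (by decide)]; simpa using h26
    have e20 : s₁.int 20 0 = k := by rw [hF₁.1 20 (by decide)]; simp [IntExpr.eval, h26, hk]
    have e18 : s₁.int 18 0 = t.int 11 (t.int 16 q) := by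
      rw [hF₁.1 18 (by decide)]; simp [IntExpr.eval, h26]
    refine Ens.seq (Ens.setReal (Ens.seq (Ens.setInt (Ens.seq ?_))))
    refine (askCmd_spec (K := K) (a := a) (k := k) (hS₁.congr ?_ ?_) ?_
      (by omega)).frame.mono ?_
    · intro b hb; fin_cases hb <;> rfl
    · intro x _; rfl
    · simpa using e20
    rintro s₂ ⟨hF₂, hres₂, -, h14₂, ht₂⟩
    have hb₂ : ∀ b ∈ [0, 2, 7, 8, 9, 10, 11, 12, 13, 15, 16, 17], s₂.int b = t.int b := by
      intro b hb
      rw [← hb₁ b hb]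
      fin_cases hb <;> exact hF₂.1 _ (by decide)
    have e26₂ : s₂.int 26 0 = q := by rw [hF₂.1 26 (by decide)]; simpa using e26
    have e3 : s₂.real 3 = t.real 3 := (hF₂.2 3 (by decide)).trans (hF₁.2 3 (by decide))
    have e9 : s₂.real 9 = t.real 9 := (hF₂.2 9 (by decide)).trans (hF₁.2 9 (by decide))
    have hval : s₂.real 2 0 - s₂.real 8 0 = curMarg f a t i := by
      have h8 : s₂.real 8 0 = s₁.real 2 0 := by
        rw [hF₂.2 8 (by decide)]; simp [RealExpr.eval, IntExpr.eval]
      rw [h8, hres₁, hres₂, curMarg, hmarg]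
      simp [IntExpr.eval, h26, e26, e18, hb₁ 9 (by decide), hb₁ 11 (by decide), hb₁ 17 (by decide)]
    have hfin : ∀ u : State, (∀ b ∈ [0, 2, 7, 8, 9, 10, 11, 12, 13, 15, 16, 17],
        u.int b = s₂.int b) → u.int 26 0 = q → u.int 14 = s₂.int 14 →
        u.real 3 = Function.update (s₂.real 3) q (s₂.real 2 0 - s₂.real 8 0) →
        u.real 9 = Function.update (s₂.real 9) q |s₂.real 2 0 - s₂.real 8 0| →
        u.time = s₂.time + 3 → Ens f EO (setI 26 (.add (iv 26) (.const 1))) u fun s' =>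
          ∃ l < a - q, ∃ q : ℕ, l = a - q ∧ q ≤ a ∧ s'.int 26 0 = q ∧
            (∀ x, s₀.int 17 x = 0 → s'.int 14 x = s₀.int 14 x) ∧ MargTable f a s' q ∧
            s'.time ≤ s₀.time + q * (22 * a + 2 * EO + 28) := by
      intro u hu hu26 hu14 hu3 hu9 hut
      refine Ens.setInt ⟨a - (q + 1), by omega, q + 1, rfl, by omega, ?_, ?_, ?_, ?_⟩
      · simp [IntExpr.eval, hu26]
      · intro x hx
        have hx' : t.int 17 x = 0 := by rw [hb 17 (by decide)]; exact hx
        have h1 : s₂.int 14 x = s₁.int 14 x :=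
          h14₂ x (by
            have : s₁.int 17 x = 0 := by rw [hb₁ 17 (by decide)]; exact hx'
            exact this)
        have h2 : s₁.int 14 x = t.int 14 x := h14₁ x hx'
        simp [hu14, h1, h2, h14 x hx]
      · intro j hj hjq
        unfold curMarg
        simp only [State.tick_int, State.tick_real, State.writeInt_int, State.writeInt_real, hu3, hu9,
          hu 17 (by decide), hu 9 (by decide), hu 11 (by decide), hb₂ 17 (by decide),
          hb₂ 9 (by decide), hb₂ 11 (by decide), e3, e9] at hj hjq ⊢
        simp only [Nat.reduceEqDiff, if_false] at hj hjq ⊢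
        rw [hval]
        by_cases hij : t.int 17 (j : ℕ) - 1 = q
        · have hji : j = i := hSt.order.mk_inj j i (by rw [hiT, hmT]; omega) hj
          subst hji
          rw [hij, Function.update_self, Function.update_self]
          exact ⟨rfl, rfl⟩
        · rw [Function.update_of_ne hij, Function.update_of_ne hij]
          exact hT j hj (by push_cast at hjq; omega)
      · simp at ht₁ ht₂ ⊢
        rw [hut]
        linarith
    refine Ens.seq (Ens.setReal (Ens.seq (Ens.branch (fun hpos => Ens.setReal ?_)
      (fun hneg => Ens.setReal ?_))))
    · simp only [Test.Holds, RealExpr.eval, IntExpr.eval] at hpos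
      simp [e26₂] at hpos
      refine hfin _ ?_ ?_ ?_ ?_ ?_ ?_
      · intro b hb; fin_cases hb <;> rfl
      · simpa using e26₂
      · rfl
      · simp [RealExpr.eval, IntExpr.eval, e26₂]
      · simp [RealExpr.eval, IntExpr.eval, e26₂, abs_of_nonneg (sub_nonneg.2 hpos)]
      · simp; ring
    · simp only [Test.Holds, RealExpr.eval, IntExpr.eval] at hneg
      simp [e26₂] at hneg
      refine hfin _ ?_ ?_ ?_ ?_ ?_ ?_
      · intro b hb; fin_cases hb <;> rfl
      · simpa using e26₂
      · rfl
      · simp [RealExpr.eval, IntExpr.eval, e26₂]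
      · simp [RealExpr.eval, IntExpr.eval, e26₂, abs_of_neg (sub_neg.2 hneg)]
      · simp; ring
  · rintro l t hF ⟨q, rfl, hq, h26, h14, hT, htime⟩ htest
    have e7 := hF.1 7 (by decide)
    simp only [Test.Holds, IntExpr.eval, h26, e7, hS₀.ha] at htest
    obtain rfl : q = a := by omega
    have hb : ∀ b ∈ [0, 2, 7, 8, 9, 10, 11, 12, 13, 15, 16, 17], t.int b = s₀.int b := by
      intro b hb
      fin_cases hb <;> exact hF.1 _ (by decide)
    refine ⟨(hS₀.congr hb h14).congr (fun b _ => rfl) (fun x _ => rfl), ?_, hT, ?_⟩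
    · intro l hl
      have h1 := hN₀ l hl
      rw [← hF.2 1 (by decide), ← hb 9 (by decide)] at h1
      exact h1
    · simp
      linarith
  · intro i hi hi0
    have := hS₀.order.mk_nonneg i
    push_cast at hi0
    omega

end

/-! ### Marking an element and moving it by a level. -/

/-- Mark the element in bank `31` unless it is marked already. -/
def markCmd : Command :=
  .branch (.intLE (.get 17 (iv 31)) (.const 0))
    (.setInt 16 (iv 7) (iv 31) ;; .setInt 17 (iv 31) (.add (iv 7) (.const 1)) ;;
      setI 7 (.add (iv 7) (.const 1)) ;;
      .setInt 14 (.get 15 (iv 31)) (.get 14 (iv 31)) ;;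
      .setInt 15 (.get 14 (iv 31)) (.get 15 (iv 31)))
    .skip

/-- Move the element in bank `31` down or up by one level, depending on the bit in bank `30`. -/
def levelCmd : Command :=
  .branch (.intLE (.const 1) (iv 30))
    (.branch (.intLE (.const 1) (.get 11 (iv 31)))
      (.setInt 11 (iv 31) (.sub (.get 11 (iv 31)) (.const 1))) .skip)
    (.branch (ltI (.get 11 (iv 31)) (iv 2))
      (.setInt 11 (iv 31) (.add (.get 11 (iv 31)) (.const 1))) .skip)

noncomputable section

variable {n : ℕ} {f : Finset (Fin n) → ℝ} {EO : ℝ}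

lemma Base.arr_inj' {K : ℕ} {arr pos bl start : ℤ → ℤ} (hB : Base n K arr pos bl start) {p q : ℤ}
    (hp : -1 ≤ p ∧ p ≤ n) (hq : -1 ≤ q ∧ q ≤ n) (h : arr p = arr q) : p = q := by
  have key : ∀ p : ℤ, -1 ≤ p → p ≤ n → (p = -1 ∧ arr p = -1) ∨ (p = n ∧ arr p = n) ∨
      (0 ≤ arr p ∧ arr p < n ∧ pos (arr p) = p) := by
    intro p h1 h2
    by_cases h3 : p = -1
    · exact Or.inl ⟨h3, by rw [h3, hB.arr_neg]⟩
    · by_cases h4 : p = n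
      · exact Or.inr (Or.inl ⟨h4, by rw [h4, hB.arr_n]⟩)
      · have := hB.arr_mem p (by omega) (by omega)
        exact Or.inr (Or.inr ⟨this.1, this.2, hB.pos_arr p (by omega) (by omega)⟩)
  have h1 := key p hp.1 hp.2
  have h2 := key q hq.1 hq.2
  rw [h] at h1
  omega

lemma Linked.exists_neighbors {K a : ℕ} {arr pos bl start T mk nx prv : ℤ → ℤ}
    (hB : Base n K arr pos bl start) (hM : Marks n a T mk) (hL : Linked n arr mk nx prv) {z : ℤ}
    (hz : 0 ≤ z ∧ z < n) (hmz : mk (arr z) = 0) :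
    ∃ p q, -1 ≤ p ∧ p < z ∧ z < q ∧ q ≤ n ∧ mk (arr p) = 0 ∧ mk (arr q) = 0 ∧
      (∀ y, p < y → y < z → mk (arr y) ≠ 0) ∧ (∀ y, z < y → y < q → mk (arr y) ≠ 0) ∧
      prv (arr z) = arr p ∧ nx (arr z) = arr q := by
  have h1 : mk (arr (-1)) = 0 := by rw [hB.arr_neg]; exact hM.mk_neg (by omega)
  have h2 : mk (arr n) = 0 := by rw [hB.arr_n]; exact hM.mk_ge le_rfl
  obtain ⟨p, ⟨hp1, hp2, hp3⟩, hp4⟩ := Int.exists_greatest_of_bdd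
    (P := fun p => -1 ≤ p ∧ p < z ∧ mk (arr p) = 0) ⟨z, fun y hy => hy.2.1.le⟩
    ⟨-1, le_rfl, by omega, h1⟩
  obtain ⟨q, ⟨hq1, hq2, hq3⟩, hq4⟩ := Int.exists_least_of_bdd
    (P := fun q => z < q ∧ q ≤ n ∧ mk (arr q) = 0) ⟨z, fun y hy => hy.1.le⟩
    ⟨n, hz.2, le_rfl, h2⟩
  have hpz : ∀ y, p < y → y < z → mk (arr y) ≠ 0 := by
    intro y h3 h4 h5
    have := hp4 y ⟨by omega, h4, h5⟩
    omega
  have hzq : ∀ y, z < y → y < q → mk (arr y) ≠ 0 := by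
    intro y h3 h4 h5
    have := hq4 y ⟨h3, by omega, h5⟩
    omega
  exact ⟨p, q, hp1, hp2, hq1, hq2, hp3, hq3, hpz, hzq,
    (hL p z hp1 hp2 (by omega) hp3 hmz hpz).2, (hL z q (by omega) hq1 hq2 hmz hq3 hzq).1⟩

/-- Unlinking `z` creates just one new pair of neighbours, `p₀` and `q₀`. Any other pair of
consecutive unmarked positions was consecutive before and involves neither of the two overwritten
links. -/
lemma Linked.remove {K a : ℕ} {arr pos bl start mk nx prv : ℤ → ℤ}
    (hB : Base n K arr pos bl start) (hL : Linked n arr mk nx prv)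
    {z p₀ q₀ : ℤ} (hz : 0 ≤ z ∧ z < n) (hp₀ : -1 ≤ p₀ ∧ p₀ < z) (hq₀ : z < q₀ ∧ q₀ ≤ n)
    (hmp : mk (arr p₀) = 0) (hmq : mk (arr q₀) = 0)
    (hpz : ∀ y, p₀ < y → y < z → mk (arr y) ≠ 0) (hzq : ∀ y, z < y → y < q₀ → mk (arr y) ≠ 0) :
    Linked n arr (Function.update mk (arr z) (a + 1)) (Function.update nx (arr p₀) (arr q₀))
      (Function.update prv (arr q₀) (arr p₀)) := by
  have hlive : ∀ y : ℤ, -1 ≤ y → y ≤ n → (Function.update mk (arr z) (a + 1) (arr y) = 0 ↔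
      y ≠ z ∧ mk (arr y) = 0) := by
    intro y h1 h2
    by_cases hyz : y = z
    · subst hyz
      rw [Function.update_self]
      constructor
      · intro h; omega
      · intro h; exact absurd rfl h.1
    · rw [Function.update_of_ne fun h => hyz (hB.arr_inj' ⟨h1, h2⟩ (by omega) h)]
      simp [hyz]
  intro p q h1 h2 h3 h4 h5 h6
  rw [hlive p h1 (by omega)] at h4
  rw [hlive q (by omega) h3] at h5
  have h7 : ∀ y, p < y → y < q → y ≠ z → mk (arr y) ≠ 0 := by
    intro y h8 h9 h10 h11
    exact h6 y h8 h9 ((hlive y (by omega) (by omega)).2 ⟨h10, h11⟩)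
  by_cases hin : p < z ∧ z < q
  · have hpp : p = p₀ := by
      rcases lt_trichotomy p p₀ with h | h | h
      · exact absurd hmp (h7 p₀ h (by omega) (by omega))
      · exact h
      · exact absurd h4.2 (hpz p h hin.1)
    have hqq : q = q₀ := by
      rcases lt_trichotomy q q₀ with h | h | h
      · exact absurd h5.2 (hzq q hin.2 h)
      · exact h
      · exact absurd hmq (h7 q₀ (by omega) h (by omega))
    subst hpp hqq
    rw [Function.update_self, Function.update_self]
    exact ⟨rfl, rfl⟩
  · have h8 := hL p q h1 h2 h3 h4.2 h5.2 fun y h9 h10 => h7 y h9 h10 (by omega)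
    have hpp : p ≠ p₀ := by
      rintro rfl
      have : q < z := by omega
      exact hpz q h2 this h5.2
    have hqq : q ≠ q₀ := by
      rintro rfl
      have : z < p := by omega
      exact hzq p this h2 h4.2
    rw [Function.update_of_ne fun h => hpp (hB.arr_inj' ⟨h1, by omega⟩ (by omega) h),
      Function.update_of_ne fun h => hqq (hB.arr_inj' ⟨by omega, h3⟩ (by omega) h)]
    exact h8

lemma Marks.push {a : ℕ} {T mk : ℤ → ℤ} (h : Marks n a T mk) {x : ℤ} (hx : 0 ≤ x ∧ x < n)
    (hmx : mk x = 0) :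
    Marks n (a + 1) (Function.update T a x) (Function.update mk x (a + 1)) where
  T_mem r hr := by
    by_cases hra : r = a
    · subst hra; rw [Function.update_self]; exact hx
    · rw [Function.update_of_ne (by omega)]
      exact h.T_mem r (by omega)
  mk_T r hr := by
    by_cases hra : r = a
    · subst hra; rw [Function.update_self, Function.update_self]
    · have h1 := h.mk_T r (by omega)
      rw [Function.update_of_ne (by omega : (r : ℤ) ≠ a), Function.update_of_ne, h1]
      rintro he
      rw [he] at h1
      omega
  T_mk y hy := by
    by_cases hyx : y = x
    · subst hyx
      rw [Function.update_self]
      refine ⟨by omega, by push_cast; omega, ?_⟩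
      rw [show (a : ℤ) + 1 - 1 = a by ring, Function.update_self]
    · rw [Function.update_of_ne hyx] at hy ⊢
      obtain ⟨h1, h2, h3⟩ := h.T_mk y hy
      refine ⟨h1, by push_cast; omega, ?_⟩
      rw [Function.update_of_ne (by omega), h3]

/-- Marking takes constant time thanks to the double links. The bound `a + 1 < n` ensures that an
unmarked element remains. -/
lemma markCmd_spec {K a : ℕ} {s : State} (hS : Stage n K a s) (ha : a + 1 < n) {x : ℤ}
    (hx : s.int 31 0 = x) (hxn : 0 ≤ x ∧ x < n) :
    Ens f EO markCmd s fun s' => (∃ a' ≤ a + 1, Stage n K a' s') ∧ s'.int 17 x ≠ 0 ∧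
      s'.time ≤ s.time + 6 := by
  refine Ens.branch (fun ht => ?_) (fun ht => ?_)
  · have hm : s.int 17 x = 0 := by
      simp only [Test.Holds, IntExpr.eval, hx] at ht
      by_contra h0
      have := hS.marks.T_mk x h0
      omega
    have hpm := hS.base.pos_mem x hxn.1 hxn.2
    have hap := hS.base.arr_pos x hxn.1 hxn.2
    obtain ⟨p, q, hp1, hp2, hq1, hq2, hmp, hmq, hpz, hzq, hprv, hnx⟩ :=
      hS.link.exists_neighbors hS.base hS.marks hpm (by rw [hap]; exact hm)
    have hL := hS.link.remove (a := a) hS.base hpm ⟨hp1, hp2⟩ ⟨hq1, hq2⟩ hmp hmq hpz hzq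
    rw [hap] at hprv hnx hL
    -- The last command reads the successor of `x` after the link of its predecessor has been
    -- overwritten, so the two addresses must differ.
    have hne : x ≠ s.int 8 p := by
      intro he
      rw [← hap] at he
      have := hS.base.arr_inj' ⟨by omega, by omega⟩ ⟨by omega, by omega⟩ he
      omega
    refine Ens.seq (Ens.setInt (Ens.seq (Ens.setInt (Ens.seq (Ens.setInt (Ens.seq (Ens.setInt
      (Ens.setInt ?_))))))))
    refine ⟨⟨a + 1, le_rfl, ?_⟩, ?_, ?_⟩
    · have e : ∀ s' : State, s'.int 0 = s.int 0 → s'.int 2 = s.int 2 → s'.int 7 0 = a + 1 →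
          s'.int 8 = s.int 8 → s'.int 9 = s.int 9 → s'.int 10 = s.int 10 →
          s'.int 12 = s.int 12 → s'.int 13 = s.int 13 → s'.int 11 = s.int 11 →
          s'.int 16 = Function.update (s.int 16) a x →
          s'.int 17 = Function.update (s.int 17) x (a + 1) →
          s'.int 14 = Function.update (s.int 14) (s.int 8 p) (s.int 8 q) →
          s'.int 15 = Function.update (s.int 15) (s.int 8 q) (s.int 8 p) →
          Stage n K (a + 1) s' := by
        intro s' e0 e2 e7 e8 e9 e10 e12 e13 e11 e16 e17 e14 e15
        constructor
        · rw [e0]; exact hS.hn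
        · rw [e2]; exact hS.hK
        · rw [e7]; push_cast; ring
        · rw [e8, e9, e10, e12]; exact hS.base
        · rw [e16, e17]; exact hS.marks.push hxn hm
        · rw [e8, e17, e14, e15]; exact hL
        · rw [e13]; exact hS.idn
        · rw [e11]; exact hS.cl_mem
        · rw [e11, e10, e17]
          intro y h1 h2 h3
          refine hS.cl_eq y h1 h2 ?_
          by_cases hyx : y = x
          · rw [hyx]; exact hm
          · rwa [Function.update_of_ne hyx] at h3
        · exact ha
      apply e
      · rfl
      · rfl
      · simp [IntExpr.eval, hS.ha]
      · rfl
      · rfl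
      · rfl
      · rfl
      · rfl
      · rfl
      · simp [IntExpr.eval, hS.ha, hx]
      · simp [IntExpr.eval, hS.ha, hx]
      · simp [IntExpr.eval, hx, hprv, hnx]
      · simp [IntExpr.eval, hx, hprv, hnx, hne]
    · simp [IntExpr.eval, hx, hS.ha]
      omega
    · simp; linarith
  · refine Ens.skip ⟨⟨a, by omega, hS.congr (fun b _ => rfl) (fun y _ => rfl)⟩, ?_, ?_⟩
    · simp only [Test.Holds, IntExpr.eval, hx] at ht
      simp only [State.tick_int]
      omega
    · simp; linarith

/-- The element has to be marked first, since unmarked elements must keep their base levels. -/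
lemma levelCmd_spec {K a : ℕ} {s : State} (hS : Stage n K a s) {x : ℤ}
    (hx : s.int 31 0 = x) (hxn : 0 ≤ x ∧ x < n) (hm : s.int 17 x ≠ 0) :
    Ens f EO levelCmd s fun s' => Stage n K a s' ∧
      s'.int 11 = Function.update (s.int 11) x
        (if 1 ≤ s.int 30 0 then max 0 (s.int 11 x - 1) else min K (s.int 11 x + 1)) ∧
      s'.time ≤ s.time + 3 := by
  have hcl := hS.cl_mem x hxn.1 hxn.2
  have e : ∀ (s' : State) (y : ℤ), 0 ≤ y → y ≤ K →
      (∀ b ∈ [0, 2, 7, 8, 9, 10, 12, 13, 14, 15, 16, 17], s'.int b = s.int b) →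
      s'.int 11 = Function.update (s.int 11) x y → Stage n K a s' := by
    intro s' y hy0 hyK hb e11
    constructor
    · rw [hb 0 (by decide)]; exact hS.hn
    · rw [hb 2 (by decide)]; exact hS.hK
    · rw [hb 7 (by decide)]; exact hS.ha
    · rw [hb 8 (by decide), hb 9 (by decide), hb 10 (by decide), hb 12 (by decide)]
      exact hS.base
    · rw [hb 16 (by decide), hb 17 (by decide)]; exact hS.marks
    · rw [hb 8 (by decide), hb 17 (by decide), hb 14 (by decide), hb 15 (by decide)]
      exact hS.link
    · rw [hb 13 (by decide)]; exact hS.idn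
    · intro z h1 h2
      rw [e11]
      by_cases hz : z = x
      · subst hz; rw [Function.update_self]; exact ⟨hy0, hyK⟩
      · rw [Function.update_of_ne hz]; exact hS.cl_mem z h1 h2
    · intro z h1 h2 h3
      rw [hb 17 (by decide)] at h3
      have hz : z ≠ x := by rintro rfl; exact hm h3
      rw [e11, hb 10 (by decide), Function.update_of_ne hz]
      exact hS.cl_eq z h1 h2 h3
    · exact hS.a_lt
  refine Ens.branch (fun ht => Ens.branch (fun ht' => Ens.setInt ?_) fun ht' => Ens.skip ?_)
    (fun ht => Ens.branch (fun ht' => Ens.setInt ?_) fun ht' => Ens.skip ?_) <;>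
    simp only [Test.Holds, IntExpr.eval, State.tick_int, hx, hS.hK] at ht ht'
  · have hval : (if 1 ≤ s.int 30 0 then max 0 (s.int 11 x - 1) else min K (s.int 11 x + 1)) =
        s.int 11 x - 1 := by rw [if_pos ht]; omega
    rw [hval]
    have h11 : ((((s.tick 1).tick 1).writeInt 11 (IntExpr.eval ((s.tick 1).tick 1) (iv 31))
        (IntExpr.eval ((s.tick 1).tick 1) (.sub (.get 11 (iv 31)) (.const 1)))).tick 1).int 11 =
        Function.update (s.int 11) x (s.int 11 x - 1) := by
      simp [IntExpr.eval, hx]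
    refine ⟨e _ _ (by omega) (by omega) ?_ h11, h11, ?_⟩
    · intro b hb; fin_cases hb <;> rfl
    · simp; linarith
  · have hval : (if 1 ≤ s.int 30 0 then max 0 (s.int 11 x - 1) else min K (s.int 11 x + 1)) =
        s.int 11 x := by rw [if_pos ht]; omega
    rw [hval, Function.update_eq_self]
    refine ⟨hS.congr (fun b _ => rfl) (fun y _ => rfl), rfl, ?_⟩
    simp; linarith
  · have hval : (if 1 ≤ s.int 30 0 then max 0 (s.int 11 x - 1) else min K (s.int 11 x + 1)) =
        s.int 11 x + 1 := by rw [if_neg ht]; omega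
    rw [hval]
    have h11 : ((((s.tick 1).tick 1).writeInt 11 (IntExpr.eval ((s.tick 1).tick 1) (iv 31))
        (IntExpr.eval ((s.tick 1).tick 1) (.add (.get 11 (iv 31)) (.const 1)))).tick 1).int 11 =
        Function.update (s.int 11) x (s.int 11 x + 1) := by
      simp [IntExpr.eval, hx]
    refine ⟨e _ _ (by omega) (by omega) ?_ h11, h11, ?_⟩
    · intro b hb; fin_cases hb <;> rfl
    · simp; linarith
  · have hval : (if 1 ≤ s.int 30 0 then max 0 (s.int 11 x - 1) else min K (s.int 11 x + 1)) =
        s.int 11 x := by rw [if_neg ht]; omega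
    rw [hval, Function.update_eq_self]
    refine ⟨hS.congr (fun b _ => rfl) (fun y _ => rfl), rfl, ?_⟩
    simp; linarith

end

/-! ### One random step. -/

/-- Compute the marginal of the element in bank `31`, which has position `iv 27`. -/
def margOfCmd : Command :=
  .branch (.intLE (.get 17 (iv 31)) (.const 0))
    (setI 18 (.get 10 (iv 31)) ;; setI 19 (iv 7) ;; setI 20 (iv 27) ;; askCmd ;; setR 8 (rv 2) ;;
      setI 20 (.add (iv 27) (.const 1)) ;; askCmd ;; setR 8 (.sub (rv 2) (rv 8)))
    (setR 8 (.get 3 (.sub (.get 17 (iv 31)) (.const 1))))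

/-- Move the element at position `iv 27` by a random step. -/
def chooseCmd : Command :=
  setI 31 (.get 8 (iv 27)) ;; margOfCmd ;;
  .flip (.div (.add (.sub (rv 6) (rv 5)) (rv 8)) (.mul (.const 2) (.sub (rv 6) (rv 5)))) 30
    (.const 0) ;;
  markCmd ;; levelCmd

def descentBody : Command :=
  setI 29 (.half (.add (iv 27) (iv 28))) ;; setI 20 (iv 29) ;; cumCmd ;;
  .flip (.div (.sub (rv 7) (rv 5)) (.sub (rv 6) (rv 5))) 30 (.const 0) ;;
  .branch (.intLE (.const 1) (iv 30)) (setI 28 (iv 29) ;; setR 6 (rv 7))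
    (setI 27 (iv 29) ;; setR 5 (rv 7))

/-- Randomized binary search for a position. -/
def descentCmd : Command := .loop (.intLE (.add (iv 27) (.const 2)) (iv 28)) descentBody

/-- One step of stochastic subgradient descent. -/
def stepCmd : Command :=
  margCmd ;; setI 20 (iv 0) ;; cumCmd ;; setR 6 (rv 7) ;; setI 20 (.const 0) ;; cumCmd ;;
  setR 5 (rv 7) ;; .flip (.div (.sub (rv 6) (rv 5)) (.const 12)) 30 (.const 0) ;;
  .branch (.intLE (.const 1) (iv 30))
    (setI 27 (.const 0) ;; setI 28 (iv 0) ;; descentCmd ;; chooseCmd) .skip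

noncomputable section

variable {n : ℕ} {f : Finset (Fin n) → ℝ} {EO : ℝ}

/-- The two successor states differ in the written cell, so an intermediate bound can assign them
separate values. -/
lemma Bounded.flip_seq {p : RealExpr} {a : ℕ} {i : IntExpr} {c : Command} {s : State}
    {φ : State → ℝ≥0∞} {x y : ℝ} (hp0 : 0 ≤ p.eval s) (hp1 : p.eval s ≤ 1) (hx : 0 ≤ x)
    (hy : 0 ≤ y) (h₁ : Bounded f EO c ((s.writeInt a (i.eval s) 1).tick 1) φ (ENNReal.ofReal x))
    (h₀ : Bounded f EO c ((s.writeInt a (i.eval s) 0).tick 1) φ (ENNReal.ofReal y)) :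
    Bounded f EO (.seq (.flip p a i) c) s φ
      (ENNReal.ofReal (p.eval s * x + (1 - p.eval s) * y)) := by
  classical
  have hne : (s.writeInt a (i.eval s) 0).tick 1 ≠ (s.writeInt a (i.eval s) 1).tick 1 := by
    intro h
    have := congrArg (fun t => t.int a (i.eval s)) h
    simp at this
  refine Bounded.seq (ψ := fun s' => if s' = (s.writeInt a (i.eval s) 1).tick 1 then
    ENNReal.ofReal x else if s' = (s.writeInt a (i.eval s) 0).tick 1 then ENNReal.ofReal y else ⊤)
    (Bounded.flip hp0 hp1 hx hy ?_ ?_) ?_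
  · simp
  · simp [hne]
  · intro s'
    by_cases hs1 : s' = (s.writeInt a (i.eval s) 1).tick 1
    · simpa [hs1] using h₁
    · by_cases hs0 : s' = (s.writeInt a (i.eval s) 0).tick 1
      · simpa [hs0, hne] using h₀
      · simp [hs1, hs0, Bounded.top]

/-- The state during a step that started in `s₀`. -/
structure StepCtx (f : Finset (Fin n) → ℝ) (K a : ℕ) (s₀ s : State) : Prop where
  stage : Stage n K a s
  neg : NegSums f s
  table : MargTable f a s a
  keep : ∀ b ∈ [0, 1, 2, 3, 4, 5, 6, 7, 8, 9, 10, 11, 12, 13, 15, 16, 17], s.int b = s₀.int b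
  keep_real : s.real 0 = s₀.real 0

lemma NegSums.congr {s s' : State} (h : NegSums f s) (h9 : s'.int 9 = s.int 9)
    (h1 : s'.real 1 = s.real 1) : NegSums f s' := by
  intro k hk
  rw [h1, h9]
  exact h k hk

lemma MargTable.congr {a q : ℕ} {s s' : State} (h : MargTable f a s q)
    (hb : ∀ b ∈ [9, 11, 17], s'.int b = s.int b) (h3 : s'.real 3 = s.real 3)
    (h9 : s'.real 9 = s.real 9) : MargTable f a s' q := by
  intro i
  unfold curMarg
  rw [hb 17 (by decide), hb 9 (by decide), hb 11 (by decide), h3, h9]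
  exact h i

lemma StepCtx.congr {K a : ℕ} {s₀ s s' : State} (h : StepCtx f K a s₀ s)
    (hb : ∀ b ∈ [0, 1, 2, 3, 4, 5, 6, 7, 8, 9, 10, 11, 12, 13, 15, 16, 17], s'.int b = s.int b)
    (hx : ∀ x, s.int 17 x = 0 → s'.int 14 x = s.int 14 x)
    (hr : ∀ b ∈ [0, 1, 3, 9], s'.real b = s.real b) : StepCtx f K a s₀ s' where
  stage := h.stage.congr (fun b hm => hb b (by revert b; decide)) hx
  neg := h.neg.congr (hb 9 (by decide)) (hr 1 (by decide))
  table := h.table.congr (fun b hm => hb b (by revert b; decide)) (hr 3 (by decide))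
    (hr 9 (by decide))
  keep b hm := (hb b hm).trans (h.keep b hm)
  keep_real := (hr 0 (by decide)).trans h.keep_real

lemma StepCtx.curMarg_eq {K a : ℕ} {s₀ s : State} (h : StepCtx f K a s₀ s) (i : Fin n) :
    curMarg f a s i = curMarg f a s₀ i := by
  unfold curMarg
  rw [h.keep 9 (by decide), h.keep 11 (by decide), h.keep 17 (by decide)]

lemma StepCtx.cumWeight_eq {K a : ℕ} {s₀ s : State} (h : StepCtx f K a s₀ s) (k : ℤ) :
    cumWeight f a s k = cumWeight f a s₀ k := by
  unfold cumWeight curWeight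
  rw [h.keep 9 (by decide), h.keep 11 (by decide), h.keep 17 (by decide)]

lemma StepCtx.cumCmd_spec {K a : ℕ} {s₀ s : State} (h : StepCtx f K a s₀ s) {k : ℕ}
    (hk : s.int 20 0 = k) (hkn : k ≤ n) :
    Ens f EO cumCmd s fun s' => StepCtx f K a s₀ s' ∧
      s'.real 7 0 = f ∅ + cumWeight f a s₀ k ∧ s'.time ≤ s.time + 22 * a + 2 * EO + 24 ∧
      (∀ b ∈ [27, 28, 29, 30, 31], s'.int b = s.int b) ∧
      ∀ b ∈ [5, 6, 8], s'.real b = s.real b := by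
  refine (RealRAM.cumCmd_spec h.stage h.neg h.table hk hkn).frame.mono ?_
  rintro s' ⟨hF, h1, h2, h3, h4, h5⟩
  refine ⟨⟨h1, h2, h3, ?_, ?_⟩, ?_, h5, ?_, ?_⟩
  · intro b hb
    rw [← h.keep b hb]
    fin_cases hb <;> exact hF.1 _ (by decide)
  · rw [← h.keep_real]; exact hF.2 0 (by decide)
  · rw [h4, h.cumWeight_eq]
  · intro b hb; fin_cases hb <;> exact hF.1 _ (by decide)
  · intro b hb; fin_cases hb <;> exact hF.2 _ (by decide)

/-- The effect of a step on the state. -/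
structure StepPost (f : Finset (Fin n) → ℝ) (K a : ℕ) (s s' : State) : Prop where
  stage : ∃ a' ≤ a + 1, Stage n K a' s'
  neg : NegSums f s'
  keep : ∀ b ∈ [0, 1, 2, 3, 4, 5, 6, 8, 9, 10, 12, 13], s'.int b = s.int b
  keep_real : s'.real 0 = s.real 0
  close : ∀ x : ℤ, 0 ≤ x → x < n → |s'.int 11 x - s.int 11 x| ≤ 1

/-- The current grid point. -/
def levels (n : ℕ) (s : State) (i : Fin n) : ℤ := s.int 11 (i : ℕ)

/-- The expected potential after a random step that moves `i`. -/
def stepValue (f : Finset (Fin n) → ℝ) (K a : ℕ) (s : State) (S : Finset (Fin n)) (α β : ℝ)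
    (i : Fin n) : ℝ :=
  (curWeight f a s i + curMarg f a s i) / (2 * curWeight f a s i) *
      (α * sqDist K S (Function.update (levels n s) i (max 0 (levels n s i - 1))) + β) +
    (1 - (curWeight f a s i + curMarg f a s i) / (2 * curWeight f a s i)) *
      (α * sqDist K S (Function.update (levels n s) i (min K (levels n s i + 1))) + β)

lemma levels_update {s s' : State} {i : Fin n} {y : ℤ}
    (h : s'.int 11 = Function.update (s.int 11) (i : ℕ) y) :
    levels n s' = Function.update (levels n s) i y := by
  funext j
  unfold levels
  rw [h]
  by_cases hij : j = i
  · subst hij; simp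
  · rw [Function.update_of_ne hij, Function.update_of_ne]
    intro he
    exact hij (Fin.ext (by omega))

lemma margOfCmd_spec {K a : ℕ} {s₀ s : State} (h : StepCtx f K a s₀ s) {i : Fin n}
    (h31 : s.int 31 0 = (i : ℕ)) (h27 : s.int 27 0 = s.int 9 (i : ℕ)) (hEO : 0 ≤ EO) :
    Ens f EO margOfCmd s fun s' => StepCtx f K a s₀ s' ∧ s'.real 8 0 = curMarg f a s₀ i ∧
      s'.int 31 0 = (i : ℕ) ∧ s'.real 5 = s.real 5 ∧ s'.real 6 = s.real 6 ∧
      s'.time ≤ s.time + 22 * a + 2 * EO + 25 := by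
  have hi := Fin.int_mem i
  have hp := h.stage.base.pos_mem _ hi.1 hi.2
  obtain ⟨k, hk⟩ : ∃ k : ℕ, (k : ℤ) = s.int 9 (i : ℕ) := ⟨(s.int 9 (i : ℕ)).toNat, by omega⟩
  refine Ens.branch (fun ht => ?_) (fun ht => ?_)
  · have hm : s.int 17 (i : ℕ) = 0 := by
      simp only [Test.Holds, IntExpr.eval, h31] at ht
      have := h.stage.order.mk_nonneg i
      omega
    have hcur := h.stage.order.marg_of_unmarked (f := f) hm
    rw [← hk] at hcur
    refine Ens.seq (Ens.setInt (Ens.seq (Ens.setInt (Ens.seq (Ens.setInt (Ens.seq ?_))))))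
    refine (askCmd_spec (K := K) (a := a) (k := k) (h.stage.congr ?_ ?_) ?_
      (by omega)).frame.mono ?_
    · intro b hb; fin_cases hb <;> rfl
    · intro x _; rfl
    · simp [IntExpr.eval, h27, hk]
    rintro s₁ ⟨hF₁, hres₁, -, h14₁, ht₁⟩
    have hb₁ : ∀ b ∈ [0, 1, 2, 3, 4, 5, 6, 7, 8, 9, 10, 11, 12, 13, 15, 16, 17, 27, 31],
        s₁.int b = s.int b := by
      intro b hb
      fin_cases hb <;> exact hF₁.1 _ (by decide)
    have h14₁' : ∀ x, s.int 17 x = 0 → s₁.int 14 x = s.int 14 x := h14₁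
    have hr₁ : ∀ b ∈ [0, 1, 3, 9, 5, 6], s₁.real b = s.real b := by
      intro b hb
      fin_cases hb <;> exact hF₁.2 _ (by decide)
    have h₁ : StepCtx f K a s₀ s₁ := h.congr (fun b hb => hb₁ b (by revert b; decide)) h14₁'
      (fun b hb => hr₁ b (by revert b; decide))
    have e18 : s₁.int 18 0 = s.int 10 (i : ℕ) := by
      rw [hF₁.1 18 (by decide)]; simp [IntExpr.eval, h31]
    have e19 : s₁.int 19 0 = a := by
      rw [hF₁.1 19 (by decide)]; simp [IntExpr.eval, h.stage.ha]
    have hA₁ : s₁.real 2 0 =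
        f (askSet n (s.int 9) (s.int 11) (s.int 17) (s.int 10 (i : ℕ)) a k) := by
      rw [hres₁]
      simp [IntExpr.eval, h31, h.stage.ha]
    refine Ens.seq (Ens.setReal (Ens.seq (Ens.setInt (Ens.seq ?_))))
    refine (askCmd_spec (K := K) (a := a) (k := k + 1) (h₁.stage.congr ?_ ?_) ?_
      (by omega)).frame.mono ?_
    · intro b hb; fin_cases hb <;> rfl
    · intro x _; rfl
    · simp [IntExpr.eval, hb₁ 27 (by decide), h27, hk]
    rintro s₂ ⟨hF₂, hres₂, -, h14₂, ht₂⟩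
    have hb₂ : ∀ b ∈ [0, 1, 2, 3, 4, 5, 6, 7, 8, 9, 10, 11, 12, 13, 15, 16, 17, 27, 31],
        s₂.int b = s₁.int b := by
      intro b hb
      fin_cases hb <;> exact hF₂.1 _ (by decide)
    have h14₂' : ∀ x, s₁.int 17 x = 0 → s₂.int 14 x = s₁.int 14 x := h14₂
    have hr₂ : ∀ b ∈ [0, 1, 3, 9, 5, 6], s₂.real b = s₁.real b := by
      intro b hb
      fin_cases hb <;> exact hF₂.2 _ (by decide)
    have h₂ : StepCtx f K a s₀ s₂ := h₁.congr (fun b hb => hb₂ b (by revert b; decide)) h14₂'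
      (fun b hb => hr₂ b (by revert b; decide))
    have e8 : s₂.real 8 0 = s₁.real 2 0 := by
      rw [hF₂.2 8 (by decide)]; simp [RealExpr.eval, IntExpr.eval]
    have hA₂ : s₂.real 2 0 =
        f (askSet n (s.int 9) (s.int 11) (s.int 17) (s.int 10 (i : ℕ)) a (k + 1)) := by
      rw [hres₂]
      simp [e18, e19, hb₁ 9 (by decide), hb₁ 11 (by decide), hb₁ 17 (by decide)]
    refine Ens.setReal ⟨h₂.congr (fun b _ => rfl) (fun x _ => rfl) ?_, ?_, ?_, ?_, ?_, ?_⟩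
    · intro b hb; fin_cases hb <;> rfl
    · rw [← h.curMarg_eq, curMarg, hcur]
      simp [RealExpr.eval, IntExpr.eval, hA₂, e8, hA₁]
    · simp [hb₂ 31 (by decide), hb₁ 31 (by decide), h31]
    · simp [hr₂ 5 (by decide), hr₁ 5 (by decide)]
    · simp [hr₂ 6 (by decide), hr₁ 6 (by decide)]
    · simp at ht₁ ht₂ ⊢
      linarith
  · have hm : s.int 17 (i : ℕ) ≠ 0 := by
      simp only [Test.Holds, IntExpr.eval, h31] at ht
      omega
    have hval := (h.table i hm (h.stage.order.mk_le i)).1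
    refine Ens.setReal ⟨h.congr (fun b _ => rfl) (fun x _ => rfl) ?_, ?_, ?_, ?_, ?_, ?_⟩
    · intro b hb; fin_cases hb <;> rfl
    · rw [← h.curMarg_eq, ← hval]
      simp [RealExpr.eval, IntExpr.eval, h31]
    · simpa using h31
    · simp
    · simp
    · have : (0 : ℝ) ≤ a := Nat.cast_nonneg a
      simp; linarith

lemma moveCmd_spec {K a : ℕ} {s₀ s : State} (h : StepCtx f K a s₀ s) (ha : a + 1 < n) {i : Fin n}
    (h31 : s.int 31 0 = (i : ℕ)) :
    Ens f EO (markCmd ;; levelCmd) s fun s' => StepPost f K a s₀ s' ∧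
      levels n s' = Function.update (levels n s₀) i (if 1 ≤ s.int 30 0 then
        max 0 (levels n s₀ i - 1) else min K (levels n s₀ i + 1)) ∧ s'.time ≤ s.time + 9 := by
  have hi := Fin.int_mem i
  refine Ens.seq ((markCmd_spec h.stage ha h31 hi).frame.mono ?_)
  rintro s₁ ⟨hF₁, ⟨a', ha', hS₁⟩, hm₁, ht₁⟩
  refine (levelCmd_spec hS₁ (x := (i : ℕ)) (by rw [hF₁.1 31 (by decide)]; exact h31) hi
    hm₁).frame.mono ?_
  rintro s₂ ⟨hF₂, hS₂, h11, ht₂⟩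
  rw [hF₁.1 11 (by decide), hF₁.1 30 (by decide), h.keep 11 (by decide)] at h11
  have hcl := h.stage.cl_mem _ hi.1 hi.2
  rw [h.keep 11 (by decide)] at hcl
  refine ⟨⟨⟨a', ha', hS₂⟩, ?_, ?_, ?_, ?_⟩, ?_, by linarith⟩
  · refine h.neg.congr ?_ ?_
    · rw [hF₂.1 9 (by decide), hF₁.1 9 (by decide)]
    · rw [hF₂.2 1 (by decide), hF₁.2 1 (by decide)]
  · intro b hb
    have h1 : s₂.int b = s₁.int b := by fin_cases hb <;> exact hF₂.1 _ (by decide)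
    have h2 : s₁.int b = s.int b := by fin_cases hb <;> exact hF₁.1 _ (by decide)
    rw [h1, h2]
    clear h1 h2
    exact h.keep b (by revert b; decide)
  · rw [hF₂.2 0 (by decide), hF₁.2 0 (by decide), h.keep_real]
  · intro x _ _
    rw [h11]
    by_cases hx : x = (i : ℕ)
    · subst hx
      rw [Function.update_self, abs_le]
      split_ifs <;> omega
    · rw [Function.update_of_ne hx]; simp
  · exact levels_update h11

lemma StepCtx.order₀ {K a : ℕ} {s₀ s : State} (h : StepCtx f K a s₀ s) :
    StageOrder n a (s₀.int 9) (s₀.int 10) (s₀.int 11) (s₀.int 17) := by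
  have := h.stage.order
  rwa [h.keep 9 (by decide), h.keep 10 (by decide), h.keep 11 (by decide),
    h.keep 17 (by decide)] at this

/-- For the sampled `i`, banks `6` and `5` of the binary search differ by the weight of `i`, so the
bias of the second coin needs only the marginal of `i`. -/
lemma chooseCmd_spec {K a : ℕ} {s₀ s : State} (hf : Submodular f) (h : StepCtx f K a s₀ s)
    (ha : a + 1 < n) (hEO : 0 ≤ EO) {i : Fin n} {lo : ℕ} (hlo : lo < n) (h27 : s.int 27 0 = lo)
    (harr : s₀.int 8 lo = (i : ℕ)) (hw : s.real 6 0 - s.real 5 0 = curWeight f a s₀ i)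
    {S : Finset (Fin n)} {α β : ℝ} (hα : 0 ≤ α) (hβ : 0 ≤ β) {τ : ℝ} {ψ : State → ℝ≥0∞}
    (ht : s.time + 22 * a + 2 * EO + 40 ≤ τ)
    (hψ : ∀ s', StepPost f K a s₀ s' → s'.time ≤ τ →
      ψ s' ≤ ENNReal.ofReal (α * sqDist K S (levels n s') + β)) :
    Bounded f EO chooseCmd s ψ (ENNReal.ofReal (stepValue f K a s₀ S α β i)) := by
  have hpos : (lo : ℤ) = s.int 9 (i : ℕ) := by
    rw [← harr, ← h.keep 8 (by decide)]
    exact (h.stage.base.pos_arr lo (by omega) (by omega)).symm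
  refine Ens.seq_bounded (Ens.setInt (Ens.seq_bounded ?_))
  refine (margOfCmd_spec (K := K) (a := a) (s₀ := s₀) (i := i) (h.congr ?_ ?_ ?_) ?_ ?_
    hEO).mono ?_
  · intro b hb; fin_cases hb <;> rfl
  · intro x _; rfl
  · intro b _; rfl
  · simp [IntExpr.eval, h27, h.keep 8 (by decide), harr]
  · simp [h27, hpos]
  rintro s₁ ⟨h₁, h8, h31, h5, h6, ht₁⟩
  have h5' : s₁.real 5 0 = s.real 5 0 := by rw [h5]; rfl
  have h6' : s₁.real 6 0 = s.real 6 0 := by rw [h6]; rfl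
  have hp : (RealExpr.div (.add (.sub (rv 6) (rv 5)) (rv 8))
      (.mul (.const 2) (.sub (rv 6) (rv 5)))).eval s₁ =
      (curWeight f a s₀ i + curMarg f a s₀ i) / (2 * curWeight f a s₀ i) := by
    simp [RealExpr.eval, IntExpr.eval, h5', h6', h8, hw]
  have habs := abs_le.1 (h.order₀.abs_marg_le_weight hf i)
  change -curWeight f a s₀ i ≤ curMarg f a s₀ i ∧ curMarg f a s₀ i ≤ curWeight f a s₀ i at habs
  have hw0 : 0 ≤ curWeight f a s₀ i := by linarith
  have hres : ∀ b : ℤ, ∀ u : State, u = (s₁.writeInt 30 0 b).tick 1 →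
      Bounded f EO (markCmd ;; levelCmd) u ψ (ENNReal.ofReal (α * sqDist K S
        (Function.update (levels n s₀) i (if 1 ≤ b then
          max 0 (levels n s₀ i - 1) else min K (levels n s₀ i + 1))) + β)) := by
    intro b u hu
    refine Ens.bounded ((moveCmd_spec (s₀ := s₀) (i := i) (h₁.congr ?_ ?_ ?_) ha ?_).mono ?_)
    · intro b hb; rw [hu]; fin_cases hb <;> rfl
    · intro x _; rw [hu]; rfl
    · intro b _; rw [hu]; rfl
    · rw [hu]; simpa using h31
    · rintro s' ⟨hpost, hlev, ht'⟩
      have h30 : u.int 30 0 = b := by rw [hu]; simp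
      rw [h30] at hlev
      rw [← hlev]
      refine hψ s' hpost ?_
      rw [hu] at ht'
      simp at ht₁ ht'
      linarith
  have hmain := Bounded.flip_seq (p := RealExpr.div (.add (.sub (rv 6) (rv 5)) (rv 8))
      (.mul (.const 2) (.sub (rv 6) (rv 5)))) (a := 30) (i := .const 0)
    (x := α * sqDist K S (Function.update (levels n s₀) i (max 0 (levels n s₀ i - 1))) + β)
    (y := α * sqDist K S (Function.update (levels n s₀) i (min K (levels n s₀ i + 1))) + β)
    -- The bias lies in `[0, 1]` because `|g i| ≤ w i`; at weight `0` the quotient is `0`.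
    (by rw [hp]; exact div_nonneg (by linarith) (by linarith))
    (by rw [hp]; exact div_le_one_of_le₀ (by linarith) (by linarith))
    (add_nonneg (mul_nonneg hα (sqDist_nonneg _ _ _)) hβ)
    (add_nonneg (mul_nonneg hα (sqDist_nonneg _ _ _)) hβ)
    (by simpa [IntExpr.eval] using hres 1 _ rfl) (by simpa [IntExpr.eval] using hres 0 _ rfl)
  rw [hp] at hmain
  exact hmain

/-- Sums over the elements at the positions in `[lo, hi)`. -/
def posSum (n : ℕ) (pos : ℤ → ℤ) (lo hi : ℤ) (F : Fin n → ℝ) : ℝ :=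
  ∑ i ∈ Finset.univ.filter (fun i : Fin n => lo ≤ pos (i : ℕ) ∧ pos (i : ℕ) < hi), F i

lemma posSum_add {pos : ℤ → ℤ} {lo mid hi : ℤ} (h₁ : lo ≤ mid) (h₂ : mid ≤ hi) (F : Fin n → ℝ) :
    posSum n pos lo mid F + posSum n pos mid hi F = posSum n pos lo hi F := by
  unfold posSum
  rw [← Finset.sum_union]
  · congr 1
    ext i
    simp only [Finset.mem_union, Finset.mem_filter, Finset.mem_univ, true_and]
    omega
  · rw [Finset.disjoint_left]
    intro i
    simp only [Finset.mem_filter, Finset.mem_univ, true_and]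
    omega

lemma posSum_nonneg {pos : ℤ → ℤ} {lo hi : ℤ} {F : Fin n → ℝ} (hF : ∀ i, 0 ≤ F i) :
    0 ≤ posSum n pos lo hi F :=
  Finset.sum_nonneg fun i _ => hF i

lemma cumWeight_sub {a : ℕ} {s : State} (hpos : ∀ i : Fin n, 0 ≤ s.int 9 (i : ℕ)) {lo hi : ℤ}
    (h0 : 0 ≤ lo) (h : lo ≤ hi) :
    cumWeight f a s hi - cumWeight f a s lo = posSum n (s.int 9) lo hi (curWeight f a s) := by
  have e : ∀ k, cumWeight f a s k = posSum n (s.int 9) 0 k (curWeight f a s) := by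
    intro k
    unfold cumWeight posSum
    congr 1
    ext i
    simp [hpos i]
  rw [e, e, ← posSum_add h0 h]
  ring

lemma posSum_single {K : ℕ} {arr pos bl start : ℤ → ℤ} (hB : Base n K arr pos bl start) {lo : ℕ}
    {i : Fin n} (hlo : lo < n) (harr : arr lo = (i : ℕ)) (F : Fin n → ℝ) :
    posSum n pos lo (lo + 1) F = F i := by
  unfold posSum
  rw [Finset.sum_eq_single_of_mem i]
  · have := hB.pos_arr lo (by omega) (by omega)
    rw [harr] at this
    simp only [Finset.mem_filter, Finset.mem_univ, true_and]
    omega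
  · intro j hj hji
    simp only [Finset.mem_filter, Finset.mem_univ, true_and] at hj
    have h1 := hB.arr_pos _ (Fin.int_mem j).1 (Fin.int_mem j).2
    rw [show pos (j : ℕ) = lo by omega, harr] at h1
    exact absurd (Fin.ext (by omega)) hji

/-- A state in which the binary search has found the position of `i`. -/
structure Found (f : Finset (Fin n) → ℝ) (K a : ℕ) (s₀ : State) (τ : ℝ) (s : State) (i : Fin n) :
    Prop where
  ctx : StepCtx f K a s₀ s
  pos : ∃ lo : ℕ, lo < n ∧ s.int 27 0 = lo ∧ s₀.int 8 lo = (i : ℕ)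
  weight : s.real 6 0 - s.real 5 0 = curWeight f a s₀ i
  time : s.time ≤ τ

/-- Both groupings execute the same commands in the same order; only the recursion depth differs. -/
lemma Bounded.assoc {c₁ c₂ c₃ : Command} {s : State} {φ : State → ℝ≥0∞} {v : ℝ≥0∞}
    (h : Bounded f EO (.seq c₁ (.seq c₂ c₃)) s φ v) :
    Bounded f EO (.seq (.seq c₁ c₂) c₃) s φ v := by
  obtain ⟨d, hd⟩ := h
  refine ⟨d + 3, le_trans ?_ ((expect_run_antitone f EO (show d ≤ d + 2 by omega) _ s φ).trans hd)⟩
  simp only [run, expect_bind_elim]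
  exact expect_mono (fun s' => (expect_mono (fun s'' =>
    expect_run_antitone f EO (show d ≤ d + 2 by omega) c₃ s'' φ) _).trans
      (expect_run_antitone f EO (show d ≤ d + 1 by omega) c₂ s' _)) _

lemma StepCtx.weight_nonneg {K a : ℕ} {s₀ s : State} (hf : Submodular f)
    (h : StepCtx f K a s₀ s) (i : Fin n) : 0 ≤ curWeight f a s₀ i :=
  (abs_nonneg _).trans (h.order₀.abs_marg_le_weight hf i)

lemma StepCtx.base₀ {K a : ℕ} {s₀ s : State} (h : StepCtx f K a s₀ s) :
    Base n K (s₀.int 8) (s₀.int 9) (s₀.int 10) (s₀.int 12) := by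
  have := h.stage.base
  rwa [h.keep 8 (by decide), h.keep 9 (by decide), h.keep 10 (by decide),
    h.keep 12 (by decide)] at this

lemma descentCmd_single {K a : ℕ} {s₀ : State} {τ : ℝ} {φ : State → ℝ≥0∞}
    {B : Fin n → ℝ} (hφ : ∀ s i, Found f K a s₀ τ s i → φ s ≤ ENNReal.ofReal (B i)) {lo : ℕ}
    {i : Fin n} (hi : s₀.int 8 lo = (i : ℕ)) {s : State}
    (h : StepCtx f K a s₀ s) (h27 : s.int 27 0 = lo) (h28 : s.int 28 0 = (lo + 1 : ℕ))
    (hlo : lo < n) (h5 : s.real 5 0 = f ∅ + cumWeight f a s₀ lo)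
    (h6 : s.real 6 0 = f ∅ + cumWeight f a s₀ (lo + 1 : ℕ)) (ht : s.time + 1 ≤ τ) :
    Bounded f EO descentCmd s φ (ENNReal.ofReal (B i)) := by
  have hs := posSum_single h.base₀ hlo hi (curWeight f a s₀)
  refine Bounded.loop_false ?_ (hφ _ i ⟨h.congr (fun b _ => rfl) (fun x _ => rfl)
    (fun b _ => rfl), ⟨lo, hlo, h27, hi⟩, ?_, by simpa using ht⟩)
  · simp only [Test.Holds, IntExpr.eval, h27, h28]; push_cast; omega
  · have := cumWeight_sub (f := f) (a := a) (s := s₀) (h.order₀.pos_nonneg) (lo := lo)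
      (hi := lo + 1) (by omega) (by omega)
    push_cast at h6
    simp only [State.tick_real]
    rw [h5, h6, ← hs, ← this]
    ring

/-- A state in which the binary search has narrowed the positions to `[lo, hi)`. -/
structure Narrowed (f : Finset (Fin n) → ℝ) (K a : ℕ) (s₀ : State) (lo hi : ℕ) (τ : ℝ)
    (s : State) : Prop where
  ctx : StepCtx f K a s₀ s
  lo_eq : s.int 27 0 = lo
  hi_eq : s.int 28 0 = hi
  lo_real : s.real 5 0 = f ∅ + cumWeight f a s₀ lo
  hi_real : s.real 6 0 = f ∅ + cumWeight f a s₀ hi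
  time : s.time ≤ τ

/-- The halves are chosen with probabilities proportional to their weights, so the bounds of the two
halves are averaged accordingly. -/
lemma descentBody_spec {K a : ℕ} {s₀ : State} (hf : Submodular f) {lo mid hi : ℕ} {τ : ℝ}
    (hlo : lo < mid) (hhi : mid < hi) (hn : hi ≤ n) (hmid : mid = (lo + hi) / 2)
    {φ : State → ℝ≥0∞} {c : Command} {v₁ v₂ : ℝ} (hv₁ : 0 ≤ v₁) (hv₂ : 0 ≤ v₂)
    (h₁ : ∀ s, Narrowed f K a s₀ lo mid (τ + 22 * a + 2 * EO + 30) s →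
      Bounded f EO c s φ (ENNReal.ofReal v₁))
    (h₂ : ∀ s, Narrowed f K a s₀ mid hi (τ + 22 * a + 2 * EO + 30) s →
      Bounded f EO c s φ (ENNReal.ofReal v₂)) {s : State}
    (h : Narrowed f K a s₀ lo hi τ s) {p : ℝ}
    (hp : p = posSum n (s₀.int 9) lo mid (curWeight f a s₀) /
      posSum n (s₀.int 9) lo hi (curWeight f a s₀)) :
    Bounded f EO (.seq descentBody c) s φ (ENNReal.ofReal (p * v₁ + (1 - p) * v₂)) := by
  have hw := h.ctx.weight_nonneg hf
  have hd₁ : cumWeight f a s₀ mid - cumWeight f a s₀ lo = posSum n (s₀.int 9) lo mid _ :=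
    cumWeight_sub h.ctx.order₀.pos_nonneg (by omega) (by omega)
  have hd : cumWeight f a s₀ hi - cumWeight f a s₀ lo = posSum n (s₀.int 9) lo hi _ :=
    cumWeight_sub h.ctx.order₀.pos_nonneg (by omega) (by omega)
  have hsum := posSum_add (pos := s₀.int 9) (lo := lo) (mid := mid) (hi := hi) (by omega)
    (by omega) (curWeight f a s₀)
  have hn₁ : 0 ≤ posSum n (s₀.int 9) lo mid (curWeight f a s₀) := posSum_nonneg hw
  have hn₂ : 0 ≤ posSum n (s₀.int 9) mid hi (curWeight f a s₀) := posSum_nonneg hw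
  refine (Ens.seq_bounded (Ens.setInt (Bounded.assoc (Ens.seq_bounded (Ens.setInt
    (Bounded.assoc (Ens.seq_bounded ?_))))))).assoc
  refine (StepCtx.cumCmd_spec (s₀ := s₀) (k := mid) (h.ctx.congr ?_ ?_ ?_) ?_
    (by omega)).mono ?_
  · intro b hb; fin_cases hb <;> rfl
  · intro x _; rfl
  · intro b _; rfl
  · simp [IntExpr.eval, h.lo_eq, h.hi_eq, hmid]
  rintro s₁ ⟨h₁', h7, ht₁, hb₁, hr₁⟩
  have e27 : s₁.int 27 0 = lo := by rw [hb₁ 27 (by decide)]; exact h.lo_eq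
  have e28 : s₁.int 28 0 = hi := by rw [hb₁ 28 (by decide)]; exact h.hi_eq
  have e29 : s₁.int 29 0 = mid := by
    rw [hb₁ 29 (by decide)]; simp [IntExpr.eval, h.lo_eq, h.hi_eq, hmid]
  have e5 : s₁.real 5 0 = f ∅ + cumWeight f a s₀ lo := by
    rw [hr₁ 5 (by decide)]; exact h.lo_real
  have e6 : s₁.real 6 0 = f ∅ + cumWeight f a s₀ hi := by
    rw [hr₁ 6 (by decide)]; exact h.hi_real
  have ht₁' := h.time
  simp only [State.tick_time, State.writeInt_time] at ht₁
  have hpe : (RealExpr.div (.sub (rv 7) (rv 5)) (.sub (rv 6) (rv 5))).eval s₁ = p := by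
    rw [hp, ← hd₁, ← hd]
    simp only [RealExpr.eval, IntExpr.eval, h7, e5, e6]
    congr 1 <;> ring
  refine Bounded.assoc ?_
  rw [← hpe]
  refine Bounded.flip_seq ?_ ?_ hv₁ hv₂ ?_ ?_
  · rw [hpe, hp]; exact div_nonneg hn₁ (by linarith)
  · rw [hpe, hp]; exact div_le_one_of_le₀ (by linarith) (by linarith)
  · refine Ens.seq_bounded (Ens.branch (fun _ => ?_) (fun ht => ?_))
    · refine Ens.seq (Ens.setInt (Ens.setReal (h₁ _ ⟨h₁'.congr ?_ ?_ ?_, ?_, ?_, ?_, ?_, ?_⟩)))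
      · intro b hb; fin_cases hb <;> rfl
      · intro x _; rfl
      · intro b hb; fin_cases hb <;> rfl
      · simpa using e27
      · simpa [IntExpr.eval] using e29
      · simpa using e5
      · simpa [IntExpr.eval, RealExpr.eval] using h7
      · simp; linarith
    · simp [Test.Holds, IntExpr.eval] at ht
  · refine Ens.seq_bounded (Ens.branch (fun ht => ?_) (fun ht => ?_))
    · simp [Test.Holds, IntExpr.eval] at ht
    · refine Ens.seq (Ens.setInt (Ens.setReal (h₂ _ ⟨h₁'.congr ?_ ?_ ?_, ?_, ?_, ?_, ?_, ?_⟩)))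
      · intro b hb; fin_cases hb <;> rfl
      · intro x _; rfl
      · intro b hb; fin_cases hb <;> rfl
      · simpa [IntExpr.eval] using e29
      · simpa using e28
      · simpa [IntExpr.eval, RealExpr.eval] using h7
      · simpa using e6
      · simp; linarith

/-- The bound `v` is at most the `w`-average of `B` over `[lo, hi)`. Multiplying it by the total
weight avoids a division: an interval of weight `0` may return any element. Induction on the number
`e` of halvings. -/
lemma descentCmd_spec {K a : ℕ} {s₀ : State} (hf : Submodular f)
    (hbase : Base n K (s₀.int 8) (s₀.int 9) (s₀.int 10) (s₀.int 12))
    (hw : ∀ i, 0 ≤ curWeight f a s₀ i) {τ : ℝ} {φ : State → ℝ≥0∞}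
    {B : Fin n → ℝ} (hB : ∀ i, 0 ≤ B i)
    (hφ : ∀ s i, Found f K a s₀ τ s i → φ s ≤ ENNReal.ofReal (B i)) (hEO : 0 ≤ EO) (e : ℕ) :
    ∀ lo hi : ℕ, lo < hi → hi ≤ n → hi - lo ≤ 2 ^ e →
      ∃ v, 0 ≤ v ∧ posSum n (s₀.int 9) lo hi (curWeight f a s₀) * v ≤
          posSum n (s₀.int 9) lo hi (fun i => curWeight f a s₀ i * B i) ∧
        ∀ s, Narrowed f K a s₀ lo hi (τ - e * (22 * a + 2 * EO + 40) - 1) s →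
          Bounded f EO descentCmd s φ (ENNReal.ofReal v) := by
  have hsingle : ∀ (lo : ℕ) (τ' : ℝ), lo < n → τ' ≤ τ - 1 →
      ∃ v, 0 ≤ v ∧ posSum n (s₀.int 9) lo (lo + 1 : ℕ) (curWeight f a s₀) * v ≤
          posSum n (s₀.int 9) lo (lo + 1 : ℕ) (fun i => curWeight f a s₀ i * B i) ∧
        ∀ s, Narrowed f K a s₀ lo (lo + 1) τ' s →
          Bounded f EO descentCmd s φ (ENNReal.ofReal v) := by
    intro lo τ' hlo hτ
    have hm := hbase.arr_mem lo (by omega) (by omega)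
    obtain ⟨i, hi⟩ : ∃ i : Fin n, s₀.int 8 lo = (i : ℕ) :=
      ⟨⟨(s₀.int 8 lo).toNat, by omega⟩, by simp only; omega⟩
    refine ⟨B i, hB i, ?_, fun s h => descentCmd_single hφ hi h.ctx h.lo_eq h.hi_eq hlo h.lo_real
      h.hi_real (by linarith [h.time])⟩
    push_cast
    rw [posSum_single hbase hlo hi, posSum_single hbase hlo hi]
  have ha0 : (0 : ℝ) ≤ a := Nat.cast_nonneg a
  induction e with
  | zero =>
    intro lo hi hlt hin he
    obtain rfl : hi = lo + 1 := by rw [pow_zero] at he; omega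
    exact hsingle lo _ (by omega) (by simp)
  | succ e ih =>
    intro lo hi hlt hin he
    have he0 : (0 : ℝ) ≤ (e + 1 : ℕ) * (22 * a + 2 * EO + 40) := by positivity
    by_cases hone : hi = lo + 1
    · subst hone
      exact hsingle lo _ (by omega) (by linarith)
    obtain ⟨mid, hmid⟩ : ∃ mid : ℕ, mid = (lo + hi) / 2 := ⟨_, rfl⟩
    have hpow : (2 : ℕ) ^ (e + 1) = 2 * 2 ^ e := pow_succ' 2 e
    obtain ⟨v₁, hv₁, hW₁, hs₁⟩ := ih lo mid (by omega) (by omega) (by omega)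
    obtain ⟨v₂, hv₂, hW₂, hs₂⟩ := ih mid hi (by omega) (by omega) (by omega)
    have hsum := posSum_add (pos := s₀.int 9) (lo := lo) (mid := mid) (hi := hi) (by omega)
      (by omega) (curWeight f a s₀)
    have hsumF := posSum_add (pos := s₀.int 9) (lo := lo) (mid := mid) (hi := hi) (by omega)
      (by omega) (fun i => curWeight f a s₀ i * B i)
    have hn₁ : 0 ≤ posSum n (s₀.int 9) lo mid (curWeight f a s₀) := posSum_nonneg hw
    have hn₂ : 0 ≤ posSum n (s₀.int 9) mid hi (curWeight f a s₀) := posSum_nonneg hw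
    have hF₀ : 0 ≤ posSum n (s₀.int 9) lo hi (fun i => curWeight f a s₀ i * B i) :=
      posSum_nonneg fun i => mul_nonneg (hw i) (hB i)
    obtain ⟨p, hp⟩ : ∃ p, p = posSum n (s₀.int 9) lo mid (curWeight f a s₀) /
      posSum n (s₀.int 9) lo hi (curWeight f a s₀) := ⟨_, rfl⟩
    have hp0 : 0 ≤ p := by rw [hp]; exact div_nonneg hn₁ (by linarith)
    have hp1 : p ≤ 1 := by rw [hp]; exact div_le_one_of_le₀ (by linarith) (by linarith)
    refine ⟨p * v₁ + (1 - p) * v₂, add_nonneg (mul_nonneg hp0 hv₁)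
      (mul_nonneg (by linarith) hv₂), ?_, fun s h => Bounded.loop_true ?_ ?_⟩
    · by_cases hz : posSum n (s₀.int 9) lo hi (curWeight f a s₀) = 0
      -- With total weight `0` the coin uses a quotient by zero, but then nothing is claimed about
      -- `v`.
      · rw [hz, zero_mul]; exact hF₀
      · have : posSum n (s₀.int 9) lo hi (curWeight f a s₀) * p =
            posSum n (s₀.int 9) lo mid (curWeight f a s₀) := by rw [hp]; field_simp
        calc _ = (posSum n (s₀.int 9) lo hi (curWeight f a s₀) * p) * v₁ +
              (posSum n (s₀.int 9) lo hi (curWeight f a s₀) -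
                posSum n (s₀.int 9) lo hi (curWeight f a s₀) * p) * v₂ := by ring
          _ = posSum n (s₀.int 9) lo mid (curWeight f a s₀) * v₁ +
              posSum n (s₀.int 9) mid hi (curWeight f a s₀) * v₂ := by
            rw [this, ← hsum]; ring
          _ ≤ _ := by linarith
    · simp only [Test.Holds, IntExpr.eval, h.lo_eq, h.hi_eq]; omega
    · have ht := h.time
      push_cast at ht
      refine descentBody_spec (τ := τ - (e + 1) * (22 * a + 2 * EO + 40)) (s := s.tick 1) hf (by omega)
        (by omega) hin hmid hv₁ hv₂ (fun s' h' => hs₁ s' ⟨h'.ctx, h'.lo_eq, h'.hi_eq, h'.lo_real,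
          h'.hi_real, ?_⟩) (fun s' h' => hs₂ s' ⟨h'.ctx, h'.lo_eq, h'.hi_eq, h'.lo_real,
          h'.hi_real, ?_⟩) ⟨h.ctx.congr (fun b _ => rfl) (fun x _ => rfl) (fun b _ => rfl),
          h.lo_eq, h.hi_eq, h.lo_real, h.hi_real, ?_⟩ hp
      · linarith [h'.time]
      · linarith [h'.time]
      · simp only [State.tick_time]; linarith

lemma stepValue_nonneg {K a : ℕ} {s : State} {S : Finset (Fin n)} {α β : ℝ} (hα : 0 ≤ α)
    (hβ : 0 ≤ β) {i : Fin n} (h : |curMarg f a s i| ≤ curWeight f a s i) :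
    0 ≤ stepValue f K a s S α β i := by
  have h := abs_le.1 h
  have h1 : (curWeight f a s i + curMarg f a s i) / (2 * curWeight f a s i) ≤ 1 :=
    div_le_one_of_le₀ (by linarith) (by linarith)
  have h2 : 0 ≤ (curWeight f a s i + curMarg f a s i) / (2 * curWeight f a s i) :=
    div_nonneg (by linarith) (by linarith)
  have h3 := fun x => add_nonneg (mul_nonneg hα (sqDist_nonneg (K : ℤ) S x)) hβ
  exact add_nonneg (mul_nonneg h2 (h3 _)) (mul_nonneg (by linarith) (h3 _))

/-- The expected potential after one step. -/
lemma stepCmd_spec {K a e : ℕ} {s : State} (hf : Submodular f) (hb : ∀ S, |f S| ≤ 1)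
    (hS : Stage n K a s) (hN : NegSums f s) (ha : a + 1 < n) (he : n ≤ 2 ^ e) (hEO : 0 ≤ EO)
    {S : Finset (Fin n)} {α β : ℝ} (hα : 0 ≤ α) (hβ : 0 ≤ β) {τ : ℝ} {ψ : State → ℝ≥0∞}
    (ht : s.time + (a + e + 4) * (22 * a + 2 * EO + 40) ≤ τ)
    (hψ : ∀ s', StepPost f K a s s' → s'.time ≤ τ →
      ψ s' ≤ ENNReal.ofReal (α * sqDist K S (levels n s') + β)) :
    Bounded f EO stepCmd s ψ (ENNReal.ofReal (α * (sqDist K S (levels n s) -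
      (∑ i, curMarg f a s i * ((levels n s i : ℝ) - K * if i ∈ S then 1 else 0)) / 6 + 1) + β)) := by
  have ha0 : (0 : ℝ) ≤ a := Nat.cast_nonneg a
  have he0 : (0 : ℝ) ≤ e * (22 * a + 2 * EO + 40) := by positivity
  have hmw : ∀ i, |curMarg f a s i| ≤ curWeight f a s i := hS.order.abs_marg_le_weight hf
  have hw : ∀ i, 0 ≤ curWeight f a s i := fun i => (abs_nonneg _).trans (hmw i)
  have hstep := fun i => stepValue_nonneg (K := K) (S := S) hα hβ (hmw i)
  have hsum : ∑ i, curWeight f a s i ≤ 12 := hS.order.sum_weight_le hf hb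
  have hfull : posSum n (s.int 9) (0 : ℕ) n (curWeight f a s) = ∑ i, curWeight f a s i := by
    unfold posSum
    congr 1
    ext i
    have := hS.base.pos_mem _ (Fin.int_mem i).1 (Fin.int_mem i).2
    simp only [Finset.mem_filter, Finset.mem_univ, true_and, iff_true]
    omega
  have hfull' : posSum n (s.int 9) (0 : ℕ) n (fun i => curWeight f a s i *
      stepValue f K a s S α β i) = ∑ i, curWeight f a s i * stepValue f K a s S α β i := by
    unfold posSum
    congr 1
    ext i
    have := hS.base.pos_mem _ (Fin.int_mem i).1 (Fin.int_mem i).2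
    simp only [Finset.mem_filter, Finset.mem_univ, true_and, iff_true]
    omega
  have hcum : cumWeight f a s n - cumWeight f a s (0 : ℕ) = ∑ i, curWeight f a s i := by
    rw [cumWeight_sub hS.order.pos_nonneg (by omega) (by omega)]
    exact hfull
  -- Time reserved for `chooseCmd` after the search.
  set σ : ℝ := τ - (22 * a + 2 * EO + 40) with hσ
  obtain ⟨v, hv, hWv, hdesc⟩ := descentCmd_spec (s₀ := s) (a := a) (τ := σ) (EO := EO)
    (φ := fun s' => ⨅ i, ⨅ _ : Found f K a s σ s' i, ENNReal.ofReal (stepValue f K a s S α β i))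
    (B := stepValue f K a s S α β) hf hS.base hw hstep (fun s' i h => iInf₂_le i h) hEO e 0 n
    (by omega) le_rfl (by simpa using he)
  rw [hfull, hfull'] at hWv
  -- The infimum equals the value for `i` at a state in which the search has found `i`, as the
  -- element is unique, and `⊤` at all other states. Thus it serves as the assertion between search
  -- and move.
  have hchoose : ∀ s' : State, Bounded f EO chooseCmd s' ψ
      (⨅ i, ⨅ _ : Found f K a s σ s' i, ENNReal.ofReal (stepValue f K a s S α β i)) := by
    intro s'
    by_cases hex : ∃ i, Found f K a s σ s' i
    · obtain ⟨i, hi⟩ := hex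
      have huniq : ∀ j, Found f K a s σ s' j → j = i := by
        intro j hj
        obtain ⟨lo, -, h1, h2⟩ := hi.pos
        obtain ⟨lo', -, h3, h4⟩ := hj.pos
        obtain rfl : lo = lo' := by omega
        exact Fin.ext (by omega)
      obtain ⟨lo, h1, h2, h3⟩ := hi.pos
      refine Bounded.mono (chooseCmd_spec hf hi.ctx ha hEO h1 h2 h3 hi.weight hα hβ
        (by linarith [hi.time]) hψ) (fun _ => le_rfl) ?_
      refine le_iInf₂ fun j hj => ?_
      rw [huniq j hj]
    · have : (⨅ i, ⨅ _ : Found f K a s σ s' i, ENNReal.ofReal (stepValue f K a s S α β i)) = ⊤ := by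
        simp only [iInf_eq_top]
        intro i hi
        exact absurd ⟨i, hi⟩ hex
      rw [this]
      exact Bounded.top _ _ _
  refine Ens.seq_bounded ((margCmd_spec hS hN).frame.mono ?_)
  rintro s₁ ⟨hF₁, hS₁, hN₁, hT₁, ht₁⟩
  have hkeep : ∀ b ∈ [0, 1, 2, 3, 4, 5, 6, 7, 8, 9, 10, 11, 12, 13, 15, 16, 17],
      s₁.int b = s.int b := by
    intro b hb; fin_cases hb <;> exact hF₁.1 _ (by decide)
  have h₁ : StepCtx f K a s s₁ := ⟨hS₁, hN₁, hT₁, hkeep, hF₁.2 0 (by decide)⟩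
  refine Ens.seq_bounded (Ens.setInt (Ens.seq_bounded ?_))
  refine (StepCtx.cumCmd_spec (s₀ := s) (k := n) (h₁.congr ?_ ?_ ?_) ?_ le_rfl).mono ?_
  · intro b hb; fin_cases hb <;> rfl
  · intro x _; rfl
  · intro b hb; fin_cases hb <;> rfl
  · simpa [IntExpr.eval] using hS₁.hn
  rintro s₂ ⟨h₂, h7₂, ht₂, -, -⟩
  refine Ens.seq_bounded (Ens.setReal (Ens.seq_bounded (Ens.setInt (Ens.seq_bounded ?_))))
  refine (StepCtx.cumCmd_spec (s₀ := s) (k := 0) (h₂.congr ?_ ?_ ?_) ?_ (Nat.zero_le _)).mono ?_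
  · intro b hb; fin_cases hb <;> rfl
  · intro x _; rfl
  · intro b hb; fin_cases hb <;> rfl
  · simp [IntExpr.eval]
  rintro s₃ ⟨h₃, h7₃, ht₃, -, hr₃⟩
  have h6₃ : s₃.real 6 0 = f ∅ + cumWeight f a s n := by
    rw [hr₃ 6 (by decide)]; simpa [IntExpr.eval, RealExpr.eval] using h7₂
  obtain ⟨s₄, hs₄⟩ : ∃ s₄, s₄ = (s₃.writeReal 5 0 (s₃.real 7 0)).tick 1 := ⟨_, rfl⟩
  have h₄ : StepCtx f K a s s₄ := by
    rw [hs₄]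
    refine h₃.congr (fun _ _ => rfl) (fun _ _ => rfl) ?_
    intro b hb; fin_cases hb <;> rfl
  have h5₄ : s₄.real 5 0 = f ∅ + cumWeight f a s (0 : ℕ) := by rw [hs₄]; simpa using h7₃
  have h6₄ : s₄.real 6 0 = f ∅ + cumWeight f a s n := by rw [hs₄]; simpa using h6₃
  have ht₄ : s₄.time ≤ s.time + (a + 2) * (22 * a + 2 * EO + 40) := by
    rw [hs₄]
    simp at ht₂ ht₃ ⊢
    nlinarith
  refine Ens.seq_bounded (Ens.setReal ?_)
  simp only [RealExpr.eval, IntExpr.eval]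
  rw [← hs₄]
  -- A first coin decides whether anything moves. It replaces the varying normalization `∑ w` by the
  -- constant `12`, which makes the drift independent of the weights.
  have hp : (RealExpr.div (.sub (rv 6) (rv 5)) (.const 12)).eval s₄ =
      (∑ i, curWeight f a s i) / 12 := by
    simp only [RealExpr.eval, IntExpr.eval, h5₄, h6₄, ← hcum]
    push_cast; ring
  have hmain := Bounded.flip_seq (f := f) (EO := EO) (s := s₄) (φ := ψ)
    (p := .div (.sub (rv 6) (rv 5)) (.const 12)) (a := 30)
    (i := .const 0) (x := v) (y := α * sqDist K S (levels n s) + β)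
    (c := .branch (.intLE (.const 1) (iv 30))
      (setI 27 (.const 0) ;; setI 28 (iv 0) ;; descentCmd ;; chooseCmd) .skip)
    (by rw [hp]; exact div_nonneg (Finset.sum_nonneg fun i _ => hw i) (by norm_num))
    (by rw [hp]; linarith) hv
    (add_nonneg (mul_nonneg hα (sqDist_nonneg _ _ _)) hβ) ?_ ?_
  · refine hmain.mono (fun _ => le_rfl) (ENNReal.ofReal_le_ofReal ?_)
    rw [hp]
    have hE := expected_step_le (β := β) (Ψ := sqDist K S (levels n s)) hα hmw
      (fun i => sqDist_down (K : ℤ) (by omega) S (levels n s) i)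
      (fun i => sqDist_up (K : ℤ) S (levels n s) (by omega) i) hsum
    have e1 : (∑ i, curWeight f a s i) / 12 * v ≤
        (∑ i, curWeight f a s i * stepValue f K a s S α β i) / 12 := by linarith
    refine (add_le_add_left e1 _).trans ?_
    exact_mod_cast hE
  · refine Bounded.branch (fun _ => ?_) (fun h => ?_)
    · refine Ens.seq_bounded (Ens.setInt (Ens.seq_bounded (Ens.setInt ?_)))
      refine Bounded.seq (hdesc _ ⟨h₄.congr ?_ ?_ ?_, ?_, ?_, ?_, ?_, ?_⟩) hchoose
      · intro b hb; fin_cases hb <;> rfl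
      · intro x _; rfl
      · intro b hb; rfl
      · simp [IntExpr.eval]
      · simpa [IntExpr.eval] using h₄.stage.hn
      · simpa using h5₄
      · simpa using h6₄
      · simp; linarith
    · simp [Test.Holds, IntExpr.eval] at h
  · refine Bounded.branch (fun h => ?_) (fun h => Bounded.skip ?_)
    · simp [Test.Holds, IntExpr.eval] at h
    · have hl : levels n s = levels n (((s₄.writeInt 30 0 0).tick 1).tick 1 |>.tick 1) := by
        unfold levels
        funext i
        simp [h₄.keep 11 (by decide)]
      rw [hl]
      refine hψ _ ⟨⟨a, by omega, h₄.stage.congr ?_ ?_⟩, h₄.neg.congr rfl rfl, ?_, ?_, ?_⟩ ?_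
      · intro b hb; fin_cases hb <;> rfl
      · intro x _; rfl
      · intro b hb
        rw [← h₄.keep b (by revert b; decide)]
        fin_cases hb <;> rfl
      · exact h₄.keep_real
      · intro x _ _
        simp [h₄.keep 11 (by decide)]
      · simp [IntExpr.eval]; nlinarith

end

/-! ### Rebasing: starting a new stage. -/

/-- Exchange the element in bank `25` with the one at position `iv 27`. -/
def swapCmd : Command :=
  setI 28 (.get 8 (iv 27)) ;; .setInt 8 (.get 9 (iv 25)) (iv 28) ;;
  .setInt 9 (iv 28) (.get 9 (iv 25)) ;; .setInt 8 (iv 27) (iv 25) ;; .setInt 9 (iv 25) (iv 27)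

/-- Move the base level of the element in bank `25` towards its current level. -/
def shiftCmd : Command :=
  .branch (ltI (.get 10 (iv 25)) (.get 11 (iv 25)))
    (setI 32 (.get 10 (iv 25)) ;; setI 27 (.get 12 (iv 32)) ;; swapCmd ;;
      .setInt 10 (iv 25) (.add (iv 32) (.const 1)) ;;
      .setInt 12 (iv 32) (.add (.get 12 (iv 32)) (.const 1)))
    (setI 32 (.sub (.get 10 (iv 25)) (.const 1)) ;;
      setI 27 (.sub (.get 12 (iv 32)) (.const 1)) ;; swapCmd ;;
      .setInt 10 (iv 25) (iv 32) ;; .setInt 12 (iv 32) (.sub (.get 12 (iv 32)) (.const 1)))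

def settleLoop : Command :=
  .loop (.neg (.conj (.intLE (.get 10 (iv 25)) (.get 11 (iv 25)))
    (.intLE (.get 11 (iv 25)) (.get 10 (iv 25))))) shiftCmd

def unmarkLoop : Command :=
  .loop (ltI (iv 26) (iv 7))
    (setI 25 (.get 16 (iv 26)) ;; .setInt 17 (iv 25) (.const 0) ;; settleLoop ;;
      setI 26 (.add (iv 26) (.const 1)))

def relinkLoop : Command :=
  .loop (ltI (iv 21) (iv 0))
    (.setInt 14 (.get 8 (iv 21)) (.get 8 (.add (iv 21) (.const 1))) ;;
      .setInt 15 (.get 8 (.add (iv 21) (.const 1))) (.get 8 (iv 21)) ;;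
      setI 21 (.add (iv 21) (.const 1)))

def negSumsLoop : Command :=
  .loop (ltI (iv 26) (iv 0))
    (setI 20 (.add (iv 26) (.const 1)) ;; askCmd ;;
      .branch (.realLE (rv 2) (rv 5))
        (.setReal 1 (.add (iv 26) (.const 1)) (.add (.get 1 (iv 26)) (.sub (rv 5) (rv 2))))
        (.setReal 1 (.add (iv 26) (.const 1)) (.get 1 (iv 26))) ;;
      setR 5 (rv 2) ;; setI 26 (.add (iv 26) (.const 1)))

/-- Make the current levels the base levels. -/
def rebaseCmd : Command :=
  setI 26 (.const 0) ;; unmarkLoop ;; setI 7 (.const 0) ;; setI 21 (.const (-1)) ;; relinkLoop ;;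
  setI 18 (iv 2) ;; setI 19 (.const 0) ;; setI 20 (.const 0) ;; askCmd ;; setR 5 (rv 2) ;;
  .setReal 1 (.const 0) (.const 0) ;; setI 26 (.const 0) ;; negSumsLoop

noncomputable section

section Arrays

variable {n K : ℕ} {arr pos bl start : ℤ → ℤ}

lemma Base.lt_start (h : Base n K arr pos bl start) {v x : ℤ} (hv : 0 ≤ v) (h0 : 0 ≤ x)
    (hn : x < n) : v < bl x ↔ pos x < start v := by
  have h1 := h.pos_mem x h0 hn
  rw [← h.start_iff v (pos x) hv h1.1 h1.2, h.arr_pos x h0 hn]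

/-- Exchanging two elements of the same level. -/
lemma Base.swap (h : Base n K arr pos bl start) {x y : ℤ} (hx0 : 0 ≤ x) (hxn : x < n)
    (hy0 : 0 ≤ y) (hyn : y < n) (hxy : bl x = bl y) :
    Base n K (Function.update (Function.update arr (pos x) y) (pos y) x)
      (Function.update (Function.update pos y (pos x)) x (pos y)) bl start := by
  have hpx := h.pos_mem x hx0 hxn
  have hpy := h.pos_mem y hy0 hyn
  have hax := h.arr_pos x hx0 hxn
  have hay := h.arr_pos y hy0 hyn
  refine ⟨?_, ?_, ?_, ?_, ?_, ?_, h.bl_mem, h.bl_n, h.start_mem, ?_⟩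
  · have := h.arr_neg
    simp only [Function.update_apply]
    grind
  · have := h.arr_n
    simp only [Function.update_apply]
    grind
  · intro p h1 h2
    have := h.arr_mem p h1 h2
    simp only [Function.update_apply]
    grind
  · intro p h1 h2
    have := h.pos_arr p h1 h2
    simp only [Function.update_apply]
    grind
  · intro i h1 h2
    have := h.pos_mem i h1 h2
    simp only [Function.update_apply]
    grind
  · intro i h1 h2
    have := h.arr_pos i h1 h2
    simp only [Function.update_apply]
    grind
  · intro v p hv h1 h2
    have := h.start_iff v p hv h1 h2
    simp only [Function.update_apply]
    grind

/-- Raising the level of the first element of its level. -/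
lemma Base.raise (h : Base n K arr pos bl start) {x : ℤ} (hx0 : 0 ≤ x) (hxn : x < n)
    (hK : bl x < K) (hp : pos x = start (bl x)) :
    Base n K arr pos (Function.update bl x (bl x + 1))
      (Function.update start (bl x) (start (bl x) + 1)) := by
  have hpx := h.pos_mem x hx0 hxn
  have hb := h.bl_mem x hx0 hxn
  have hax := h.arr_pos x hx0 hxn
  refine ⟨h.arr_neg, h.arr_n, h.arr_mem, h.pos_arr, h.pos_mem, h.arr_pos, ?_, ?_, ?_, ?_⟩
  · intro i h1 h2
    have := h.bl_mem i h1 h2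
    simp only [Function.update_apply]
    grind
  · have := h.bl_n
    simp only [Function.update_apply]
    grind
  · intro v hv
    have := h.start_mem v hv
    simp only [Function.update_apply]
    grind
  · intro v p hv h1 h2
    have h3 := h.start_iff v p hv h1 h2
    have h4 := h.pos_arr p h1 h2
    simp only [Function.update_apply]
    grind

/-- Lowering the level of the last element of its level. -/
lemma Base.lower (h : Base n K arr pos bl start) {x : ℤ} (hx0 : 0 ≤ x) (hxn : x < n)
    (h1 : 1 ≤ bl x) (hp : pos x = start (bl x - 1) - 1) :
    Base n K arr pos (Function.update bl x (bl x - 1))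
      (Function.update start (bl x - 1) (start (bl x - 1) - 1)) := by
  have hpx := h.pos_mem x hx0 hxn
  have hb := h.bl_mem x hx0 hxn
  have hax := h.arr_pos x hx0 hxn
  refine ⟨h.arr_neg, h.arr_n, h.arr_mem, h.pos_arr, h.pos_mem, h.arr_pos, ?_, ?_, ?_, ?_⟩
  · intro i h1 h2
    have := h.bl_mem i h1 h2
    simp only [Function.update_apply]
    grind
  · have := h.bl_n
    simp only [Function.update_apply]
    grind
  · intro v hv
    have := h.start_mem v hv
    simp only [Function.update_apply]
    grind
  · intro v p hv h1 h2
    have h3 := h.start_iff v p hv h1 h2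
    have h4 := h.pos_arr p h1 h2
    simp only [Function.update_apply]
    grind

/-- The first position of the level of `x`. -/
lemma Base.first (h : Base n K arr pos bl start) {x : ℤ} (hx0 : 0 ≤ x) (hxn : x < n) :
    0 ≤ start (bl x) ∧ start (bl x) < n ∧ bl (arr (start (bl x))) = bl x := by
  have hb := h.bl_mem x hx0 hxn
  have hpx := h.pos_mem x hx0 hxn
  have h1 := h.start_mem (bl x) hb.1
  have h2 := h.lt_start hb.1 hx0 hxn
  have h3 := h.start_iff (bl x) (start (bl x)) hb.1 h1.1 (by omega)
  have h6 := h.arr_mem (start (bl x)) h1.1 (by omega)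
  have h7 := h.bl_mem _ h6.1 h6.2
  refine ⟨h1.1, by omega, ?_⟩
  rcases eq_or_lt_of_le hb.1 with h0 | h0
  · omega
  · have h4 := h.lt_start (v := bl x - 1) (by omega) hx0 hxn
    have h5 := h.start_iff (bl x - 1) (start (bl x)) (by omega) h1.1 (by omega)
    omega

/-- The last position of the level of `x`. -/
lemma Base.last (h : Base n K arr pos bl start) {x : ℤ} (hx0 : 0 ≤ x) (hxn : x < n)
    (hx : 1 ≤ bl x) : 0 ≤ start (bl x - 1) - 1 ∧ start (bl x - 1) - 1 < n ∧
      bl (arr (start (bl x - 1) - 1)) = bl x := by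
  have hb := h.bl_mem x hx0 hxn
  have hpx := h.pos_mem x hx0 hxn
  have h1 := h.start_mem (bl x - 1) (by omega)
  have h2 := h.lt_start (v := bl x - 1) (by omega) hx0 hxn
  have h3 := h.start_iff (bl x - 1) (start (bl x - 1) - 1) (by omega) (by omega) (by omega)
  have h4 := h.lt_start hb.1 hx0 hxn
  have h5 := h.start_iff (bl x) (start (bl x - 1) - 1) hb.1 (by omega) (by omega)
  omega

end Arrays

variable {n : ℕ} {f : Finset (Fin n) → ℝ} {EO : ℝ}

lemma swapCmd_spec {K : ℕ} {s : State} (h : Base n K (s.int 8) (s.int 9) (s.int 10) (s.int 12))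
    {x p : ℤ} (h25 : s.int 25 0 = x) (h27 : s.int 27 0 = p) (hx0 : 0 ≤ x) (hxn : x < n)
    (hp0 : 0 ≤ p) (hpn : p < n) (hbl : s.int 10 (s.int 8 p) = s.int 10 x) :
    Ens f EO swapCmd s fun s' => Base n K (s'.int 8) (s'.int 9) (s'.int 10) (s'.int 12) ∧
      s'.int 9 x = p ∧ s'.time ≤ s.time + 5 := by
  have hy := h.arr_mem p hp0 hpn
  have hpy := h.pos_arr p hp0 hpn
  have hB := h.swap hx0 hxn hy.1 hy.2 hbl.symm
  rw [hpy] at hB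
  refine Ens.seq (Ens.setInt (Ens.seq (Ens.setInt (Ens.seq (Ens.setInt (Ens.seq (Ens.setInt
    (Ens.setInt ⟨?_, ?_, ?_⟩))))))))
  · simpa [IntExpr.eval, h25, h27] using hB
  · simp [IntExpr.eval, h25, h27]
  · simp; linarith

/-- Elements of the same base level occupy a block of positions. Swapping `x` to the border of its
block and then moving the border by one changes its level by one in constant time, with the array
still sorted. -/
lemma shiftCmd_spec {K : ℕ} {s : State} (h : Base n K (s.int 8) (s.int 9) (s.int 10) (s.int 12))
    {x : ℤ} (h25 : s.int 25 0 = x) (hx0 : 0 ≤ x) (hxn : x < n)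
    (hcl : 0 ≤ s.int 11 x ∧ s.int 11 x ≤ K) (hne : s.int 10 x ≠ s.int 11 x) :
    Ens f EO shiftCmd s fun s' => Base n K (s'.int 8) (s'.int 9) (s'.int 10) (s'.int 12) ∧
      s'.int 10 = Function.update (s.int 10) x
        (if s.int 10 x < s.int 11 x then s.int 10 x + 1 else s.int 10 x - 1) ∧
      s'.time ≤ s.time + 10 := by
  have hb := h.bl_mem x hx0 hxn
  refine Ens.branch (fun ht => ?_) (fun ht => ?_)
  · have hlt : s.int 10 x < s.int 11 x := by
      simp only [Test.Holds, IntExpr.eval, h25] at ht; omega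
    obtain ⟨h1, h2, h3⟩ := h.first hx0 hxn
    refine Ens.seq (Ens.setInt (Ens.seq (Ens.setInt (Ens.seq ?_))))
    refine (swapCmd_spec (K := K) (x := x) (p := s.int 12 (s.int 10 x)) (by simpa using h)
      (by simpa using h25) (by simp [IntExpr.eval, h25]) hx0 hxn h1 h2
      (by simpa using h3)).frame.mono ?_
    rintro s₁ ⟨hF, hB, hp, ht₁⟩
    have e10 : s₁.int 10 = s.int 10 := by rw [hF.1 10 (by decide)]; simp
    have e12 : s₁.int 12 = s.int 12 := by rw [hF.1 12 (by decide)]; simp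
    have e25 : s₁.int 25 0 = x := by rw [hF.1 25 (by decide)]; simpa using h25
    have e32 : s₁.int 32 0 = s.int 10 x := by
      rw [hF.1 32 (by decide)]; simp [IntExpr.eval, h25]
    rw [e10, e12] at hB
    have hB' := hB.raise hx0 hxn (by omega) hp
    refine Ens.seq (Ens.setInt (Ens.setInt ⟨?_, ?_, ?_⟩))
    · simpa [IntExpr.eval, e10, e12, e25, e32] using hB'
    · simp [IntExpr.eval, e10, e25, e32, hlt]
    · simp at ht₁ ⊢; linarith
  · have hlt : s.int 11 x < s.int 10 x := by
      simp only [Test.Holds, IntExpr.eval, h25] at ht; omega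
    obtain ⟨h1, h2, h3⟩ := h.last hx0 hxn (by omega)
    refine Ens.seq (Ens.setInt (Ens.seq (Ens.setInt (Ens.seq ?_))))
    refine (swapCmd_spec (K := K) (x := x) (p := s.int 12 (s.int 10 x - 1) - 1) (by simpa using h)
      (by simpa using h25) (by simp [IntExpr.eval, h25]) hx0 hxn h1 h2
      (by simpa using h3)).frame.mono ?_
    rintro s₁ ⟨hF, hB, hp, ht₁⟩
    have e10 : s₁.int 10 = s.int 10 := by rw [hF.1 10 (by decide)]; simp
    have e12 : s₁.int 12 = s.int 12 := by rw [hF.1 12 (by decide)]; simp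
    have e25 : s₁.int 25 0 = x := by rw [hF.1 25 (by decide)]; simpa using h25
    have e32 : s₁.int 32 0 = s.int 10 x - 1 := by
      rw [hF.1 32 (by decide)]; simp [IntExpr.eval, h25]
    rw [e10, e12] at hB
    have hB' := hB.lower hx0 hxn (by omega) hp
    refine Ens.seq (Ens.setInt (Ens.setInt ⟨?_, ?_, ?_⟩))
    · simpa [IntExpr.eval, e10, e12, e25, e32] using hB'
    · simp [IntExpr.eval, e10, e25, e32, not_lt.2 hlt.le]
    · simp at ht₁ ⊢; linarith

/-- Each round brings the base level one closer to the current level, at a cost of at most 11. -/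
lemma settleLoop_spec {K m : ℕ} {s : State}
    (h : Base n K (s.int 8) (s.int 9) (s.int 10) (s.int 12)) {x : ℤ} (h25 : s.int 25 0 = x)
    (hx0 : 0 ≤ x) (hxn : x < n) (hcl : 0 ≤ s.int 11 x ∧ s.int 11 x ≤ K)
    (hm : |s.int 11 x - s.int 10 x| ≤ m) :
    Ens f EO settleLoop s fun s' => Base n K (s'.int 8) (s'.int 9) (s'.int 10) (s'.int 12) ∧
      s'.int 10 = Function.update (s.int 10) x (s.int 11 x) ∧ s'.time ≤ s.time + 11 * m + 1 := by
  have hm' := abs_le.1 hm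
  refine Ens.loop_frame (fun l t => l = (s.int 11 x - t.int 10 x).natAbs ∧ l ≤ m ∧
    Base n K (t.int 8) (t.int 9) (t.int 10) (t.int 12) ∧
    (∀ y, y ≠ x → t.int 10 y = s.int 10 y) ∧ t.time + 11 * l ≤ s.time + 11 * m) ?_ ?_
    (k := (s.int 11 x - s.int 10 x).natAbs) ⟨rfl, by omega, h, fun _ _ => rfl, ?_⟩
  · rintro l t hS ⟨hl, hlm, hB, hother, htime⟩ ht
    have e11 := hS.1 11 (by decide)
    have e25 : t.int 25 0 = x := by rw [hS.1 25 (by decide)]; exact h25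
    simp only [Test.Holds, IntExpr.eval, e25, e11] at ht
    refine (shiftCmd_spec (K := K) (x := x) (s := t.tick 1) hB e25 hx0 hxn
      (by simpa [e11] using hcl) ?_).mono ?_
    · simp only [State.tick_int, e11]; omega
    rintro s₁ ⟨hB₁, h10, ht₁⟩
    simp only [State.tick_int, e11] at h10
    have hx : s₁.int 10 x = if t.int 10 x < s.int 11 x then t.int 10 x + 1 else
        t.int 10 x - 1 := by rw [h10]; simp
    have hl' : ((s.int 11 x - s₁.int 10 x).natAbs : ℕ) + 1 = l := by
      split_ifs at hx <;> omega
    refine ⟨_, by omega, rfl, by omega, hB₁, ?_, ?_⟩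
    · intro y hy
      rw [h10, Function.update_of_ne hy, hother y hy]
    · have : (l : ℝ) = (s.int 11 x - s₁.int 10 x).natAbs + 1 := by rw [← hl']; push_cast; ring
      rw [this] at htime
      simp at ht₁
      linarith
  · rintro l t hS ⟨hl, hlm, hB, hother, htime⟩ ht
    have e11 := hS.1 11 (by decide)
    have e25 : t.int 25 0 = x := by rw [hS.1 25 (by decide)]; exact h25
    simp only [Test.Holds, IntExpr.eval, e25, e11] at ht
    refine ⟨hB, ?_, ?_⟩
    · funext y
      by_cases hy : y = x
      · subst hy; rw [Function.update_self, State.tick_int]; omega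
      · rw [Function.update_of_ne hy]; exact hother y hy
    · have : (0 : ℝ) ≤ 11 * (l : ℝ) := by positivity
      simp; linarith
  · have : ((s.int 11 x - s.int 10 x).natAbs : ℝ) ≤ m := by
      have : (s.int 11 x - s.int 10 x).natAbs ≤ m := by omega
      exact_mod_cast this
    linarith

/-- The data that persists between stages. -/
structure Arranged (n K a : ℕ) (s : State) : Prop where
  hn : s.int 0 0 = n
  hK : s.int 2 0 = K
  ha : s.int 7 0 = a
  base : Base n K (s.int 8) (s.int 9) (s.int 10) (s.int 12)
  marks : Marks n a (s.int 16) (s.int 17)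
  idn : ∀ x : ℤ, 0 ≤ x → x < n → s.int 13 x = x
  cl_mem : ∀ x : ℤ, 0 ≤ x → x < n → 0 ≤ s.int 11 x ∧ s.int 11 x ≤ K
  cl_eq : ∀ x : ℤ, 0 ≤ x → x < n → s.int 17 x = 0 → s.int 11 x = s.int 10 x

/-- After `q` rounds only marks above `q` survive, with their original values, and every unmarked
element is settled. The distance bound holds for all elements throughout, because shifting an
element leaves the base levels of the others unchanged. -/
lemma unmarkLoop_spec {K a m : ℕ} {s : State} (h : Arranged n K a s) (h26 : s.int 26 0 = 0)
    (hm : ∀ x : ℤ, 0 ≤ x → x < n → |s.int 11 x - s.int 10 x| ≤ m) :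
    Ens f EO unmarkLoop s fun s' => Base n K (s'.int 8) (s'.int 9) (s'.int 10) (s'.int 12) ∧
      (∀ x, s'.int 17 x = 0) ∧ (∀ x : ℤ, 0 ≤ x → x < n → s.int 11 x = s'.int 10 x) ∧
      s'.time ≤ s.time + a * (11 * m + 5) + 1 := by
  refine Ens.loop_frame (fun l t => ∃ q : ℕ, l = a - q ∧ q ≤ a ∧ t.int 26 0 = q ∧
    Base n K (t.int 8) (t.int 9) (t.int 10) (t.int 12) ∧
    (∀ x, t.int 17 x ≠ 0 → q < t.int 17 x ∧ t.int 17 x = s.int 17 x) ∧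
    (∀ x : ℤ, 0 ≤ x → x < n → t.int 17 x = 0 → s.int 11 x = t.int 10 x) ∧
    (∀ x : ℤ, 0 ≤ x → x < n → |s.int 11 x - t.int 10 x| ≤ m) ∧
    t.time ≤ s.time + q * (11 * m + 5)) ?_ ?_ (k := a)
    ⟨0, by omega, by omega, by simpa using h26, h.base, ?_, h.cl_eq, hm, by simp⟩
  · rintro l t hS ⟨q, rfl, hq, hq26, hB, hmk, heq, hclose, htime⟩ ht
    have e7 : t.int 7 0 = a := by rw [hS.1 7 (by decide)]; exact h.ha
    have e16 := hS.1 16 (by decide)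
    have e11 := hS.1 11 (by decide)
    simp only [Test.Holds, IntExpr.eval, hq26, e7] at ht
    obtain ⟨x, hx⟩ : ∃ x, x = s.int 16 q := ⟨_, rfl⟩
    have hxm := h.marks.T_mem q (by omega)
    have hxk := h.marks.mk_T q (by omega)
    rw [← hx] at hxm hxk
    refine Ens.seq (Ens.setInt (Ens.seq (Ens.setInt (Ens.seq ?_))))
    refine (settleLoop_spec (n := n) (K := K) (m := m) (x := x) (by simpa using hB) ?_ hxm.1 hxm.2
      ?_ ?_).frame.mono ?_
    · simp [IntExpr.eval, hq26, e16, hx]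
    · simpa [e11] using h.cl_mem x hxm.1 hxm.2
    · simpa [e11] using hclose x hxm.1 hxm.2
    rintro s₁ ⟨hF, hB₁, h10, ht₁⟩
    have g17 : s₁.int 17 = Function.update (t.int 17) x 0 := by
      rw [hF.1 17 (by decide)]; simp [IntExpr.eval, hq26, e16, hx]
    have g26 : s₁.int 26 0 = q := by rw [hF.1 26 (by decide)]; simpa using hq26
    replace h10 : s₁.int 10 = Function.update (t.int 10) x (s.int 11 x) := by
      rw [h10]; simp [e11]
    refine Ens.setInt ⟨a - (q + 1), by omega, q + 1, rfl, by omega, ?_, ?_, ?_, ?_, ?_, ?_⟩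
    · simp [IntExpr.eval, g26]
    · simpa using hB₁
    · intro y
      simp only [State.tick_int, State.writeInt_int]
      norm_num
      rw [g17]
      by_cases hy : y = x
      · simp [hy]
      · rw [Function.update_of_ne hy]
        intro hne
        obtain ⟨h1, h2⟩ := hmk y hne
        refine ⟨?_, h2⟩
        have h3 := h.marks.T_mk y (by omega)
        by_contra hlt
        apply hy
        rw [hx, ← h3.2.2]
        congr 1
        omega
    · intro y hy0 hyn
      simp only [State.tick_int, State.writeInt_int]
      norm_num
      rw [g17, h10]
      by_cases hy : y = x
      · simp [hy]
      · rw [Function.update_of_ne hy, Function.update_of_ne hy]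
        exact heq y hy0 hyn
    · intro y hy0 hyn
      simp only [State.tick_int, State.writeInt_int]
      norm_num
      rw [h10]
      by_cases hy : y = x
      · simp [hy]
      · rw [Function.update_of_ne hy]
        exact hclose y hy0 hyn
    · simp at ht₁ ⊢
      linarith
  · rintro l t hS ⟨q, rfl, hq, hq26, hB, hmk, heq, hclose, htime⟩ ht
    have e7 : t.int 7 0 = a := by rw [hS.1 7 (by decide)]; exact h.ha
    simp only [Test.Holds, IntExpr.eval, hq26, e7] at ht
    obtain rfl : q = a := by omega
    have h0 : ∀ x, t.int 17 x = 0 := by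
      intro x
      by_contra hne
      obtain ⟨h1, h2⟩ := hmk x hne
      have h3 := h.marks.T_mk x (by omega)
      omega
    exact ⟨hB, h0, fun x h1 h2 => heq x h1 h2 (h0 x), by simpa using htime⟩
  · intro x hx
    have := h.marks.T_mk x hx
    exact ⟨by omega, rfl⟩

/-- Without marks, consecutive unmarked positions are adjacent ones; starting at `-1`, there are `n
+ 1` links to set, sentinels included. -/
lemma relinkLoop_spec {K : ℕ} {s : State} (hn : s.int 0 0 = n)
    (hB : Base n K (s.int 8) (s.int 9) (s.int 10) (s.int 12)) (h21 : s.int 21 0 = -1)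
    (hmk : ∀ x, s.int 17 x = 0) :
    Ens f EO relinkLoop s fun s' => Linked n (s'.int 8) (s'.int 17) (s'.int 14) (s'.int 15) ∧
      s'.time ≤ s.time + 4 * n + 5 := by
  refine Ens.loop_frame (fun l t => ∃ q : ℕ, l = n + 1 - q ∧ q ≤ n + 1 ∧ t.int 21 0 = q - 1 ∧
    (∀ z : ℤ, -1 ≤ z → z < (q : ℤ) - 1 → t.int 14 (s.int 8 z) = s.int 8 (z + 1) ∧
      t.int 15 (s.int 8 (z + 1)) = s.int 8 z) ∧
    t.time ≤ s.time + 4 * q) ?_ ?_ (k := n + 1)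
    ⟨0, by omega, by omega, by simpa using h21, by intro z h1 h2; omega, by simp⟩
  · rintro l t hS ⟨q, rfl, hq, hq21, hlink, htime⟩ ht
    have e0 : t.int 0 0 = n := by rw [hS.1 0 (by decide)]; exact hn
    have e8 := hS.1 8 (by decide)
    simp only [Test.Holds, IntExpr.eval, hq21, e0] at ht
    refine Ens.seq (Ens.setInt (Ens.seq (Ens.setInt (Ens.setInt ⟨n + 1 - (q + 1), by omega, q + 1,
      rfl, by omega, ?_, ?_, ?_⟩))))
    · simp [IntExpr.eval, hq21]
    · intro z hz1 hz2
      push_cast at hz2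
      simp [IntExpr.eval, hq21, e8]
      by_cases hz : z = q - 1
      · subst hz; simp
      · have h1 : s.int 8 z ≠ s.int 8 (q - 1) := fun he =>
          hz (hB.arr_inj' ⟨by omega, by omega⟩ ⟨by omega, by omega⟩ he)
        have h2 : s.int 8 (z + 1) ≠ s.int 8 q := fun he =>
          hz (by have := hB.arr_inj' (p := z + 1) (q := q) ⟨by omega, by omega⟩ ⟨by omega, by omega⟩ he
                 omega)
        rw [Function.update_of_ne h1, Function.update_of_ne h2]
        exact hlink z hz1 (by omega)
    · simp; linarith
  · rintro l t hS ⟨q, rfl, hq, hq21, hlink, htime⟩ ht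
    have e0 : t.int 0 0 = n := by rw [hS.1 0 (by decide)]; exact hn
    have e8 := hS.1 8 (by decide)
    have e17 := hS.1 17 (by decide)
    simp only [Test.Holds, IntExpr.eval, hq21, e0] at ht
    obtain rfl : q = n + 1 := by omega
    refine ⟨?_, ?_⟩
    · intro p q h1 h2 h3 _ _ h6
      simp only [State.tick_int, e8, e17] at h6 ⊢
      obtain rfl : q = p + 1 := by
        by_contra hne
        exact h6 (p + 1) (by omega) (by omega) (hmk _)
      exact hlink p h1 (by push_cast; omega)
    · push_cast at htime
      simp; linarith

lemma marg_posKey {K : ℕ} {arr pos bl start : ℤ → ℤ} (hB : Base n K arr pos bl start)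
    (i : Fin n) : marg f (posKey n pos) i =
      f (Finset.univ.filter fun j : Fin n => pos (j : ℕ) < pos (i : ℕ) + 1) -
        f (Finset.univ.filter fun j : Fin n => pos (j : ℕ) < pos (i : ℕ)) := by
  have hb : ∀ j : Fin n, j ∈ below (posKey n pos) i ↔ pos (j : ℕ) < pos (i : ℕ) := fun j =>
    (@Finset.mem_filter _ _ (_) _ _).trans (by simp [posKey])
  have h1 : insert i (below (posKey n pos) i) =
      Finset.univ.filter fun j : Fin n => pos (j : ℕ) < pos (i : ℕ) + 1 := by
    ext j
    rw [Finset.mem_insert, hb j, Finset.mem_filter]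
    refine ⟨?_, fun h => ?_⟩
    · rintro (rfl | h)
      · simp
      · exact ⟨Finset.mem_univ _, by omega⟩
    · by_cases hij : pos (j : ℕ) = pos (i : ℕ)
      · have h2 := hB.arr_pos _ (Fin.int_mem j).1 (Fin.int_mem j).2
        rw [hij, hB.arr_pos _ (Fin.int_mem i).1 (Fin.int_mem i).2] at h2
        exact Or.inl (Fin.ext (by omega))
      · right; omega
  have h2 : below (posKey n pos) i =
      Finset.univ.filter fun j : Fin n => pos (j : ℕ) < pos (i : ℕ) := by
    ext j
    rw [hb j]
    simp
  rw [marg, h1, h2]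

lemma askSet_unmarked {pos cl mk : ℤ → ℤ} (hmk : ∀ x, mk x = 0) (v r k : ℤ) :
    askSet n pos cl mk v r k = Finset.univ.filter fun j : Fin n => pos (j : ℕ) < k := by
  ext j
  rw [mem_askSet]
  simp [hmk]

/-- Without marks a query returns `f` on a plain prefix of positions, so consecutive answers differ
by the base marginals. Bank `5` of the reals keeps the previous answer. -/
lemma negSumsLoop_spec {K : ℕ} {s : State} (hS : Stage n K 0 s) (h26 : s.int 26 0 = 0)
    (h5 : s.real 5 0 = f (Finset.univ.filter fun j : Fin n => s.int 9 (j : ℕ) < 0))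
    (h1 : s.real 1 0 = 0) :
    Ens f EO negSumsLoop s fun s' => Stage n K 0 s' ∧ NegSums f s' ∧
      s'.time ≤ s.time + n * (EO + 20) + 1 := by
  have hmk : ∀ x, s.int 17 x = 0 := by
    intro x
    by_contra hx
    have := hS.marks.T_mk x hx
    omega
  have hfr : ∀ t, Same negSumsLoop.ints negSumsLoop.reals s t →
      ∀ b ∈ [0, 2, 7, 8, 9, 10, 11, 12, 13, 15, 16, 17], t.int b = s.int b := by
    intro t ht b hb
    fin_cases hb <;> exact ht.1 _ (by decide)
  refine Ens.loop_frame (fun l t => ∃ q : ℕ, l = n - q ∧ q ≤ n ∧ t.int 26 0 = q ∧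
    Stage n K 0 t ∧
    t.real 5 0 = f (Finset.univ.filter fun j : Fin n => s.int 9 (j : ℕ) < q) ∧
    (∀ k : ℕ, k ≤ q → t.real 1 k =
      ∑ i ∈ Finset.univ.filter (fun i : Fin n => s.int 9 (i : ℕ) < k),
        max 0 (-marg f (posKey n (s.int 9)) i)) ∧
    t.time ≤ s.time + q * (EO + 20)) ?_ ?_ (k := n)
    ⟨0, by omega, by omega, by simpa using h26, hS, by simpa using h5, ?_, by simp⟩
  · rintro l t hSame ⟨q, rfl, hq, hq26, hSt, hq5, hq1, htime⟩ ht
    have e := hfr t hSame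
    have e0 : t.int 0 0 = n := hSt.hn
    simp only [Test.Holds, IntExpr.eval, hq26, e0] at ht
    refine Ens.seq (Ens.setInt (Ens.seq ?_))
    refine (askCmd_spec (K := K) (a := 0) (k := q + 1) (hSt.congr ?_ ?_) ?_
      (by omega)).frame.mono ?_
    · intro b hb; fin_cases hb <;> rfl
    · intro x _; rfl
    · simp [IntExpr.eval, hq26]
    rintro s₁ ⟨hF₁, hres₁, -, h14₁, ht₁⟩
    have hb₁ : ∀ b ∈ [0, 2, 7, 8, 9, 10, 11, 12, 13, 15, 16, 17], s₁.int b = t.int b := by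
      intro b hb
      fin_cases hb <;> exact hF₁.1 _ (by decide)
    have g26 : s₁.int 26 0 = q := by rw [hF₁.1 26 (by decide)]; simpa using hq26
    have g5 : s₁.real 5 = t.real 5 := by rw [hF₁.2 5 (by decide)]; simp
    have g1 : s₁.real 1 = t.real 1 := by rw [hF₁.2 1 (by decide)]; simp
    have hS₁ : Stage n K 0 s₁ := hSt.congr hb₁ h14₁
    have g2 : s₁.real 2 0 =
        f (Finset.univ.filter fun j : Fin n => s.int 9 (j : ℕ) < ((q + 1 : ℕ) : ℤ)) := by
      rw [hres₁, askSet_unmarked (by simpa [e 17 (by decide)] using hmk)]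
      simp [e 9 (by decide)]
    have hm := hS.base.arr_mem q (by omega) (by omega)
    obtain ⟨i, hi⟩ : ∃ i : Fin n, s.int 8 q = (i : ℕ) :=
      ⟨⟨(s.int 8 q).toNat, by omega⟩, by simp only; omega⟩
    have hpi : s.int 9 (i : ℕ) = q := by
      rw [← hi]; exact hS.base.pos_arr q (by omega) (by omega)
    have hmarg := marg_posKey (f := f) hS.base i
    rw [hpi] at hmarg
    push_cast at g2
    rw [← g2, ← hq5] at hmarg
    have hsum : ∑ i ∈ Finset.univ.filter (fun i : Fin n => s.int 9 (i : ℕ) < ((q + 1 : ℕ) : ℤ)),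
        max 0 (-marg f (posKey n (s.int 9)) i) = t.real 1 q +
          max 0 (-marg f (posKey n (s.int 9)) i) := by
      have h3 := posSum_add (n := n) (pos := s.int 9) (lo := -1) (mid := q) (hi := q + 1)
        (by omega) (by omega) (fun i => max 0 (-marg f (posKey n (s.int 9)) i))
      rw [posSum_single hS.base (by omega) hi] at h3
      have h4 : ∀ k : ℤ, posSum n (s.int 9) (-1) k
          (fun i => max 0 (-marg f (posKey n (s.int 9)) i)) =
          ∑ i ∈ Finset.univ.filter (fun i : Fin n => s.int 9 (i : ℕ) < k),
            max 0 (-marg f (posKey n (s.int 9)) i) := by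
        intro k
        unfold posSum
        congr 1
        ext j
        have := (hS.base.pos_mem _ (Fin.int_mem j).1 (Fin.int_mem j).2).1
        simp only [Finset.mem_filter, Finset.mem_univ, true_and]
        omega
      rw [h4, h4] at h3
      push_cast
      rw [← h3, hq1 q le_rfl]
    have hfin : ∀ y : ℝ, y = t.real 1 q + max 0 (-marg f (posKey n (s.int 9)) i) →
        ∀ k : ℕ, k ≤ q + 1 → Function.update (t.real 1) ((q : ℤ) + 1) y k =
          ∑ i ∈ Finset.univ.filter (fun i : Fin n => s.int 9 (i : ℕ) < k),
            max 0 (-marg f (posKey n (s.int 9)) i) := by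
      intro y hy k hk
      by_cases hkq : k = q + 1
      · subst hkq
        push_cast at hsum ⊢
        rw [Function.update_self, hy, hsum]
      · rw [Function.update_of_ne (by omega)]
        exact hq1 k (by omega)
    have hrest : ∀ y : ℝ, y = t.real 1 q + max 0 (-marg f (posKey n (s.int 9)) i) →
        ∀ s₂ : State, s₂ = (((s₁.tick 1).writeReal 1 ((q : ℤ) + 1) y).tick 1) →
        Ens f EO (setR 5 (rv 2) ;; setI 26 (.add (iv 26) (.const 1))) s₂ fun t' => ∃ l < n - q,
          ∃ q : ℕ, l = n - q ∧ q ≤ n ∧ t'.int 26 0 = q ∧ Stage n K 0 t' ∧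
          t'.real 5 0 = f (Finset.univ.filter fun j : Fin n => s.int 9 (j : ℕ) < q) ∧
          (∀ k : ℕ, k ≤ q → t'.real 1 k =
            ∑ i ∈ Finset.univ.filter (fun i : Fin n => s.int 9 (i : ℕ) < k),
              max 0 (-marg f (posKey n (s.int 9)) i)) ∧
          t'.time ≤ s.time + q * (EO + 20) := by
      rintro y hy s₂ rfl
      refine Ens.seq (Ens.setReal (Ens.setInt ⟨n - (q + 1), by omega, q + 1, rfl, by omega, ?_,
        hS₁.congr ?_ ?_, ?_, ?_, ?_⟩))
      · simp [IntExpr.eval, g26]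
      · intro b hb; fin_cases hb <;> rfl
      · intro x _; rfl
      · simpa [IntExpr.eval, RealExpr.eval] using g2
      · simpa [g1] using hfin y hy
      · simp at ht₁ ⊢; linarith
    refine Ens.seq (Ens.branch (fun ht' => ?_) (fun ht' => ?_))
    · simp only [Test.Holds, RealExpr.eval, IntExpr.eval, g5] at ht'
      refine Ens.setReal ?_
      simp only [IntExpr.eval, State.tick_int, g26]
      refine hrest _ ?_ _ rfl
      rw [hmarg, max_eq_right (by linarith)]
      simp [RealExpr.eval, IntExpr.eval, g26, g5, g1]
    · simp only [Test.Holds, RealExpr.eval, IntExpr.eval, g5] at ht'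
      refine Ens.setReal ?_
      simp only [IntExpr.eval, State.tick_int, g26]
      refine hrest _ ?_ _ rfl
      rw [hmarg, max_eq_left (by linarith)]
      simp [RealExpr.eval, IntExpr.eval, g26, g1]
  · rintro l t hSame ⟨q, rfl, hq, hq26, hSt, hq5, hq1, htime⟩ ht
    have e9 := hfr t hSame 9 (by decide)
    have e0 : t.int 0 0 = n := hSt.hn
    simp only [Test.Holds, IntExpr.eval, hq26, e0] at ht
    obtain rfl : q = n := by omega
    refine ⟨hSt.congr (fun b _ => rfl) (fun x _ => rfl), ?_, by simpa using htime⟩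
    intro k hk
    simp only [State.tick_real, State.tick_int, e9]
    exact hq1 k hk
  · intro k hk
    obtain rfl : k = 0 := by omega
    rw [Finset.sum_eq_zero]
    · simpa using h1
    · intro i hi
      have := (hS.base.pos_mem _ (Fin.int_mem i).1 (Fin.int_mem i).2).1
      simp only [Finset.mem_filter, Finset.mem_univ, true_and] at hi
      omega

/-- At most `a` elements have to be settled, each by at most `m` levels; the `n + 1` queries for the
table of negative parts are the expensive part and are paid once per stage. -/
lemma rebaseCmd_spec {K a m : ℕ} {s : State} (h : Arranged n K a s) (h0 : 0 < n)
    (hm : ∀ x : ℤ, 0 ≤ x → x < n → |s.int 11 x - s.int 10 x| ≤ m) :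
    Ens f EO rebaseCmd s fun s' => Stage n K 0 s' ∧ NegSums f s' ∧
      (∀ b ∈ [0, 1, 2, 3, 4, 5, 6, 11, 13], s'.int b = s.int b) ∧ s'.real 0 = s.real 0 ∧
      s'.time ≤ s.time + a * (11 * m + 5) + n * (EO + 24) + EO + 30 := by
  suffices hsuff : Ens f EO rebaseCmd s fun s' => Stage n K 0 s' ∧ NegSums f s' ∧
      s'.time ≤ s.time + a * (11 * m + 5) + n * (EO + 24) + EO + 30 by
    refine hsuff.frame.mono ?_
    rintro s' ⟨hF, h1, h2, h3⟩
    refine ⟨h1, h2, ?_, hF.2 0 (by decide), h3⟩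
    intro b hb; fin_cases hb <;> exact hF.1 _ (by decide)
  refine Ens.seq (Ens.setInt (Ens.seq ?_))
  refine (unmarkLoop_spec (n := n) (K := K) (a := a) (m := m)
    (s := (s.writeInt 26 0 0).tick 1) ⟨h.hn, h.hK, h.ha, h.base, h.marks, h.idn, h.cl_mem, h.cl_eq⟩
    (by simp) hm).frame.mono ?_
  rintro s₁ ⟨hF₁, hB₁, hmk₁, hcl₁, ht₁⟩
  have e₁ : ∀ b ∈ [0, 2, 11, 13, 16], s₁.int b = s.int b := by
    intro b hb; fin_cases hb <;> exact hF₁.1 _ (by decide)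
  refine Ens.seq (Ens.setInt (Ens.seq (Ens.setInt (Ens.seq ?_))))
  refine (relinkLoop_spec (n := n) (K := K) ?_ ?_ ?_ ?_).frame.mono ?_
  · simpa [e₁ 0 (by decide)] using h.hn
  · simpa using hB₁
  · simp [IntExpr.eval]
  · simpa using hmk₁
  rintro s₂ ⟨hF₂, hL₂, ht₂⟩
  have e₂ : ∀ b ∈ [0, 2, 8, 9, 10, 11, 12, 13, 16, 17], s₂.int b = s₁.int b := by
    intro b hb; fin_cases hb <;> exact hF₂.1 _ (by decide)
  have e7 : s₂.int 7 0 = 0 := by rw [hF₂.1 7 (by decide)]; simp [IntExpr.eval]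
  have hmk₂ : ∀ x, s₂.int 17 x = 0 := by rw [e₂ 17 (by decide)]; exact hmk₁
  have hS₂ : Stage n K 0 s₂ := by
    refine ⟨?_, ?_, by simpa using e7, ?_, ⟨by simp, by simp, fun x hx => absurd (hmk₂ x) hx⟩, hL₂,
      ?_, ?_, ?_, h0⟩
    · rw [e₂ 0 (by decide), e₁ 0 (by decide)]; exact h.hn
    · rw [e₂ 2 (by decide), e₁ 2 (by decide)]; exact h.hK
    · rw [e₂ 8 (by decide), e₂ 9 (by decide), e₂ 10 (by decide), e₂ 12 (by decide)]; exact hB₁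
    · rw [e₂ 13 (by decide), e₁ 13 (by decide)]; exact h.idn
    · rw [e₂ 11 (by decide), e₁ 11 (by decide)]; exact h.cl_mem
    · intro x hx0 hxn _
      rw [e₂ 11 (by decide), e₁ 11 (by decide), e₂ 10 (by decide)]
      exact hcl₁ x hx0 hxn
  refine Ens.seq (Ens.setInt (Ens.seq (Ens.setInt (Ens.seq (Ens.setInt (Ens.seq ?_))))))
  refine (askCmd_spec (K := K) (a := 0) (k := 0) (hS₂.congr ?_ ?_) ?_
    (by omega)).frame.mono ?_
  · intro b hb; fin_cases hb <;> rfl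
  · intro x _; rfl
  · simp [IntExpr.eval]
  rintro s₃ ⟨hF₃, hres₃, -, h14₃, ht₃⟩
  have e₃ : ∀ b ∈ [0, 2, 7, 8, 9, 10, 11, 12, 13, 15, 16, 17], s₃.int b = s₂.int b := by
    intro b hb
    fin_cases hb <;> exact hF₃.1 _ (by decide)
  have hS₃ : Stage n K 0 s₃ := hS₂.congr e₃ h14₃
  refine Ens.seq (Ens.setReal (Ens.seq (Ens.setReal (Ens.seq (Ens.setInt ?_)))))
  refine (negSumsLoop_spec (K := K) (hS₃.congr ?_ ?_) ?_ ?_ ?_).mono ?_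
  · intro b hb; fin_cases hb <;> rfl
  · intro x _; rfl
  · simp [IntExpr.eval]
  · simp [IntExpr.eval, RealExpr.eval, hres₃, askSet_unmarked hmk₂, e₃ 9 (by decide)]
  · simp [IntExpr.eval, RealExpr.eval]
  rintro s₄ ⟨hS₄, hN₄, ht₄⟩
  refine ⟨hS₄, hN₄, ?_⟩
  simp at ht₁ ht₂ ht₃ ht₄
  linarith

end

/-! ### The main loop. -/

/-- Start a new stage if the current one is over. -/
def stageCmd : Command :=
  .branch (.intLE (iv 3) (iv 5)) (rebaseCmd ;; setI 5 (.const 0)) .skip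

/-- The number of remaining steps, `n K² - t`. -/
def remainingExpr : RealExpr :=
  .sub (.mul (.ofInt (iv 0)) (.mul (.ofInt (iv 2)) (.ofInt (iv 2)))) (.ofInt (iv 4))

def mainBody : Command :=
  stageCmd ;; .flip (.div (.const 1) remainingExpr) 30 (.const 0) ;;
  .branch (.intLE (.const 1) (iv 30)) (setI 6 (.const 0)) stepCmd ;;
  setI 4 (.add (iv 4) (.const 1)) ;; setI 5 (.add (iv 5) (.const 1))

/-- Stochastic subgradient descent, stopped at a uniformly random time. -/
def mainLoop : Command := .loop (.intLE (.const 1) (iv 6)) mainBody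

noncomputable section

variable {n : ℕ} {f : Finset (Fin n) → ℝ} {EO : ℝ}

/-- The sum of the excess values of the level sets. -/
def gap (f : Finset (Fin n) → ℝ) (K : ℤ) (S : Finset (Fin n)) (cl : Fin n → ℤ) : ℝ :=
  ∑ v ∈ Finset.Ico 0 K, (f (Finset.univ.filter fun i => v < cl i) - f S)

lemma gap_nonneg {S : Finset (Fin n)} (hS : ∀ T, f S ≤ f T) (K : ℤ) (cl : Fin n → ℤ) :
    0 ≤ gap f K S cl :=
  Finset.sum_nonneg fun _ _ => sub_nonneg.2 (hS _)

/-- The scalar product of the subgradient with the vector to the scaled indicator of `S`. -/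
def descent (f : Finset (Fin n) → ℝ) (K a : ℕ) (S : Finset (Fin n)) (s : State) : ℝ :=
  ∑ i, curMarg f a s i * ((levels n s i : ℝ) - K * if i ∈ S then 1 else 0)

/-- The current order lists the levels decreasingly, so its marginals form a subgradient of the
Lovász extension at the grid point. -/
lemma gap_le_descent {K a : ℕ} {s : State} (hf : Submodular f) (h : Stage n K a s)
    (S : Finset (Fin n)) : gap f K S (levels n s) ≤ descent f K a S s := by
  have := sum_levels_le (K := K) (cl := levels n s) hf h.order.curKey_inj
    (fun i => h.cl_mem _ (Fin.int_mem i).1 (Fin.int_mem i).2) (fun i j hij => ?_) S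
  · unfold gap descent
    exact_mod_cast this
  · rw [StageOrder.curKey_lt] at hij
    unfold levels
    omega

/-- The right side bounds an expected squared distance from above, hence is nonnegative. In the last
round this bounds the gap itself; in the other rounds it keeps the arguments of `ENNReal.ofReal`
nonnegative. -/
lemma descent_le {K a : ℕ} {s : State} (hf : Submodular f) (hb : ∀ S, |f S| ≤ 1)
    (h : Stage n K a s) (S : Finset (Fin n)) :
    0 ≤ sqDist K S (levels n s) - descent f K a S s / 6 + 1 := by
  have hmw : ∀ i, |curMarg f a s i| ≤ curWeight f a s i := h.order.abs_marg_le_weight hf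
  have hw : ∀ i, 0 ≤ curWeight f a s i := fun i => (abs_nonneg _).trans (hmw i)
  have hsum : ∑ i, curWeight f a s i ≤ 12 := h.order.sum_weight_le hf hb
  have hE := expected_step_le (α := 1) (β := 0) (Ψ := sqDist K S (levels n s)) zero_le_one hmw
    (fun i => sqDist_down (K : ℤ) (by omega) S (levels n s) i)
    (fun i => sqDist_up (K : ℤ) S (levels n s) (by omega) i) hsum
  have h0 : 0 ≤ ∑ i, curWeight f a s i * stepValue f K a s S 1 0 i :=
    Finset.sum_nonneg fun i _ => mul_nonneg (hw i)
      (stepValue_nonneg zero_le_one le_rfl (hmw i))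
  have h1 := mul_nonneg (show 0 ≤ 1 - (∑ i, curWeight f a s i) / 12 by linarith)
    (show 0 ≤ 1 * sqDist K S (levels n s) + 0 by linarith [sqDist_nonneg K S (levels n s)])
  have h2 : descent f K a S s = ∑ i, curMarg f a s i *
      ((levels n s i : ℝ) - (K : ℤ) * if i ∈ S then 1 else 0) := by
    unfold descent; push_cast; rfl
  rw [h2]
  have h3 := div_nonneg h0 (show (0 : ℝ) ≤ 12 by norm_num)
  unfold stepValue at h3
  linarith

/-- Used when one choice remains and the bit is surely `1`: the other outcome has probability `0`,
so it needs no finite bound. -/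
lemma Bounded.flip_seq_one {p : RealExpr} {a : ℕ} {i : IntExpr} {c : Command} {s : State}
    {φ : State → ℝ≥0∞} {v : ℝ≥0∞} (hp : p.eval s = 1)
    (h : Bounded f EO c ((s.writeInt a (i.eval s) 1).tick 1) φ v) :
    Bounded f EO (.seq (.flip p a i) c) s φ v := by
  classical
  refine Bounded.seq (ψ := fun s' => if s' = (s.writeInt a (i.eval s) 1).tick 1 then v else ⊤)
    ⟨1, ?_⟩ ?_
  · rw [run, expect_coin_map _ _ fun b => (s.writeInt a (i.eval s) b).tick 1, hp]
    simp
  · intro s'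
    by_cases hs : s' = (s.writeInt a (i.eval s) 1).tick 1
    · simpa [hs] using h
    · simp [hs, Bounded.top]

/-- The state at the beginning of a round of the main loop, with `k` steps remaining. -/
structure MainInv (f : Finset (Fin n) → ℝ) (K m k : ℕ) (α R τ : ℝ) (s : State) : Prop where
  hm : s.int 3 0 = m
  run : s.int 6 0 = 1
  remaining : s.int 4 0 + k = n * (K * K)
  out : ∀ x, s.int 1 x = 0
  main : ∃ a j : ℕ, s.int 5 0 = j ∧ a ≤ j ∧ j ≤ m ∧ Arranged n K a s ∧
    (∀ x : ℤ, 0 ≤ x → x < n → |s.int 11 x - s.int 10 x| ≤ j) ∧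
    (j < m → Stage n K a s ∧ NegSums f s) ∧ s.time + k * α + (k + j) / m * R ≤ τ

/-- The state after the main loop. -/
structure MainPost (n K : ℕ) (cl : Fin n → ℤ) (τ : ℝ) (s : State) : Prop where
  hn : s.int 0 0 = n
  hK : s.int 2 0 = K
  out : ∀ x, s.int 1 x = 0
  cl_eq : levels n s = cl
  cl_mem : ∀ i, 0 ≤ cl i ∧ cl i ≤ K
  time : s.time ≤ τ

/-- The state at the beginning of a step. -/
structure RoundInv (f : Finset (Fin n) → ℝ) (K m k a j : ℕ) (α R τ : ℝ) (s : State) : Prop where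
  hm : s.int 3 0 = m
  run : s.int 6 0 = 1
  remaining : s.int 4 0 + k = n * (K * K)
  out : ∀ x, s.int 1 x = 0
  hj : s.int 5 0 = j
  haj : a ≤ j
  hjm : j < m
  stage : Stage n K a s
  neg : NegSums f s
  close : ∀ x : ℤ, 0 ≤ x → x < n → |s.int 11 x - s.int 10 x| ≤ j
  time : s.time + k * α + (k + j) / m * R ≤ τ + 3

/-- The time budget holds `(k + j) / m` charges of `R`, with `k` rounds remaining and `j` steps done
in the stage. Rebasing resets `j` from `m` to `0` and so releases one charge. -/
lemma stageCmd_spec {K m k : ℕ} {α R τ : ℝ} {s : State} (h : MainInv f K m k α R τ s) (hn : 0 < n)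
    (hm : 0 < m) (hR : m * (11 * m + 5) + n * (EO + 24) + EO + 31 ≤ R) :
    Ens f EO stageCmd (s.tick 1) fun s' => levels n s' = levels n s ∧
      ∃ a j, RoundInv f K m k a j α R τ s' := by
  obtain ⟨a, j, hj, haj, hjm, hA, hclose, hstage, ht⟩ := h.main
  refine Ens.branch (fun htest => ?_) (fun htest => ?_)
  · obtain rfl : j = m := by
      simp only [Test.Holds, IntExpr.eval, State.tick_int, h.hm, hj] at htest
      omega
    refine Ens.seq ((rebaseCmd_spec (K := K) (a := a) (m := j) (s := (s.tick 1).tick 1)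
      ⟨hA.hn, hA.hK, hA.ha, hA.base, hA.marks, hA.idn, hA.cl_mem, hA.cl_eq⟩ hn hclose).mono ?_)
    rintro s₁ ⟨hS₁, hN₁, hb₁, hr₁, ht₁⟩
    have hmk : ∀ x, s₁.int 17 x = 0 := by
      intro x
      by_contra hx
      have := hS₁.marks.T_mk x hx
      omega
    refine Ens.setInt ⟨?_, 0, 0, ?_, ?_, ?_, ?_, ?_, le_rfl, hm, hS₁.congr ?_ ?_,
      hN₁.congr rfl rfl, ?_, ?_⟩
    · unfold levels
      simp [hb₁ 11 (by decide)]
    · simpa [hb₁ 3 (by decide)] using h.hm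
    · simpa [hb₁ 6 (by decide)] using h.run
    · simpa [hb₁ 4 (by decide)] using h.remaining
    · simpa [hb₁ 1 (by decide)] using h.out
    · simp [IntExpr.eval]
    · intro b hb; fin_cases hb <;> rfl
    · intro x _; rfl
    · intro x hx0 hxn
      simp [hS₁.cl_eq x hx0 hxn (hmk x)]
    · have haj' : (a : ℝ) * (11 * j + 5) ≤ j * (11 * j + 5) := by gcongr
      have hj0 : (0 : ℝ) < j := by exact_mod_cast hm
      have e1 : ((k : ℝ) + j) / j * R = k / j * R + R := by field_simp
      rw [e1] at ht
      simp at ht₁ ⊢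
      linarith
  · have hlt : j < m := by
      simp only [Test.Holds, IntExpr.eval, State.tick_int, h.hm, hj] at htest
      omega
    obtain ⟨hS, hN⟩ := hstage hlt
    refine Ens.skip ⟨rfl, a, j, h.hm, h.run, h.remaining, h.out, hj, haj, hlt,
      hS.congr (fun _ _ => rfl) (fun _ _ => rfl), hN.congr rfl rfl, hclose, ?_⟩
    simp; linarith

lemma halt_spec {K m k a j : ℕ} {α R τ : ℝ} {s : State} (h : RoundInv f K m (k + 1) a j α R τ s)
    (hα : 9 ≤ α) (hR : 0 ≤ R) {φ : State → ℝ≥0∞} {v : ℝ≥0∞}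
    (hφ : ∀ s', MainPost n K (levels n s) τ s' → φ s' ≤ v) :
    Bounded f EO (.seq (.branch (.intLE (.const 1) (iv 30)) (setI 6 (.const 0)) stepCmd ;;
      setI 4 (.add (iv 4) (.const 1)) ;; setI 5 (.add (iv 5) (.const 1))) mainLoop)
      ((s.writeInt 30 0 1).tick 1) φ v := by
  refine Bounded.assoc (Ens.seq_bounded (Ens.branch (fun _ => Ens.setInt ?_) (fun ht => ?_)))
  · refine Bounded.assoc (Ens.seq_bounded (Ens.setInt (Ens.seq_bounded (Ens.setInt
      (Bounded.loop_false ?_ (hφ _ ⟨?_, ?_, ?_, ?_, ?_, ?_⟩))))))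
    · simp [Test.Holds, IntExpr.eval]
    · simpa using h.stage.hn
    · simpa using h.stage.hK
    · simpa using h.out
    · funext i; simp [levels]
    · exact fun i => h.stage.cl_mem _ (Fin.int_mem i).1 (Fin.int_mem i).2
    · have ht := h.time
      have h1 : 0 ≤ ((k + 1 : ℕ) + (j : ℝ)) / m * R := by positivity
      have h2 : 0 ≤ (k : ℝ) * α := by positivity
      push_cast at ht h1
      simp
      linarith
  · simp [Test.Holds, IntExpr.eval] at ht

/-- A step decreases `k` and increases `j` by one. The budget for rebasing is unchanged and only `α`
is spent. The numbers `β` and `γ` are the coefficients of the affine bound for the remaining rounds.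
-/
lemma continue_spec {K m k a j e : ℕ} {α R τ : ℝ} {s : State}
    (h : RoundInv f K m (k + 2) a j α R τ s) (hf : Submodular f) (hb : ∀ S, |f S| ≤ 1)
    (hm : m < n) (he : n ≤ 2 ^ e) (hEO : 0 ≤ EO) (hα : (m + e + 4) * (22 * m + 2 * EO + 40) + 9 ≤ α)
    {S : Finset (Fin n)} {β γ : ℝ} (hβ : 0 ≤ β) (hγ : 0 ≤ γ) {φ : State → ℝ≥0∞}
    (ih : ∀ s', MainInv f K m (k + 1) α R τ s' →
      Bounded f EO mainLoop s' φ (ENNReal.ofReal (β * sqDist K S (levels n s') + γ))) :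
    Bounded f EO (.seq (.branch (.intLE (.const 1) (iv 30)) (setI 6 (.const 0)) stepCmd ;;
      setI 4 (.add (iv 4) (.const 1)) ;; setI 5 (.add (iv 5) (.const 1))) mainLoop)
      ((s.writeInt 30 0 0).tick 1) φ (ENNReal.ofReal (β * (sqDist K S (levels n s) -
        descent f K a S s / 6 + 1) + γ)) := by
  classical
  obtain ⟨u, hu⟩ : ∃ u, u = (((s.writeInt 30 0 0).tick 1).tick 1) := ⟨_, rfl⟩
  have hub : ∀ b, b ≠ 30 → u.int b = s.int b := by intro b hb; rw [hu]; simp [hb]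
  have hut : u.time = s.time + 2 := by rw [hu]; simp; ring
  have hlev : levels n u = levels n s := by unfold levels; rw [hub 11 (by decide)]
  have hdes : descent f K a S u = descent f K a S s := by
    unfold descent curMarg
    rw [hlev, hub 9 (by decide), hub 11 (by decide), hub 17 (by decide)]
  have hSu : Stage n K a u := by
    refine h.stage.congr (fun b hb => hub b ?_) (fun x _ => ?_)
    · rintro rfl; revert hb; decide
    · rw [hub 14 (by decide)]
  have hNu : NegSums f u := h.neg.congr (hub 9 (by decide)) (by rw [hu]; rfl)
  set δ : ℝ := (m + e + 4) * (22 * m + 2 * EO + 40) with hδ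
  have hδ' : (a + e + 4) * (22 * a + 2 * EO + 40) ≤ δ := by
    have : (a : ℝ) ≤ m := by exact_mod_cast h.haj.trans h.hjm.le
    rw [hδ]; gcongr
  have hstep := stepCmd_spec (f := f) (EO := EO) (S := S) (s := u) (τ := u.time + δ)
    (ψ := fun s' => if StepPost f K a u s' ∧ s'.time ≤ u.time + δ then
      ENNReal.ofReal (β * sqDist K S (levels n s') + γ) else ⊤) hf hb hSu hNu
    (by have := h.haj; have := h.hjm; omega) he hEO hβ hγ (by linarith)
    (fun s' h1 h2 => by rw [if_pos ⟨h1, h2⟩])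
  change Bounded f EO stepCmd u _ (ENNReal.ofReal (β * (sqDist K S (levels n u) -
    descent f K a S u / 6 + 1) + γ)) at hstep
  rw [hlev, hdes] at hstep
  refine Bounded.assoc (Bounded.seq (Bounded.branch (fun ht => ?_) (fun _ => by rw [← hu]; exact hstep)) ?_)
  · simp [Test.Holds, IntExpr.eval] at ht
  · intro s₁
    by_cases hs₁ : StepPost f K a u s₁ ∧ s₁.time ≤ u.time + δ
    · rw [if_pos hs₁]
      obtain ⟨hpost, htime⟩ := hs₁
      obtain ⟨a', ha', hS₁⟩ := hpost.stage
      have hk : ∀ b ∈ [0, 1, 2, 3, 4, 5, 6, 8, 9, 10, 12, 13], s₁.int b = s.int b := by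
        intro b hb
        rw [hpost.keep b hb]
        refine hub b ?_
        rintro rfl; revert hb; decide
      have hclose : ∀ x : ℤ, 0 ≤ x → x < n → |s₁.int 11 x - s₁.int 10 x| ≤ (j + 1 : ℕ) := by
        intro x hx0 hxn
        have h1 := abs_le.1 (hpost.close x hx0 hxn)
        have h2 := abs_le.1 (h.close x hx0 hxn)
        rw [hub 11 (by decide)] at h1
        rw [hk 10 (by decide), abs_le]
        push_cast
        omega
      refine Bounded.assoc (Ens.seq_bounded (Ens.setInt (Ens.seq_bounded (Ens.setInt
        (ih _ ⟨?_, ?_, ?_, ?_, a', j + 1, ?_, ?_, ?_, ?_, ?_, ?_, ?_⟩)))))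
      · simpa [hk 3 (by decide)] using h.hm
      · simpa [hk 6 (by decide)] using h.run
      · have := h.remaining
        simp [IntExpr.eval, hk 4 (by decide)]
        push_cast at this
        linarith
      · simpa [hk 1 (by decide)] using h.out
      · simp [IntExpr.eval, hk 5 (by decide), h.hj]
      · have := h.haj; omega
      · exact h.hjm
      · exact ⟨hS₁.hn, hS₁.hK, hS₁.ha, hS₁.base, hS₁.marks, hS₁.idn, hS₁.cl_mem, hS₁.cl_eq⟩
      · exact hclose
      · intro _
        refine ⟨hS₁.congr ?_ ?_, hpost.neg.congr rfl rfl⟩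
        · intro b hb; fin_cases hb <;> rfl
        · intro x _; rfl
      · have ht := h.time
        have h1 : ((k + 1 : ℕ) + ((j + 1 : ℕ) : ℝ)) / m * R = ((k + 2 : ℕ) + (j : ℝ)) / m * R := by
          push_cast; ring
        rw [h1]
        push_cast at ht ⊢
        simp
        linarith
    · rw [if_neg hs₁]
      exact Bounded.top _ _ _

lemma remainingExpr_eval {K m k a j : ℕ} {α R τ : ℝ} {s : State}
    (h : RoundInv f K m k a j α R τ s) : remainingExpr.eval s = k := by
  have h1 := h.remaining
  have h2 : ((s.int 4 0 : ℤ) : ℝ) + k = n * (K * K) := by exact_mod_cast h1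
  simp only [remainingExpr, RealExpr.eval, IntExpr.eval, h.stage.hn, h.stage.hK]
  push_cast
  linarith

/-- Halting with probability one over the number of remaining rounds makes the stopping time
uniform. With `k + 2` rounds left, the value `gap / K ≤ descent / K` enters with weight `1 / (k +
2)`; the continuation enters with weight `(k + 1) / (k + 2)`, and its coefficient `6 / (K (k + 1))`
turns the drift `-descent / 6` into the exact opposite. -/
lemma mainLoop_spec {K m e : ℕ} {α R τ : ℝ} (hf : Submodular f) (hb : ∀ S, |f S| ≤ 1)
    {S : Finset (Fin n)} (hS : ∀ T, f S ≤ f T) (hK : 0 < K) (hm : 0 < m) (hmn : m < n)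
    (he : n ≤ 2 ^ e) (hEO : 0 ≤ EO) (hα : (m + e + 4) * (22 * m + 2 * EO + 40) + 9 ≤ α)
    (hR : m * (11 * m + 5) + n * (EO + 24) + EO + 31 ≤ R) {φ : State → ℝ≥0∞}
    (hφ : ∀ cl s', MainPost n K cl τ s' → φ s' ≤ ENNReal.ofReal (gap f K S cl / K)) (k : ℕ) :
    ∀ s, MainInv f K m (k + 1) α R τ s → Bounded f EO mainLoop s φ
      (ENNReal.ofReal (6 / K * (sqDist K S (levels n s) / (k + 1) + 1))) := by
  have hK' : (0 : ℝ) < K := by exact_mod_cast hK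
  have hα9 : 9 ≤ α := by
    have : (0 : ℝ) ≤ (m + e + 4) * (22 * m + 2 * EO + 40) := by positivity
    linarith
  have hR0 : 0 ≤ R := by
    have : (0 : ℝ) ≤ m * (11 * m + 5) + n * (EO + 24) + EO + 31 := by positivity
    linarith
  induction k with
  | zero =>
    intro s h
    refine Bounded.loop_true (by simp [Test.Holds, IntExpr.eval, h.run]) (Bounded.assoc
      (Ens.seq_bounded ((stageCmd_spec h (by omega) hm hR).mono ?_)))
    rintro s₁ ⟨hlev, a, j, h₁⟩
    refine Bounded.assoc (Bounded.flip_seq_one ?_ (Bounded.mono (halt_spec h₁ hα9 hR0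
      (hφ (levels n s₁))) (fun _ => le_rfl) (ENNReal.ofReal_le_ofReal ?_)))
    · simp [RealExpr.eval, remainingExpr_eval h₁]
    · have h2 := gap_le_descent hf h₁.stage S
      have h3 := descent_le hf hb h₁.stage S
      rw [← hlev]
      -- In the last round no step follows; nonnegativity of the potential after a hypothetical step
      -- bounds the gap.
      have h4 : gap f K S (levels n s₁) ≤ 6 * (sqDist K S (levels n s₁) + 1) := by linarith
      calc gap f K S (levels n s₁) / K ≤ 6 * (sqDist K S (levels n s₁) + 1) / K := by gcongr
        _ = _ := by push_cast; ring
  | succ k ih =>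
    intro s h
    refine Bounded.loop_true (by simp [Test.Holds, IntExpr.eval, h.run]) (Bounded.assoc
      (Ens.seq_bounded ((stageCmd_spec h (by omega) hm hR).mono ?_)))
    rintro s₁ ⟨hlev, a, j, h₁⟩
    have hp : (RealExpr.div (.const 1) remainingExpr).eval s₁ = 1 / ((k : ℝ) + 2) := by
      simp only [RealExpr.eval, remainingExpr_eval h₁]
      push_cast
      ring
    have h2 := gap_le_descent hf h₁.stage S
    have h3 := descent_le hf hb h₁.stage S
    have hk2 : (0 : ℝ) < (k : ℝ) + 2 := by positivity
    have hk1 : (0 : ℝ) < (k : ℝ) + 1 := by positivity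
    have hβ : (0 : ℝ) ≤ 6 / K / (k + 1) := by positivity
    have hγ : (0 : ℝ) ≤ 6 / K := by positivity
    refine Bounded.assoc (Bounded.mono (Bounded.flip_seq (x := gap f K S (levels n s₁) / K)
      (y := 6 / K / (k + 1) * (sqDist K S (levels n s₁) - descent f K a S s₁ / 6 + 1) + 6 / K)
      ?_ ?_ (div_nonneg (gap_nonneg hS _ _) hK'.le) (add_nonneg (mul_nonneg hβ h3) hγ)
      (halt_spec h₁ hα9 hR0 (hφ (levels n s₁)))
      (continue_spec h₁ hf hb hmn he hEO hα hβ hγ fun s' h' => ?_))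
      (fun _ => le_rfl) (ENNReal.ofReal_le_ofReal ?_))
    · rw [hp]; positivity
    · rw [hp, div_le_one hk2]; linarith
    · have := ih s' h'
      convert this using 2
      ring
    · rw [hp, ← hlev]
      -- After replacing the gap by `descent`, both occurrences of `descent` cancel and an identity
      -- remains.
      calc 1 / ((k : ℝ) + 2) * (gap f K S (levels n s₁) / K) + (1 - 1 / ((k : ℝ) + 2)) *
            (6 / K / (k + 1) * (sqDist K S (levels n s₁) - descent f K a S s₁ / 6 + 1) + 6 / K)
          ≤ 1 / ((k : ℝ) + 2) * (descent f K a S s₁ / K) + (1 - 1 / ((k : ℝ) + 2)) *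
            (6 / K / (k + 1) * (sqDist K S (levels n s₁) - descent f K a S s₁ / 6 + 1) + 6 / K) := by
            gcongr
        _ = _ := by
            push_cast
            field_simp
            ring

end

/-! ### Rounding the grid point to a random level set. -/

def pickLoop : Command :=
  .loop (.intLE (.const 1) (iv 6))
    (.flip (.div (.const 1) (.ofInt (.sub (iv 2) (iv 32)))) 30 (.const 0) ;;
      .branch (.intLE (.const 1) (iv 30)) (setI 6 (.const 0))
        (setI 32 (.add (iv 32) (.const 1))))

def outLoop : Command :=
  .loop (ltI (iv 31) (iv 0))
    (.branch (ltI (iv 32) (.get 11 (iv 31))) (.setInt 1 (iv 31) (.const 1)) .skip ;;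
      setI 31 (.add (iv 31) (.const 1)))

/-- Return a uniformly random level set of the current grid point. -/
def pickCmd : Command :=
  setI 32 (.const 0) ;; setI 6 (.const 1) ;; pickLoop ;; setI 31 (.const 0) ;; outLoop

noncomputable section

variable {n : ℕ} {f : Finset (Fin n) → ℝ} {EO : ℝ}

/-- The state after the choice of the level `w`. -/
structure PickPost (n K : ℕ) (cl : Fin n → ℤ) (τ : ℝ) (w : ℤ) (s : State) : Prop where
  post : MainPost n K cl τ s
  level : s.int 32 0 = w

/-- Level `v`, once reached, is accepted with probability `1 / (K - v)`, so the accepted level is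
uniform among the remaining ones. -/
lemma pickLoop_spec {K : ℕ} {cl : Fin n → ℤ} {τ : ℝ} {φ : State → ℝ≥0∞} {G : ℤ → ℝ}
    (hG : ∀ v, 0 ≤ G v) (hφ : ∀ w s', PickPost n K cl τ w s' → φ s' ≤ ENNReal.ofReal (G w))
    (k : ℕ) : ∀ (v : ℤ) (s : State), v + (k + 1) = K → PickPost n K cl (τ - 4 * (k + 1) - 1) v s →
      s.int 6 0 = 1 →
      Bounded f EO pickLoop s φ (ENNReal.ofReal ((∑ w ∈ Finset.Ico v K, G w) / (k + 1))) := by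
  have halt : ∀ (v : ℤ) (s : State), PickPost n K cl (τ - 5) v s →
      Bounded f EO (.seq (.branch (.intLE (.const 1) (iv 30)) (setI 6 (.const 0))
        (setI 32 (.add (iv 32) (.const 1)))) pickLoop)
        (((s.tick 1).writeInt 30 0 1).tick 1) φ (ENNReal.ofReal (G v)) := by
    intro v s h
    refine Ens.seq_bounded (Ens.branch (fun _ => Ens.setInt ?_) (fun ht => ?_))
    · refine Bounded.loop_false ?_ (hφ v _ ⟨⟨?_, ?_, ?_, ?_, h.post.cl_mem, ?_⟩, ?_⟩)
      · simp [Test.Holds, IntExpr.eval]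
      · simpa using h.post.hn
      · simpa using h.post.hK
      · simpa using h.post.out
      · rw [← h.post.cl_eq]; funext i; simp [levels]
      · have := h.post.time; simp; linarith
      · simpa using h.level
    · simp [Test.Holds, IntExpr.eval] at ht
  induction k with
  | zero =>
    intro v s hv h h6
    refine Bounded.loop_true (by simp [Test.Holds, IntExpr.eval, h6]) (Bounded.assoc
      (Bounded.flip_seq_one ?_ ((halt v s ?_).mono (fun _ => le_rfl) (le_of_eq ?_))))
    · have : (K : ℤ) - v = 1 := by push_cast at hv; omega
      simp only [RealExpr.eval, IntExpr.eval, State.tick_int, h.post.hK, h.level, this]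
      norm_num
    · refine ⟨⟨h.post.hn, h.post.hK, h.post.out, h.post.cl_eq, h.post.cl_mem, ?_⟩, h.level⟩
      have := h.post.time
      push_cast at this
      linarith
    · have : Finset.Ico v (K : ℤ) = {v} := by
        ext x; simp only [Finset.mem_Ico, Finset.mem_singleton]; push_cast at hv; omega
      simp [this]
  | succ k ih =>
    intro v s hv h h6
    push_cast at hv
    have hp : (RealExpr.div (.const 1) (.ofInt (.sub (iv 2) (iv 32)))).eval (s.tick 1) =
        1 / ((k : ℝ) + 2) := by
      have : (K : ℤ) - v = k + 2 := by omega
      simp only [RealExpr.eval, IntExpr.eval, State.tick_int, h.post.hK, h.level, this]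
      push_cast; ring
    have hk2 : (0 : ℝ) < (k : ℝ) + 2 := by positivity
    refine Bounded.loop_true (by simp [Test.Holds, IntExpr.eval, h6]) (Bounded.assoc
      (Bounded.mono (Bounded.flip_seq (x := G v)
        (y := (∑ w ∈ Finset.Ico (v + 1) (K : ℤ), G w) / (k + 1)) ?_ ?_ (hG v)
        (div_nonneg (Finset.sum_nonneg fun w _ => hG w) (by positivity)) (halt v s ?_)
        (Ens.seq_bounded (Ens.branch (fun ht => ?_) (fun _ => Ens.setInt (ih (v + 1) _ (by omega)
          ⟨⟨?_, ?_, ?_, ?_, h.post.cl_mem, ?_⟩, ?_⟩ ?_)))))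
        (fun _ => le_rfl) (ENNReal.ofReal_le_ofReal (le_of_eq ?_))))
    · rw [hp]; positivity
    · rw [hp, div_le_one hk2]; linarith
    · refine ⟨⟨h.post.hn, h.post.hK, h.post.out, h.post.cl_eq, h.post.cl_mem, ?_⟩, h.level⟩
      have := h.post.time
      have h0 : (0 : ℝ) ≤ k := Nat.cast_nonneg k
      push_cast at this
      linarith
    · simp [Test.Holds, IntExpr.eval] at ht
    · simpa using h.post.hn
    · simpa using h.post.hK
    · simpa using h.post.out
    · rw [← h.post.cl_eq]; funext i; simp [levels]
    · have := h.post.time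
      push_cast at this
      simp; linarith
    · simp [IntExpr.eval, h.level]
    · simpa using h6
    · rw [hp]
      have : Finset.Ico v (K : ℤ) = insert v (Finset.Ico (v + 1) (K : ℤ)) := by
        ext x; simp only [Finset.mem_Ico, Finset.mem_insert]; omega
      rw [this, Finset.sum_insert (by simp)]
      push_cast
      field_simp
      ring

lemma outLoop_spec {s : State} (hn : s.int 0 0 = n) (h31 : s.int 31 0 = 0)
    (h1 : ∀ x, s.int 1 x = 0) :
    Ens f EO outLoop s fun s' =>
      output n s' = (Finset.univ.filter fun i => s.int 32 0 < levels n s i) ∧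
      s'.time ≤ s.time + 4 * n + 1 := by
  refine Ens.loop_frame (fun l t => ∃ q : ℕ, l = n - q ∧ q ≤ n ∧ t.int 31 0 = q ∧
    (∀ i : Fin n, t.int 1 (i : ℕ) ≠ 0 ↔ (i : ℕ) < q ∧ s.int 32 0 < levels n s i) ∧
    t.time ≤ s.time + 4 * q) ?_ ?_ (k := n)
    ⟨0, by omega, by omega, by simpa using h31, by simp [h1], by simp⟩
  · rintro l t hS ⟨q, rfl, hq, hq31, hout, htime⟩ ht
    have e0 := hS.1 0 (by decide)
    have e11 := hS.1 11 (by decide)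
    have e32 := hS.1 32 (by decide)
    simp only [Test.Holds, IntExpr.eval, hq31, e0, hn] at ht
    refine Ens.seq (Ens.branch (fun h => Ens.setInt (Ens.setInt ?_))
      (fun h => Ens.skip (Ens.setInt ?_)))
    · simp only [Test.Holds, IntExpr.eval, State.tick_int, hq31, e11, e32] at h
      refine ⟨n - (q + 1), by omega, q + 1, rfl, by omega, ?_, fun i => ?_, ?_⟩
      · simp [IntExpr.eval, hq31]
      · have := hout i
        simp [IntExpr.eval, hq31]
        by_cases hi : (i : ℕ) = q
        · have : s.int 32 0 < levels n s i := by unfold levels; rw [hi]; omega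
          simp [hi, this]
        · rw [Function.update_of_ne (by omega)]
          simp only [ne_eq] at this
          rw [this]
          refine and_congr_left fun _ => ?_
          omega
      · simp; linarith
    · simp only [Test.Holds, IntExpr.eval, State.tick_int, hq31, e11, e32] at h
      refine ⟨n - (q + 1), by omega, q + 1, rfl, by omega, ?_, fun i => ?_, ?_⟩
      · simp [IntExpr.eval, hq31]
      · have := hout i
        simp [IntExpr.eval, hq31]
        by_cases hi : (i : ℕ) = q
        · have h2 : ¬ s.int 32 0 < levels n s i := by unfold levels; rw [hi]; omega
          simpa [hi, h2] using this
        · simp only [ne_eq] at this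
          rw [this]
          refine and_congr_left fun _ => ?_
          omega
      · simp; linarith
  · rintro l t hS ⟨q, rfl, hq, hq31, hout, htime⟩ ht
    have e0 := hS.1 0 (by decide)
    simp only [Test.Holds, IntExpr.eval, hq31, e0, hn] at ht
    obtain rfl : q = n := by omega
    refine ⟨?_, by simpa using htime⟩
    ext i
    simp [output, hout]

/-- The average of `f` over the level sets `0, …, K - 1` is the Lovász extension at the scaled grid
point, so the expected excess is `gap / K`. -/
lemma pickCmd_spec {K : ℕ} (hK : 0 < K) {S : Finset (Fin n)} (hS : ∀ T, f S ≤ f T)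
    {cl : Fin n → ℤ} {σ τ : ℝ} {s : State} (h : MainPost n K cl σ s)
    (hτ : σ + 4 * K + 4 * n + 5 ≤ τ) {φ : State → ℝ≥0∞}
    (hφ : ∀ s', s'.time ≤ τ → φ s' ≤ ENNReal.ofReal (f (output n s') - f S)) :
    Bounded f EO pickCmd s φ (ENNReal.ofReal (gap f K S cl / K)) := by
  refine Ens.seq_bounded (Ens.setInt (Ens.seq_bounded (Ens.setInt (Bounded.seq
    (ψ := fun s' => ⨅ w, ⨅ _ : PickPost n K cl (σ + 4 * K + 3) w s',
      ENNReal.ofReal (f (Finset.univ.filter fun i => w < cl i) - f S))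
    (Bounded.mono (pickLoop_spec (K := K) (cl := cl) (τ := σ + 4 * K + 3)
      (G := fun w => f (Finset.univ.filter fun i => w < cl i) - f S)
      (fun v => sub_nonneg.2 (hS _)) (fun w s' h => iInf₂_le w h) (K - 1) 0 _ (by omega)
      ⟨⟨?_, ?_, ?_, ?_, h.cl_mem, ?_⟩, ?_⟩ ?_) (fun _ => le_rfl) (le_of_eq ?_)) ?_))))
  · simpa using h.hn
  · simpa using h.hK
  · simpa using h.out
  · rw [← h.cl_eq]; funext i; simp [levels]
  · have := h.time
    rw [Nat.cast_sub hK]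
    push_cast
    simp; linarith
  · simp [IntExpr.eval]
  · simp [IntExpr.eval]
  · rw [Nat.cast_sub hK, gap]
    push_cast
    rw [sub_add_cancel]
  · intro s₁
    by_cases hex : ∃ w, PickPost n K cl (σ + 4 * K + 3) w s₁
    · obtain ⟨w, hw⟩ := hex
      refine Bounded.mono (φ := φ) (v := ENNReal.ofReal
        (f (Finset.univ.filter fun i => w < cl i) - f S)) ?_ (fun _ => le_rfl)
        (le_iInf₂ fun w' hw' => ?_)
      · refine Ens.seq_bounded (Ens.setInt (Ens.bounded ((outLoop_spec (n := n) ?_ ?_ ?_).mono ?_)))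
        · simpa using hw.post.hn
        · simp [IntExpr.eval]
        · simpa using hw.post.out
        · rintro s' ⟨hout, ht⟩
          refine (hφ s' ?_).trans (le_of_eq ?_)
          · have := hw.post.time
            simp at ht
            linarith
          · rw [hout]
            simp only [State.tick_int, State.writeInt_int]
            norm_num
            rw [hw.level, ← hw.post.cl_eq]
            rfl
      · rw [show w' = w by rw [← hw.level, ← hw'.level]]
    · have : (⨅ w, ⨅ _ : PickPost n K cl (σ + 4 * K + 3) w s₁,
          ENNReal.ofReal (f (Finset.univ.filter fun i => w < cl i) - f S)) = ⊤ := by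
        simp only [iInf_eq_top]
        intro w hw
        exact absurd ⟨w, hw⟩ hex
      rw [this]
      exact Bounded.top _ _ _

end

/-! ### From expected costs to the law of the final state. -/

noncomputable section

variable {n : ℕ} {f : Finset (Fin n) → ℝ} {EO : ℝ}

lemma map_eq_self {α : Type*} (q : PMF α) (g : α → α) (h : ∀ o, q o ≠ 0 → g o = o) :
    q.map g = q := by
  classical
  ext o
  rw [PMF.map_apply]
  have : ∀ a, (if o = g a then q a else 0) = if a = o then q o else 0 := by
    intro a
    by_cases ha : q a = 0
    · by_cases hao : a = o
      · subst hao; simp [ha]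
      · simp [ha, hao]
    · rw [h a ha]
      by_cases hao : a = o
      · subst hao; simp
      · simp [hao, Ne.symm hao]
  simp only [this]
  rw [tsum_ite_eq]

lemma expect_map_some (μ : PMF State) (φ : State → ℝ≥0∞) :
    expect φ (μ.map some) = ∑' s, μ s * φ s := by
  rw [← PMF.bind_pure_comp, expect_bind]
  simp [expect_pure]

/-- Since `S` is a minimizer, all excesses are nonnegative, and the real expectation agrees with a
sum in `[0, ∞]`. -/
lemma expectedValue_sub (μ : PMF State) {S : Finset (Fin n)} (hS : ∀ T, f S ≤ f T) :
    ENNReal.ofReal (expectedValue f μ - f S) =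
      ∑' s, μ s * ENNReal.ofReal (f (output n s) - f S) := by
  classical
  have h1 : ∑ T, ((μ.map (output n)) T).toReal = 1 := by
    rw [← ENNReal.toReal_sum fun T _ => PMF.apply_ne_top _ T,
      ← tsum_fintype (L := .unconditional (Finset (Fin n))), PMF.tsum_coe]
    simp
  have h2 : expectedValue f μ - f S = ∑ T, ((μ.map (output n)) T).toReal * (f T - f S) := by
    simp only [mul_sub, Finset.sum_sub_distrib, ← Finset.sum_mul, h1, one_mul, expectedValue]
  rw [h2, ENNReal.ofReal_sum_of_nonneg fun T _ =>
    mul_nonneg ENNReal.toReal_nonneg (sub_nonneg.2 (hS T))]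
  have h3 : ∀ T, ENNReal.ofReal (((μ.map (output n)) T).toReal * (f T - f S)) =
      ∑' s, if T = output n s then μ s * ENNReal.ofReal (f (output n s) - f S) else 0 := by
    intro T
    rw [ENNReal.ofReal_mul ENNReal.toReal_nonneg, ENNReal.ofReal_toReal (PMF.apply_ne_top _ T),
      PMF.map_apply, ← ENNReal.tsum_mul_right]
    refine tsum_congr fun s => ?_
    split_ifs with h
    · rw [← h]
    · simp
  simp only [h3]
  rw [← tsum_fintype (L := .unconditional (Finset (Fin n))), ENNReal.tsum_comm]
  refine tsum_congr fun s => ?_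
  rw [tsum_ite_eq]

/-- From a bound of an expectation to the law of the final state. -/
lemma exists_law {c : Command} {ε τ v : ℝ} {S : Finset (Fin n)} (hS : ∀ T, f S ≤ f T) (hv : 0 ≤ v)
    (h : Bounded f EO c (initial n ε)
      (fun s => if s.time ≤ τ then ENNReal.ofReal (f (output n s) - f S) else ⊤)
      (ENNReal.ofReal v)) :
    ∃ μ : PMF State, HaltsWithLaw f EO ε c μ ∧ (∀ s ∈ μ.support, s.time ≤ τ) ∧
      expectedValue f μ ≤ f S + v := by
  obtain ⟨d, hd⟩ := h
  set q := run f EO d c (initial n ε) with hq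
  -- The expected cost is finite, so no outcome of positive probability costs `⊤`: none fails and
  -- none is late.
  have hfin : ∀ o, q o ≠ 0 → ∃ s, o = some s ∧ s.time ≤ τ := by
    intro o ho
    have h1 := (ENNReal.le_tsum o).trans hd
    cases o with
    | none =>
      rw [Option.elim_none, ENNReal.mul_top ho] at h1
      exact absurd h1 (by simp)
    | some s =>
      refine ⟨s, rfl, ?_⟩
      by_contra hs
      rw [Option.elim_some, if_neg hs, ENNReal.mul_top ho] at h1
      exact absurd h1 (by simp)
  have hmap : (q.map fun o => o.getD (initial n ε)).map some = q := by
    rw [PMF.map_comp]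
    refine map_eq_self q _ fun o ho => ?_
    obtain ⟨s, rfl, -⟩ := hfin o ho
    rfl
  refine ⟨q.map fun o => o.getD (initial n ε), ⟨d, hmap.symm⟩, ?_, ?_⟩
  · intro s hs
    rw [PMF.support_map] at hs
    obtain ⟨o, ho, rfl⟩ := hs
    obtain ⟨s, rfl, hs⟩ := hfin o ((PMF.mem_support_iff _ _).1 ho)
    exact hs
  · rw [← hmap, expect_map_some] at hd
    have h1 := expectedValue_sub (f := f) (q.map fun o => o.getD (initial n ε)) hS
    have h2 : ENNReal.ofReal (expectedValue f (q.map fun o => o.getD (initial n ε)) - f S) ≤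
        ENNReal.ofReal v := by
      rw [h1]
      refine le_trans (ENNReal.tsum_le_tsum fun s => mul_le_mul_right ?_ _) hd
      split_ifs
      · exact le_rfl
      · exact le_top
    have h3 := (ENNReal.ofReal_le_ofReal_iff hv).1 h2
    linarith

/-- The machine cannot round reals to integers, so `K` and `m` are found by counting upwards; `N`
steps are affordable. -/
lemma countLoop_spec {b N : ℕ} {t : Test} {s : State} (hN : 1 ≤ N) (hs : s.int b 0 = 1)
    (ht : ∀ (q : ℕ) (s' : State), 1 ≤ q → q ≤ N → Same [b] [] s s' → s'.int b 0 = q →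
      (t.Holds s' ↔ q < N)) :
    Ens f EO (.loop t (setI b (.add (iv b) (.const 1)))) s fun s' => s'.int b 0 = N ∧
      s'.time ≤ s.time + 2 * N + 1 := by
  refine Ens.loop_frame (fun l u => ∃ q : ℕ, l = N - q ∧ 1 ≤ q ∧ q ≤ N ∧ u.int b 0 = q ∧
    u.time ≤ s.time + 2 * q) ?_ ?_ (k := N - 1) ⟨1, rfl, le_rfl, hN, by simpa using hs, by simp⟩
  · rintro l u hS ⟨q, rfl, hq1, hqN, hq, htime⟩ h
    have hlt := (ht q u hq1 hqN hS hq).1 h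
    refine Ens.setInt ⟨N - (q + 1), by omega, q + 1, rfl, by omega, hlt, ?_, ?_⟩
    · simp [IntExpr.eval, hq]
    · simp; linarith
  · rintro l u hS ⟨q, rfl, hq1, hqN, hq, htime⟩ h
    rw [ht q u hq1 hqN hS hq] at h
    obtain rfl : q = N := by omega
    exact ⟨hq, by simpa using htime⟩

end

/-! ### Initialization and the whole program. -/

def fillLoop : Command :=
  .loop (.intLE (iv 21) (iv 0)) (.setInt 8 (iv 21) (iv 21) ;; .setInt 9 (iv 21) (iv 21) ;;
    .setInt 13 (iv 21) (iv 21) ;; setI 21 (.add (iv 21) (.const 1)))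

def initCmd : Command :=
  setI 2 (.const 1) ;;
  .loop (.neg (.realLE (.const 12) (.mul (.ofInt (iv 2)) (rv 0))))
    (setI 2 (.add (iv 2) (.const 1))) ;;
  setI 3 (.const 1) ;;
  .loop (.neg (.realLE (.ofInt (iv 0)) (.mul (.mul (.ofInt (.add (iv 3) (.const 1)))
    (.ofInt (.add (iv 3) (.const 1)))) (.ofInt (.add (iv 3) (.const 1))))))
    (setI 3 (.add (iv 3) (.const 1))) ;;
  setI 21 (.const (-1)) ;; fillLoop ;; setI 5 (iv 3) ;; setI 6 (.const 1)

/-- Submodular minimization by stochastic subgradient descent on a grid. -/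
def minimizeCmd : Command :=
  .branch (.realLE (.const 2) (rv 0)) .skip (initCmd ;; mainLoop ;; pickCmd)

noncomputable section

variable {n : ℕ} {f : Finset (Fin n) → ℝ} {EO : ℝ}

lemma fillLoop_spec {s : State} (hn : s.int 0 0 = n) (h21 : s.int 21 0 = -1) :
    Ens f EO fillLoop s fun s' => (∀ p : ℤ, -1 ≤ p → p ≤ n → s'.int 8 p = p ∧ s'.int 9 p = p ∧
      s'.int 13 p = p) ∧ s'.time ≤ s.time + 5 * n + 11 := by
  refine Ens.loop_frame (fun l t => ∃ q : ℕ, l = n + 2 - q ∧ q ≤ n + 2 ∧ t.int 21 0 = q - 1 ∧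
    (∀ p : ℤ, -1 ≤ p → p < (q : ℤ) - 1 → t.int 8 p = p ∧ t.int 9 p = p ∧ t.int 13 p = p) ∧
    t.time ≤ s.time + 5 * q) ?_ ?_ (k := n + 2)
    ⟨0, by omega, by omega, by simpa using h21, by intro z h1 h2; omega, by simp⟩
  · rintro l t hS ⟨q, rfl, hq, hq21, hfill, htime⟩ ht
    have e0 : t.int 0 0 = n := by rw [hS.1 0 (by decide)]; exact hn
    simp only [Test.Holds, IntExpr.eval, hq21, e0] at ht
    refine Ens.seq (Ens.setInt (Ens.seq (Ens.setInt (Ens.seq (Ens.setInt (Ens.setInt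
      ⟨n + 2 - (q + 1), by omega, q + 1, rfl, by omega, ?_, ?_, ?_⟩))))))
    · simp [IntExpr.eval, hq21]
    · intro z hz1 hz2
      push_cast at hz2
      simp [IntExpr.eval, hq21]
      by_cases hz : z = q - 1
      · subst hz; simp
      · rw [Function.update_of_ne hz, Function.update_of_ne hz, Function.update_of_ne hz]
        exact hfill z hz1 (by omega)
    · simp; linarith
  · rintro l t hS ⟨q, rfl, hq, hq21, hfill, htime⟩ ht
    have e0 : t.int 0 0 = n := by rw [hS.1 0 (by decide)]; exact hn
    simp only [Test.Holds, IntExpr.eval, hq21, e0] at ht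
    obtain rfl : q = n + 2 := by omega
    refine ⟨fun p h1 h2 => hfill p h1 (by push_cast; omega), ?_⟩
    push_cast at htime
    simp; linarith

lemma initial_int (n : ℕ) (ε : ℝ) {b : ℕ} (hb : b ≠ 0) (x : ℤ) : (initial n ε).int b x = 0 := by
  simp [initial, Function.update_of_ne hb]

lemma base_init {K : ℕ} {arr pos bl start : ℤ → ℤ}
    (h : ∀ p : ℤ, -1 ≤ p → p ≤ n → arr p = p ∧ pos p = p) (hbl : ∀ x, bl x = 0)
    (hst : ∀ x, start x = 0) : Base n K arr pos bl start where
  arr_neg := (h (-1) le_rfl (by omega)).1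
  arr_n := (h n (by omega) le_rfl).1
  arr_mem p h0 hn := by rw [(h p (by omega) hn.le).1]; exact ⟨h0, hn⟩
  pos_arr p h0 hn := by rw [(h p (by omega) hn.le).1, (h p (by omega) hn.le).2]
  pos_mem p h0 hn := by rw [(h p (by omega) hn.le).2]; exact ⟨h0, hn⟩
  arr_pos p h0 hn := by rw [(h p (by omega) hn.le).2, (h p (by omega) hn.le).1]
  bl_mem i _ _ := by rw [hbl]; omega
  bl_n := hbl _
  start_mem v _ := by rw [hst]; omega
  start_iff v p hv h0 _ := by rw [hbl, hst]; omega

/-- The step counter of the stage starts at its limit `m`, so the first round rebases and thereby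
builds links and tables; this is the extra `m` in `(n * (K * K) + m) / m`. The grid point is the
origin, where every order is sorted. -/
lemma initCmd_spec {K m : ℕ} {ε : ℝ} (hK : 1 ≤ K) (hKε : 12 ≤ K * ε)
    (hK' : ∀ q : ℕ, 1 ≤ q → q < K → q * ε < 12) (hm : 1 ≤ m) (hmn : n ≤ (m + 1) ^ 3)
    (hm' : ∀ q : ℕ, 1 ≤ q → q < m → (q + 1) ^ 3 < n) {α R τ : ℝ}
    (hτ : 20 + 2 * K + 2 * m + 5 * n + n * (K * K) * α + (n * (K * K) + m) / m * R ≤ τ) :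
    Ens f EO initCmd ((initial n ε).tick 1) fun s => levels n s = 0 ∧
      MainInv f K m (n * (K * K)) α R τ s := by
  refine Ens.seq (Ens.setInt (Ens.seq ?_))
  refine (countLoop_spec (N := K) hK ?_ ?_).frame.mono ?_
  · simp [IntExpr.eval]
  · intro q s' hq1 hqK hS hq
    have e0 : s'.real 0 0 = ε := by rw [hS.2 0 (by simp)]; simp [initial]
    simp only [Test.Holds, RealExpr.eval, IntExpr.eval, hq, e0]
    push_cast
    rw [not_le]
    refine ⟨fun h => ?_, fun h => hK' q hq1 h⟩
    by_contra hlt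
    obtain rfl : q = K := by omega
    linarith
  rintro s₁ ⟨hF₁, h2₁, ht₁⟩
  refine Ens.seq (Ens.setInt (Ens.seq ?_))
  refine (countLoop_spec (N := m) hm ?_ ?_).frame.mono ?_
  · simp [IntExpr.eval]
  · intro q s' hq1 hqK hS hq
    have e0 : s'.int 0 0 = n := by
      rw [hS.1 0 (by simp)]
      simp [hF₁.1 0 (by decide), initial]
    simp only [Test.Holds, RealExpr.eval, IntExpr.eval, hq, e0]
    have : ((n : ℤ) : ℝ) ≤ ((q : ℤ) + 1 : ℤ) * ((q : ℤ) + 1 : ℤ) * ((q : ℤ) + 1 : ℤ) ↔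
        n ≤ (q + 1) ^ 3 := by
      rw [pow_succ, pow_two]
      exact_mod_cast Iff.rfl
    rw [this, not_le]
    refine ⟨fun h => ?_, fun h => hm' q hq1 h⟩
    by_contra hlt
    obtain rfl : q = m := by omega
    omega
  rintro s₂ ⟨hF₂, h3₂, ht₂⟩
  refine Ens.seq (Ens.setInt (Ens.seq ?_))
  refine (fillLoop_spec (n := n) ?_ ?_).frame.mono ?_
  · simp [hF₂.1 0 (by decide), hF₁.1 0 (by decide), initial]
  · simp [IntExpr.eval]
  rintro s₃ ⟨hF₃, hfill, ht₃⟩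
  have hz : ∀ b ∈ [1, 4, 7, 10, 11, 12, 16, 17], ∀ x, s₃.int b x = 0 := by
    intro b hb x
    have e1 : s₃.int b = s₂.int b := by fin_cases hb <;> exact hF₃.1 _ (by decide)
    have e2 : s₂.int b = s₁.int b := by fin_cases hb <;> exact hF₂.1 _ (by decide)
    have e3 : s₁.int b = (initial n ε).int b := by fin_cases hb <;> exact hF₁.1 _ (by decide)
    rw [e1, e2, e3]
    refine initial_int n ε ?_ x
    rintro rfl; clear e1 e2 e3; revert hb; decide
  have e0 : s₃.int 0 0 = n := by
    rw [hF₃.1 0 (by decide)]; simp [hF₂.1 0 (by decide), hF₁.1 0 (by decide), initial]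
  have e2 : s₃.int 2 0 = K := by
    rw [hF₃.1 2 (by decide)]; simp [hF₂.1 2 (by decide), h2₁]
  have e3 : s₃.int 3 0 = m := by
    rw [hF₃.1 3 (by decide)]; simp [h3₂]
  refine Ens.seq (Ens.setInt (Ens.setInt ⟨?_, ?_, ?_, ?_, ?_, 0, m, ?_, Nat.zero_le _, le_rfl,
    ⟨?_, ?_, ?_, base_init (fun p h1 h2 => ?_) ?_ ?_, ⟨?_, ?_, ?_⟩, ?_, ?_, ?_⟩, ?_, ?_, ?_⟩))
  · funext i; simp [levels, hz 11 (by decide)]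
  · simpa using e3
  · simp [IntExpr.eval]
  · simp [hz 4 (by decide)]
  · simp [hz 1 (by decide)]
  · simp [IntExpr.eval, e3]
  · simpa using e0
  · simpa using e2
  · simp [hz 7 (by decide)]
  · simpa using ⟨(hfill p h1 h2).1, (hfill p h1 h2).2.1⟩
  · simp [hz 10 (by decide)]
  · simp [hz 12 (by decide)]
  · simp
  · simp
  · simp [hz 17 (by decide)]
  · intro x h1 h2
    simpa using (hfill x (by omega) h2.le).2.2
  · simp [hz 11 (by decide)]
  · simp [hz 10 (by decide), hz 11 (by decide)]
  · simp [hz 10 (by decide), hz 11 (by decide)]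
  · intro h; omega
  · simp [initial] at ht₁ ht₂ ht₃ ⊢
    linarith

end

/-! ### Choice of the parameters and the running time. -/

noncomputable section

lemma exists_least (p : ℕ → Prop) (h : ∃ q, 1 ≤ q ∧ p q) :
    ∃ q, 1 ≤ q ∧ p q ∧ ∀ r, 1 ≤ r → r < q → ¬ p r := by
  classical
  exact ⟨Nat.find h, (Nat.find_spec h).1, (Nat.find_spec h).2,
    fun r h1 h2 h3 => Nat.find_min h h2 ⟨h1, h3⟩⟩

lemma exists_levels {ε : ℝ} (hε : 0 < ε) : ∃ K : ℕ, 1 ≤ K ∧ 12 ≤ K * ε ∧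
    (∀ q : ℕ, 1 ≤ q → q < K → q * ε < 12) := by
  obtain ⟨N, hN⟩ := exists_nat_ge (12 / ε)
  obtain ⟨K, h1, h2, h3⟩ := exists_least (fun q : ℕ => 12 ≤ q * ε) ⟨N + 1, by omega, by
    rw [div_le_iff₀ hε] at hN; push_cast; linarith⟩
  exact ⟨K, h1, h2, fun q h4 h5 => not_le.1 (h3 q h4 h5)⟩

/-- The least `m ≥ 1` with `n ≤ (m + 1)^3`. Minimality gives `m^3 < n`, which for `m = 1` uses `2 ≤
n`. -/
lemma exists_stage_length {n : ℕ} (hn : 2 ≤ n) : ∃ m : ℕ, 1 ≤ m ∧ n ≤ (m + 1) ^ 3 ∧ m ^ 3 < n ∧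
    (∀ q : ℕ, 1 ≤ q → q < m → (q + 1) ^ 3 < n) := by
  obtain ⟨m, h1, h2, h3⟩ := exists_least (fun q : ℕ => n ≤ (q + 1) ^ 3)
    ⟨n, by omega, by nlinarith [sq_nonneg n, sq_nonneg (n + 1)]⟩
  refine ⟨m, h1, h2, ?_, fun q h4 h5 => not_le.1 (h3 q h4 h5)⟩
  by_cases hm : m = 1
  · subst hm; omega
  · have := h3 (m - 1) (by omega) (by omega)
    rwa [not_le, Nat.sub_add_cancel h1] at this

/-- The cost of a step. -/
def stepCost (m : ℕ) (EO : ℝ) : ℝ := (m + (3 * m : ℕ) + 4) * (22 * m + 2 * EO + 40) + 9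

/-- The cost of rebasing. -/
def rebaseCost (n m : ℕ) (EO : ℝ) : ℝ := m * (11 * m + 5) + n * (EO + 24) + EO + 31

/-- The cost of all phases before the final choice of a level. -/
def mainCost (n K m : ℕ) (EO : ℝ) : ℝ :=
  20 + 2 * K + 2 * m + 5 * n + n * (K * K) * stepCost m EO +
    (n * (K * K) + m) / m * rebaseCost n m EO

/-- A step costs about `m (m + EO) ≤ 2 m² EO` up to constants, with `3 m` in place of `log n`.
Rebasing costs `O(n EO)` because `m² ≤ n`; spread over `m` steps, this is `O(m² EO)` by `n ≤ 8 m^3`.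
The constant is `521 + 2 · 584` plus lower-order terms. -/
lemma mainCost_le {n K m : ℕ} {EO : ℝ} (hK : 1 ≤ K) (hm : 1 ≤ m) (hmn : m ^ 3 < n)
    (hnm : n ≤ (m + 1) ^ 3) (hEO : 1 ≤ EO) :
    mainCost n K m EO + 4 * K + 4 * n + 5 ≤ 1800 * (n * (m : ℝ) ^ 2 * (K : ℝ) ^ 2 * EO) := by
  have hK' : (1 : ℝ) ≤ K := by exact_mod_cast hK
  have hm' : (1 : ℝ) ≤ m := by exact_mod_cast hm
  have hmn' : (m : ℝ) ^ 3 ≤ n := by exact_mod_cast hmn.le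
  have hnm' : (n : ℝ) ≤ 8 * (m : ℝ) ^ 3 := by
    have h1 : (n : ℝ) ≤ (m + 1) ^ 3 := by exact_mod_cast hnm
    have h2 : ((m : ℝ) + 1) ^ 3 ≤ (2 * m) ^ 3 := by gcongr; linarith
    linarith
  have hm2 : (m : ℝ) ^ 2 ≤ n := by
    refine le_trans ?_ hmn'
    exact pow_le_pow_right₀ hm' (by norm_num)
  have hmn1 : (m : ℝ) ≤ n := by
    refine le_trans ?_ hm2
    nlinarith
  have hn' : (1 : ℝ) ≤ n := hm'.trans hmn1
  have hmEO : 1 ≤ (m : ℝ) * EO := one_le_mul_of_one_le_of_one_le hm' hEO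
  have hmE : (m : ℝ) ≤ m * EO := le_mul_of_one_le_right (by linarith) hEO
  have hEm : EO ≤ m * EO := le_mul_of_one_le_left (by linarith) hm'
  have hm2EO : 1 ≤ (m : ℝ) ^ 2 * EO := one_le_mul_of_one_le_of_one_le (one_le_pow₀ hm') hEO
  have hα : stepCost m EO ≤ 521 * (m ^ 2 * EO) := by
    have h1 : (m : ℝ) + (3 * m : ℕ) + 4 ≤ 8 * m := by push_cast; linarith
    have h2 : 22 * (m : ℝ) + 2 * EO + 40 ≤ 64 * (m * EO) := by linarith
    have h3 : ((m : ℝ) + (3 * m : ℕ) + 4) * (22 * m + 2 * EO + 40) ≤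
        8 * m * (64 * (m * EO)) := by gcongr
    unfold stepCost
    linarith
  have hnE : (n : ℝ) ≤ n * EO := le_mul_of_one_le_right (by linarith) hEO
  have hEn : EO ≤ n * EO := le_mul_of_one_le_left (by linarith) hn'
  have hR : rebaseCost n m EO ≤ 73 * (n * EO) := by
    unfold rebaseCost
    have : (m : ℝ) * (11 * m + 5) ≤ 16 * m ^ 2 := by nlinarith
    have : (n : ℝ) * (EO + 24) = n * EO + 24 * n := by ring
    linarith
  have hRm : rebaseCost n m EO / m ≤ 584 * (m ^ 2 * EO) := by
    rw [div_le_iff₀ (by linarith)]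
    have : 73 * (n * EO) ≤ 73 * (8 * (m : ℝ) ^ 3 * EO) := by gcongr
    calc _ ≤ _ := hR
      _ ≤ _ := this
      _ = _ := by ring
  have hKK : 1 ≤ (K : ℝ) ^ 2 := one_le_pow₀ hK'
  have hKK' : (K : ℝ) ≤ K ^ 2 := by nlinarith
  have hnKK : (n : ℝ) ≤ n * K ^ 2 := le_mul_of_one_le_right (by linarith) hKK
  have hKn : (K : ℝ) ≤ n * K ^ 2 := hKK'.trans (le_mul_of_one_le_left (by linarith) hn')
  have hXn : (n : ℝ) * K ^ 2 ≤ n * K ^ 2 * (m ^ 2 * EO) :=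
    le_mul_of_one_le_right (by linarith) hm2EO
  have h1 : (n : ℝ) * (K * K) * stepCost m EO ≤ n * (K * K) * (521 * (m ^ 2 * EO)) := by gcongr
  have h2 : ((n : ℝ) * (K * K) + m) / m * rebaseCost n m EO ≤
      (n * K ^ 2 + n * K ^ 2) * (584 * (m ^ 2 * EO)) := by
    calc ((n : ℝ) * (K * K) + m) / m * rebaseCost n m EO =
          (n * (K * K) + m) * (rebaseCost n m EO / m) := by ring
      _ ≤ (n * (K * K) + m) * (584 * (m ^ 2 * EO)) := by gcongr
      _ ≤ _ := by
        gcongr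
        · rw [pow_two]
        · linarith
  unfold mainCost
  linarith

lemma time_le {n K m : ℕ} {EO ε : ℝ} (hn : 2 ≤ n) (hε : 0 < ε) (hε2 : ε < 2) (hK : 1 ≤ K)
    (hKε : ∀ q : ℕ, 1 ≤ q → q < K → q * ε < 12) (hm : 1 ≤ m) (hmn : m ^ 3 < n)
    (hnm : n ≤ (m + 1) ^ 3) (hEO : 1 ≤ EO) :
    mainCost n K m EO + 4 * K + 4 * n + 5 ≤ (352800 / Real.log 2 ^ 4 + 2) *
      (1 + (n : ℝ) ^ ((5 : ℝ) / 3) * (ε ^ 2)⁻¹ * EO * Real.log n ^ 4) := by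
  -- By minimality `(K - 1) ε < 12`, and `ε < 2`.
  have hK14 : (K : ℝ) ≤ 14 / ε := by
    rw [le_div_iff₀ hε]
    rcases eq_or_lt_of_le hK with h | h
    · rw [← h]; push_cast; linarith
    · have := hKε (K - 1) (by omega) (by omega)
      rw [Nat.cast_sub hK] at this
      push_cast at this
      linarith
  have hn0 : (0 : ℝ) < n := by positivity
  have hm2 : (m : ℝ) ^ 2 ≤ (n : ℝ) ^ ((2 : ℝ) / 3) := by
    have h1 : (m : ℝ) ^ 3 ≤ n := by exact_mod_cast hmn.le
    have h2 : (m : ℝ) ^ 2 = ((m : ℝ) ^ 3) ^ ((2 : ℝ) / 3) := by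
      rw [← Real.rpow_natCast (m : ℝ) 3, ← Real.rpow_mul (by positivity), ← Real.rpow_natCast]
      norm_num
    rw [h2]
    exact Real.rpow_le_rpow (by positivity) h1 (by norm_num)
  have hnm2 : n * (m : ℝ) ^ 2 ≤ (n : ℝ) ^ ((5 : ℝ) / 3) := by
    calc n * (m : ℝ) ^ 2 ≤ n * (n : ℝ) ^ ((2 : ℝ) / 3) := by gcongr
      _ = (n : ℝ) ^ ((5 : ℝ) / 3) := by
        nth_rewrite 1 [← Real.rpow_one (n : ℝ)]
        rw [← Real.rpow_add hn0]
        norm_num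
  have hlog2 : 0 < Real.log 2 := Real.log_pos (by norm_num)
  have hlog : Real.log 2 ≤ Real.log n := Real.log_le_log (by norm_num) (by exact_mod_cast hn)
  have hlog4 : 1 ≤ Real.log n ^ 4 / Real.log 2 ^ 4 := by
    rw [one_le_div (by positivity)]
    gcongr
  set Y := (n : ℝ) ^ ((5 : ℝ) / 3) * (ε ^ 2)⁻¹ * EO with hY
  have hY0 : 0 ≤ Y := by positivity
  calc mainCost n K m EO + 4 * K + 4 * n + 5
      ≤ 1800 * (n * (m : ℝ) ^ 2 * (K : ℝ) ^ 2 * EO) := mainCost_le hK hm hmn hnm hEO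
    _ ≤ 1800 * ((n : ℝ) ^ ((5 : ℝ) / 3) * (14 / ε) ^ 2 * EO) := by gcongr
    _ = 352800 * Y * 1 := by rw [hY, div_pow]; ring
    -- `352800 = 1800 · 14²`. The logarithm is only used through `log 2 ≤ log n`.
    _ ≤ 352800 * Y * (Real.log n ^ 4 / Real.log 2 ^ 4) := by gcongr
    _ = 352800 / Real.log 2 ^ 4 * (Y * Real.log n ^ 4) := by ring
    _ ≤ _ := by
      have h1 : 0 ≤ Y * Real.log n ^ 4 := by positivity
      have h2 : 0 ≤ 352800 / Real.log 2 ^ 4 := by positivity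
      nlinarith

variable {n : ℕ} {f : Finset (Fin n) → ℝ} {EO : ℝ}

lemma sqDist_zero_le (K : ℕ) (S : Finset (Fin n)) : sqDist K S 0 ≤ n * (K * K) := by
  unfold sqDist
  calc ∑ i : Fin n, (((0 : Fin n → ℤ) i : ℝ) - (K : ℤ) * if i ∈ S then 1 else 0) ^ 2
      ≤ ∑ _i : Fin n, (K : ℝ) * K := by
        refine Finset.sum_le_sum fun i _ => ?_
        split_ifs
        · apply le_of_eq; simp; ring
        · simp; positivity
    _ = n * (K * K) := by simp

lemma minimizeCmd_spec (hn : 2 ≤ n) (hf : Submodular f) (hb : ∀ S, |f S| ≤ 1)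
    {S : Finset (Fin n)} (hS : ∀ T, f S ≤ f T) {ε : ℝ} (hε : 0 < ε) (hEO : 1 ≤ EO) {τ : ℝ}
    (hτ : τ = (352800 / Real.log 2 ^ 4 + 2) *
      (1 + (n : ℝ) ^ ((5 : ℝ) / 3) * (ε ^ 2)⁻¹ * EO * Real.log n ^ 4)) :
    Bounded f EO minimizeCmd (initial n ε)
      (fun s => if s.time ≤ τ then ENNReal.ofReal (f (output n s) - f S) else ⊤)
      (ENNReal.ofReal ε) := by
  refine Bounded.branch (fun ht => ?_) (fun ht => ?_)
  -- For such `ε` the untouched output is good enough, as values of `f` differ by at most `2`. The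
  -- run takes 2 units, which the summand `2` in the constant pays for.
  · have hε2 : 2 ≤ ε := by
      simp only [Test.Holds, RealExpr.eval, IntExpr.eval, initial, Function.update_self] at ht
      exact_mod_cast ht
    refine Bounded.skip ?_
    rw [if_pos]
    · refine ENNReal.ofReal_le_ofReal ?_
      have h1 := abs_le.1 (hb S)
      have h2 := abs_le.1 (hb (output n (((initial n ε).tick 1).tick 1)))
      linarith
    · have h1 : 0 ≤ 352800 / Real.log 2 ^ 4 := by positivity
      have h2 : 0 ≤ (n : ℝ) ^ ((5 : ℝ) / 3) * (ε ^ 2)⁻¹ * EO * Real.log n ^ 4 := by positivity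
      rw [hτ]
      simp [initial]
      nlinarith
  · have hε2 : ε < 2 := by
      simp only [Test.Holds, RealExpr.eval, IntExpr.eval, initial, Function.update_self] at ht
      rw [not_le] at ht
      exact_mod_cast ht
    obtain ⟨K, hK, hKε, hKmin⟩ := exists_levels hε
    obtain ⟨m, hm, hnm, hmn, hmmin⟩ := exists_stage_length hn
    have hK' : (0 : ℝ) < K := by exact_mod_cast hK
    have hT : 1 ≤ n * (K * K) := Nat.one_le_iff_ne_zero.2 (by positivity)
    have hmn' : m < n := (Nat.le_self_pow (by norm_num) m).trans_lt hmn
    -- From `n ≤ (m + 1)^3` and `m + 1 ≤ 2^m`, at most `3 m` halvings suffice, so the binary search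
    -- costs no more than the marked elements.
    have he : n ≤ 2 ^ (3 * m) := by
      rw [mul_comm, pow_mul]
      exact hnm.trans (Nat.pow_le_pow_left Nat.lt_two_pow_self 3)
    refine Ens.seq_bounded ((initCmd_spec (f := f) (EO := EO) (τ := mainCost n K m EO)
      (α := stepCost m EO) (R := rebaseCost n m EO) hK hKε hKmin hm hnm hmmin le_rfl).mono ?_)
    rintro s ⟨hlev, hinv⟩
    refine Bounded.seq (ψ := fun s' => ⨅ cl, ⨅ _ : MainPost n K cl (mainCost n K m EO) s',
      ENNReal.ofReal (gap f K S cl / K)) (Bounded.mono (mainLoop_spec (S := S) (K := K) (m := m)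
      (e := 3 * m) (α := stepCost m EO) (R := rebaseCost n m EO) (τ := mainCost n K m EO) hf hb hS
      (by omega) (by omega) hmn' he (by linarith) le_rfl le_rfl (fun cl s' h => iInf₂_le cl h)
      (n * (K * K) - 1) s (by rwa [Nat.sub_add_cancel hT])) (fun _ => le_rfl)
      (ENNReal.ofReal_le_ofReal ?_)) ?_
    · rw [hlev, Nat.cast_sub hT]
      have hT' : (0 : ℝ) < (n * (K * K) : ℕ) := by exact_mod_cast hT
      -- The squared distance from the origin to any scaled vertex is at most `n K²`, the number of
      -- rounds; the bound of the main loop becomes `12 / K`.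
      have h1 : sqDist K S (0 : Fin n → ℤ) / ((n * (K * K) : ℕ) - (1 : ℕ) + 1) ≤ 1 := by
        push_cast at hT' ⊢
        rw [sub_add_cancel, div_le_one hT']
        exact sqDist_zero_le K S
      calc _ ≤ 6 / (K : ℝ) * (1 + 1) := by gcongr
        _ = 12 / K := by ring
        _ ≤ ε := by rw [div_le_iff₀ hK']; linarith
    · intro s'
      by_cases hex : ∃ cl, MainPost n K cl (mainCost n K m EO) s'
      · obtain ⟨cl, hcl⟩ := hex
        refine Bounded.mono (pickCmd_spec (τ := τ) (by omega) hS hcl ?_ fun s'' h => ?_)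
          (fun _ => le_rfl) (le_iInf₂ fun cl' hcl' => ?_)
        · rw [hτ]
          exact time_le hn hε hε2 hK hKmin hm hmn hnm hEO
        · rw [if_pos h]
        · rw [← hcl.cl_eq, ← hcl'.cl_eq]
      · have : (⨅ cl, ⨅ _ : MainPost n K cl (mainCost n K m EO) s',
            ENNReal.ofReal (gap f K S cl / K)) = ⊤ := by
          simp only [iInf_eq_top]
          intro cl hcl
          exact absurd ⟨cl, hcl⟩ hex
        rw [this]
        exact Bounded.top _ _ _

end

end RealRAM

theorem mainTheorem2 :
    ∃ (c : RealRAM.Command) (C : ℝ), 0 < C ∧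
      ∀ (n : ℕ), 2 ≤ n → ∀ f : Finset (Fin n) → ℝ, Submodular f → (∀ S, |f S| ≤ 1) →
        ∀ ε : ℝ, 0 < ε → ∀ EO : ℝ, 1 ≤ EO →
          ∃ μ : PMF RealRAM.State, RealRAM.HaltsWithLaw f EO ε c μ ∧
            (∀ s ∈ μ.support, s.time ≤
              C * (1 + (n : ℝ) ^ ((5 : ℝ) / 3) * (ε ^ 2)⁻¹ * EO * Real.log n ^ 4)) ∧
            RealRAM.expectedValue f μ ≤ optValue f + ε := by
  refine ⟨RealRAM.minimizeCmd, 352800 / Real.log 2 ^ 4 + 2, by positivity, ?_⟩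
  intro n hn f hf hb ε hε EO hEO
  obtain ⟨S, -, hS⟩ := Finset.exists_mem_eq_inf' Finset.univ_nonempty f
  have hmin : ∀ T, f S ≤ f T := fun T => hS ▸ Finset.inf'_le f (Finset.mem_univ T)
  have hopt : optValue f = f S := hS
  rw [hopt]
  exact RealRAM.exists_law hmin hε.le (RealRAM.minimizeCmd_spec hn hf hb hmin hε hEO rfl)
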